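/- Let $\mathbb T=\mathbb R/\mathbb Z$, $d\ge 1$, $\lambda\in\mathbb R\setminus\{0\}$ and $T>0$, and consider the logarithmic Schrödinger equation $$i\partial_t u+\Delta u+\lambda u\log(|u|^2)=0,\qquad u_{\mid t=0}=u_0,\qquad (t,x)\in[0,T]\times\mathbb T^d, \tag{1}$$ where $u\log(|u|^2)$ is read as $0$ where $u=0$. For $s\ge 0$, $H^s(\mathbb T^d)$ is the space of all $f\in L^2(\mathbb T^d)$ with $\|f\|_{H^s}^2=\sum_{n\in\mathbb Z^d}(1+|2\pi n|^2)^s|\hat f(n)|^2<\infty$; in particular $H^0=L^2$. For $u_0\in H^s(\mathbb T^d)$, a weak $H^s$ solution of (1) on $[0,T]$ is a function $u\in L^\infty([0,T],H^s(\mathbb T^d))$ such that (i) the equation in (1) holds in the sense of distributions on $(0,T)\times\mathbb T^d$, i.e. for every $\varphi\in C_c^\infty((0,T)\times\mathbb T^d)$, $$\int_0^T\!\!\int_{\mathbb T^d}\Big(u\,(-i\partial_t\varphi+\Delta\varphi)+\lambda u\log(|u|^2)\,\varphi\Big)\,dx\,dt=0;$$ (ii) $u_{\mid t=0}=u_0$,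 in the sense that for every $\psi\in C^\infty(\mathbb T^d)$ the essential limit of $\int_{\mathbb T^d}u(t)\psi\,dx$ as $t\downarrow 0$ is $\int_{\mathbb T^d}u_0\psi\,dx$ (equivalently, the weakly continuous representative of $u$ takes the value $u_0$ at $t=0$). Then the following hold. 1. Let $s\in(0,1)$. For any $u_0\in H^s(\mathbb T^d)$, weak $H^s$ solutions of (1) on $[0,T]$ are unique: if $u$ and $v$ are weak $H^s$ solutions of (1) on $[0,T]$ with the same initial value $u_0$, then $u=v$ in $L^\infty([0,T],H^s(\mathbb T^d))$. 2. Let $d=1$. For any $u_0\in L^2(\mathbb T)$, weak $L^2$ solutions (that is, weak $H^0$ solutions) of (1) on $[0,T]$ are unique: if $u$ and $v$ are weak $L^2$ solutions of (1) on $[0,T]$ with the same initial value $u_0$, then $u=v$ in $L^\infty([0,T],L^2(\mathbb T))$. -/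

import Mathlib

open MeasureTheory Filter Topology
open scoped ContDiff ENNReal

/-- Normalised Lebesgue (Haar) measure on the torus `𝕋^d = (ℝ/ℤ)^d`. -/
noncomputable abbrev torusMeasure (d : ℕ) : Measure (UnitAddTorus (Fin d)) :=
  Measure.pi fun _ => AddCircle.haarAddCircle

/-- The complex Hilbert space `L²(𝕋^d)`. -/
abbrev L2Torus (d : ℕ) : Type := Lp ℂ 2 (torusMeasure d)

/-- The square root `(1 + |2πn|²)^{s/2}` of the Sobolev weight at the frequency `n ∈ ℤ^d`. -/
noncomputable def sobolevWeight {d : ℕ} (s : ℝ) (n : Fin d → ℤ) : ℝ :=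
  (1 + (2 * Real.pi) ^ 2 * ∑ j, (n j : ℝ) ^ 2) ^ (s / 2)

/-- Sobolev-weighted Fourier coefficients `(1 + |2πn|²)^{s/2} f̂(n)` of `f ∈ L²(𝕋^d)`. -/
noncomputable def weightedCoeff {d : ℕ} (s : ℝ) (f : L2Torus d) (n : Fin d → ℤ) : ℂ :=
  (sobolevWeight s n : ℂ) * UnitAddTorus.mFourierCoeff (f : UnitAddTorus (Fin d) → ℂ) n

theorem weightedCoeff_eq_repr {d : ℕ} (s : ℝ) (f : L2Torus d) (n : Fin d → ℤ) :
    weightedCoeff s f n =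
      (sobolevWeight s n : ℂ) * UnitAddTorus.mFourierBasis.repr f n := by
  rw [weightedCoeff]
  congr 1
  exact (UnitAddTorus.mFourierBasis_repr f n).symm

theorem weightedCoeff_add {d : ℕ} (s : ℝ) (f g : L2Torus d) :
    weightedCoeff s (f + g) = weightedCoeff s f + weightedCoeff s g := by
  funext n
  simp only [Pi.add_apply, weightedCoeff_eq_repr]
  erw [map_add]
  rw [lp.coeFn_add, Pi.add_apply, mul_add]

theorem weightedCoeff_smul {d : ℕ} (s : ℝ) (c : ℂ) (f : L2Torus d) :
    weightedCoeff s (c • f) = c • weightedCoeff s f := by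
  funext n
  simp only [Pi.smul_apply, weightedCoeff_eq_repr]
  erw [map_smul]
  rw [lp.coeFn_smul, Pi.smul_apply, smul_eq_mul, smul_eq_mul]
  ring

theorem weightedCoeff_zero {d : ℕ} (s : ℝ) : weightedCoeff s (0 : L2Torus d) = 0 := by
  have h := weightedCoeff_smul s 0 (0 : L2Torus d)
  rwa [zero_smul, zero_smul] at h

theorem sobolevWeight_pos {d : ℕ} (s : ℝ) (n : Fin d → ℤ) : 0 < sobolevWeight s n := by
  unfold sobolevWeight
  positivity

theorem weightedCoeff_injective {d : ℕ} (s : ℝ) {f g : L2Torus d}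
    (h : weightedCoeff s f = weightedCoeff s g) : f = g := by
  have hr : UnitAddTorus.mFourierBasis.repr f = UnitAddTorus.mFourierBasis.repr g := by
    ext n
    have hn := congrFun h n
    rw [weightedCoeff_eq_repr, weightedCoeff_eq_repr] at hn
    exact mul_left_cancel₀ (by exact_mod_cast (sobolevWeight_pos s n).ne') hn
  exact UnitAddTorus.mFourierBasis.repr.injective hr

/-- The functions `f ∈ L²(𝕋^d)` with `∑ₙ (1 + |2πn|²)^s |f̂(n)|² < ∞`. -/
noncomputable def sobolevSubmodule (d : ℕ) (s : ℝ) : Submodule ℂ (L2Torus d) where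
  carrier := {f | Memℓp (weightedCoeff s f) 2}
  zero_mem' := by
    simp only [Set.mem_ofPred_eq, weightedCoeff_zero]
    exact zero_memℓp
  add_mem' := by
    intro f g hf hg
    simp only [Set.mem_ofPred_eq, weightedCoeff_add] at *
    exact hf.add hg
  smul_mem' := by
    intro c f hf
    simp only [Set.mem_ofPred_eq, weightedCoeff_smul] at *
    exact hf.const_smul c

/-- The Sobolev space `H^s(𝕋^d)`, `s ≥ 0`. It is a type of its own, because its norm is not the one
inherited from `L²(𝕋^d)`. -/
def SobolevTorus (d : ℕ) (s : ℝ) : Type := sobolevSubmodule d s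

noncomputable instance SobolevTorus.instAddCommGroup (d : ℕ) (s : ℝ) :
    AddCommGroup (SobolevTorus d s) :=
  inferInstanceAs (AddCommGroup (sobolevSubmodule d s))

noncomputable instance SobolevTorus.instModule (d : ℕ) (s : ℝ) : Module ℂ (SobolevTorus d s) :=
  inferInstanceAs (Module ℂ (sobolevSubmodule d s))

/-- The inclusion `H^s(𝕋^d) ⊆ L²(𝕋^d)`. -/
noncomputable def SobolevTorus.toL2 {d : ℕ} {s : ℝ} : SobolevTorus d s →ₗ[ℂ] L2Torus d :=
  (sobolevSubmodule d s).subtype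

/-- The linear injection `f ↦ ((1 + |2πn|²)^{s/2} f̂(n))ₙ` of `H^s(𝕋^d)` into `ℓ²(ℤ^d)`. -/
noncomputable def SobolevTorus.toSeq {d : ℕ} {s : ℝ} :
    SobolevTorus d s →ₗ[ℂ] lp (fun _ : Fin d → ℤ => ℂ) 2 where
  toFun f := ⟨weightedCoeff s f.toL2, f.2⟩
  map_add' f g := Subtype.ext (by
    simp only [map_add, weightedCoeff_add]
    rfl)
  map_smul' c f := Subtype.ext (by
    simp only [map_smul, weightedCoeff_smul]
    rfl)

theorem SobolevTorus.toSeq_injective {d : ℕ} {s : ℝ} :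
    Function.Injective (SobolevTorus.toSeq (d := d) (s := s)) := by
  intro f g h
  exact Subtype.ext (weightedCoeff_injective s (congrArg Subtype.val h))

/-- The norm of `H^s(𝕋^d)`: the `ℓ²` norm of the weighted Fourier coefficients. -/
noncomputable instance SobolevTorus.instNormedAddCommGroup (d : ℕ) (s : ℝ) :
    NormedAddCommGroup (SobolevTorus d s) :=
  NormedAddCommGroup.induced _ _ SobolevTorus.toSeq SobolevTorus.toSeq_injective

noncomputable instance SobolevTorus.instNormedSpace (d : ℕ) (s : ℝ) :
    NormedSpace ℂ (SobolevTorus d s) :=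
  NormedSpace.induced ℂ (SobolevTorus d s) _ SobolevTorus.toSeq

/-- `‖f‖²_{H^s} = ∑ₙ (1 + |2πn|²)^s |f̂(n)|²`. -/
theorem SobolevTorus.norm_sq_eq {d : ℕ} {s : ℝ} (f : SobolevTorus d s) :
    ‖f‖ ^ 2 = ∑' n : Fin d → ℤ, (1 + (2 * Real.pi) ^ 2 * ∑ j, (n j : ℝ) ^ 2) ^ s *
      ‖UnitAddTorus.mFourierCoeff (f.toL2 : UnitAddTorus (Fin d) → ℂ) n‖ ^ 2 := by
  have h : ‖f‖ = ‖SobolevTorus.toSeq f‖ := rfl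
  have h2 := lp.norm_rpow_eq_tsum (p := 2) (by norm_num) (SobolevTorus.toSeq f)
  simp only [ENNReal.toReal_ofNat, Real.rpow_ofNat] at h2
  rw [h, h2]
  refine tsum_congr fun n => ?_
  have h3 : (SobolevTorus.toSeq f : (Fin d → ℤ) → ℂ) n = weightedCoeff s f.toL2 n := rfl
  rw [h3, weightedCoeff, norm_mul, mul_pow, Complex.norm_real, Real.norm_eq_abs, sq_abs,
    sobolevWeight, ← Real.rpow_natCast, ← Real.rpow_mul (by positivity)]
  congr 2
  push_cast
  ring

/-- The nonlinearity `g(z) = λ z log(|z|²)`, with `g(0) = 0`. -/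
noncomputable def logNonlinearity (lam : ℝ) (z : ℂ) : ℂ :=
  (lam : ℂ) * z * (Real.log (‖z‖ ^ 2) : ℂ)

/-- A function on `𝕋^d` is smooth if its `ℤ^d`-periodic lift to `ℝ^d` is. -/
def IsSmoothOnTorus {d : ℕ} (ψ : UnitAddTorus (Fin d) → ℂ) : Prop :=
  ContDiff ℝ ∞ fun x : Fin d → ℝ => ψ fun j => (x j : UnitAddCircle)

/-- `φ ∈ C_c^∞((0,T) × 𝕋^d)`, the space of test functions on `(0,T) × 𝕋^d`. -/
structure IsSpaceTimeTest {d : ℕ} (T : ℝ) (φ : ℝ → UnitAddTorus (Fin d) → ℂ) : Prop where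
  smooth : ContDiff ℝ ∞ fun p : ℝ × (Fin d → ℝ) => φ p.1 fun j => (p.2 j : UnitAddCircle)
  compactSupport : ∃ a b : ℝ, 0 < a ∧ b < T ∧ ∀ t, t ∉ Set.Icc a b → ∀ x, φ t x = 0

/-- The Laplacian `∑ⱼ ∂ⱼ² ψ` on `𝕋^d`; the second partial derivatives are taken along the
translations `h ↦ x + h eⱼ`. -/
noncomputable def torusLaplacian {d : ℕ} (ψ : UnitAddTorus (Fin d) → ℂ)
    (x : UnitAddTorus (Fin d)) : ℂ :=
  ∑ j, iteratedDeriv 2 (fun h : ℝ => ψ (x + Pi.single j (h : UnitAddCircle))) 0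

/-- `i ∂ₜu + Δu + λ u log(|u|²) = 0` in the sense of distributions on `(0,T) × 𝕋^d`. -/
def SolvesLogNLS {d : ℕ} (lam T : ℝ) (u : ℝ → L2Torus d) : Prop :=
  ∀ φ : ℝ → UnitAddTorus (Fin d) → ℂ, IsSpaceTimeTest T φ →
    ∫ t in Set.Icc 0 T, ∫ x,
      (u t x * (-Complex.I * deriv (fun τ => φ τ x) t + torusLaplacian (φ t) x)
        + logNonlinearity lam (u t x) * φ t x) ∂(torusMeasure d) = 0

/-- `u|_{t=0} = u₀`: for every `ψ ∈ C^∞(𝕋^d)`, the essential limit of `∫ u(t) ψ dx` as `t ↓ 0` is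
`∫ u₀ ψ dx`. The notion depends only on the class of `u` modulo equality for almost every `t`; if
`u` has a representative that is weakly continuous on `[0,T]`, it says that the value at `t = 0` of
this representative is `u₀`. -/
def HasInitialValue {d : ℕ} (u : ℝ → L2Torus d) (u₀ : L2Torus d) : Prop :=
  ∀ ψ : UnitAddTorus (Fin d) → ℂ, IsSmoothOnTorus ψ →
    Tendsto (fun t => ∫ x, u t x * ψ x ∂(torusMeasure d)) (𝓝[>] (0 : ℝ) ⊓ ae volume)
      (𝓝 (∫ x, u₀ x * ψ x ∂(torusMeasure d)))

/-- `u ∈ L^∞([0,T], H^s(𝕋^d))` is a weak `H^s` solution on `[0,T]` with initial value `u₀`. -/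
def IsWeakHsSolution {d : ℕ} {s : ℝ} (lam T : ℝ) (u₀ : SobolevTorus d s)
    (u : Lp (SobolevTorus d s) ∞ (volume.restrict (Set.Icc (0 : ℝ) T))) : Prop :=
  SolvesLogNLS lam T (fun t => (u t).toL2) ∧ HasInitialValue (fun t => (u t).toL2) u₀.toL2

/-- `u ∈ L^∞([0,T], L²(𝕋^d))` is a weak `L²` solution on `[0,T]` with initial value `u₀`. -/
def IsWeakL2Solution {d : ℕ} (lam T : ℝ) (u₀ : L2Torus d)
    (u : Lp (L2Torus d) ∞ (volume.restrict (Set.Icc (0 : ℝ) T))) : Prop :=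
  SolvesLogNLS lam T u ∧ HasInitialValue u u₀

open MeasureTheory Filter Topology
open scoped ContDiff ENNReal ComplexConjugate

theorem logNonlinearity_eq (lam : ℝ) (z : ℂ) :
    logNonlinearity lam z = ((2 * lam * Real.log ‖z‖ : ℝ) : ℂ) * z := by
  unfold logNonlinearity
  rw [Real.log_pow]
  push_cast
  ring

theorem continuous_logNonlinearity (lam : ℝ) : Continuous (logNonlinearity lam) := by
  rw [continuous_iff_continuousAt]
  intro z
  by_cases hz : z = 0
  · subst hz
    rw [ContinuousAt, logNonlinearity_eq lam 0, mul_zero, tendsto_zero_iff_norm_tendsto_zero]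
    have h : Continuous fun z : ℂ => |2 * lam| * |‖z‖ * Real.log ‖z‖| := by
      have := Real.continuous_mul_log.comp (continuous_norm (E := ℂ))
      exact continuous_const.mul this.abs
    have h0 := h.tendsto 0
    simp only [norm_zero, zero_mul, abs_zero, mul_zero] at h0
    refine h0.congr fun z => ?_
    rw [logNonlinearity_eq, norm_mul, Complex.norm_real, Real.norm_eq_abs]
    simp only [abs_mul, abs_norm]
    ring
  · unfold logNonlinearity
    refine ContinuousAt.mul (by fun_prop) ?_
    refine Complex.continuous_ofReal.continuousAt.comp ?_
    exact ContinuousAt.log (by fun_prop) (by simpa using hz)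

theorem abs_mul_log_le {r : ℝ} (hr : 0 ≤ r) : r * |Real.log r| ≤ 2 * (1 + r ^ (3 / 2 : ℝ)) := by
  have h32 : 0 ≤ r ^ (3 / 2 : ℝ) := Real.rpow_nonneg hr _
  rcases hr.eq_or_lt with rfl | hr0
  · simp
  rcases le_total r 1 with h1 | h1
  · have h2 := Real.abs_log_mul_self_lt r hr0 h1
    rw [abs_mul, abs_of_pos hr0] at h2
    linarith
  · rw [abs_of_nonneg (Real.log_nonneg h1)]
    have h2 : Real.log r ≤ 2 * r ^ (1 / 2 : ℝ) := by
      have := Real.log_le_rpow_div hr (show (0 : ℝ) < 1 / 2 by norm_num)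
      linarith
    have h3 : r ^ (3 / 2 : ℝ) = r * r ^ (1 / 2 : ℝ) := by
      rw [show (3 / 2 : ℝ) = 1 + 1 / 2 by norm_num, Real.rpow_add hr0, Real.rpow_one]
    rw [h3]
    nlinarith

theorem norm_logNonlinearity (lam : ℝ) (z : ℂ) :
    ‖logNonlinearity lam z‖ = 2 * |lam| * (‖z‖ * |Real.log ‖z‖|) := by
  rw [logNonlinearity_eq, norm_mul, Complex.norm_real, Real.norm_eq_abs, abs_mul, abs_mul,
    abs_of_pos (show (0 : ℝ) < 2 by norm_num)]
  ring

theorem norm_logNonlinearity_le (lam : ℝ) (z : ℂ) :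
    ‖logNonlinearity lam z‖ ≤ 4 * |lam| * (1 + ‖z‖ ^ (3 / 2 : ℝ)) := by
  rw [norm_logNonlinearity]
  have := abs_mul_log_le (norm_nonneg z)
  nlinarith [abs_nonneg lam]

theorem norm_logNonlinearity_le_sq (lam : ℝ) (z : ℂ) :
    ‖logNonlinearity lam z‖ ≤ 8 * |lam| * (1 + ‖z‖ ^ 2) := by
  refine (norm_logNonlinearity_le lam z).trans ?_
  have h : ‖z‖ ^ (3 / 2 : ℝ) ≤ 1 + ‖z‖ ^ 2 := by
    rcases le_total ‖z‖ 1 with h | h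
    · have := Real.rpow_le_one (norm_nonneg z) h (show (0 : ℝ) ≤ 3 / 2 by norm_num)
      nlinarith [sq_nonneg ‖z‖]
    · have := Real.rpow_le_rpow_of_exponent_le h (show (3 / 2 : ℝ) ≤ 2 by norm_num)
      rw [Real.rpow_two] at this
      linarith
  nlinarith [abs_nonneg lam, sq_nonneg ‖z‖]

/-- The power `4/3` of the nonlinearity grows at most quadratically. -/
theorem norm_logNonlinearity_rpow_le (lam : ℝ) (z : ℂ) :
    ‖logNonlinearity lam z‖ ^ (4 / 3 : ℝ) ≤ (8 * |lam|) ^ (4 / 3 : ℝ) * (1 + ‖z‖ ^ 2) := by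
  have h32 : 0 ≤ ‖z‖ ^ (3 / 2 : ℝ) := Real.rpow_nonneg (norm_nonneg z) _
  have h : ‖logNonlinearity lam z‖ ≤ 8 * |lam| * max 1 (‖z‖ ^ (3 / 2 : ℝ)) := by
    refine (norm_logNonlinearity_le lam z).trans ?_
    have h1 := le_max_left 1 (‖z‖ ^ (3 / 2 : ℝ))
    have h2 := le_max_right 1 (‖z‖ ^ (3 / 2 : ℝ))
    nlinarith [abs_nonneg lam]
  refine (Real.rpow_le_rpow (norm_nonneg _) h (by norm_num)).trans ?_
  rw [Real.mul_rpow (by positivity) (by positivity)]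
  refine mul_le_mul_of_nonneg_left ?_ (by positivity)
  rcases max_choice 1 (‖z‖ ^ (3 / 2 : ℝ)) with h | h <;> rw [h]
  · rw [Real.one_rpow]
    nlinarith [sq_nonneg ‖z‖]
  · rw [← Real.rpow_mul (norm_nonneg z)]
    norm_num

theorem abs_log_sub_log_mul_le {a b : ℝ} (ha : 0 < a) (hb : 0 < b) :
    |Real.log a - Real.log b| * min a b ≤ |a - b| := by
  wlog h : b ≤ a generalizing a b
  · have := this hb ha (le_of_not_ge h)
    rwa [abs_sub_comm, abs_sub_comm b, min_comm] at this
  rw [min_eq_right h, abs_of_nonneg (sub_nonneg.2 (Real.log_le_log hb h)),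
    abs_of_nonneg (sub_nonneg.2 h), ← Real.log_div ha.ne' hb.ne']
  have h1 := Real.log_le_sub_one_of_pos (div_pos ha hb)
  calc Real.log (a / b) * b ≤ (a / b - 1) * b := by gcongr
    _ = a - b := by field_simp

/-- The one-sided Lipschitz estimate of Cazenave and Haraux. -/
theorem abs_im_logNonlinearity_sub_mul_conj_le (lam : ℝ) (z w : ℂ) :
    |((logNonlinearity lam z - logNonlinearity lam w) * (starRingEnd ℂ) (z - w)).im| ≤
      2 * |lam| * ‖z - w‖ ^ 2 := by
  by_cases hz : z = 0
  · subst hz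
    have : ((logNonlinearity lam 0 - logNonlinearity lam w) * (starRingEnd ℂ) (0 - w)).im = 0 := by
      simp only [logNonlinearity_eq, map_sub, map_zero]
      simp only [Complex.mul_im, Complex.sub_re, Complex.sub_im, Complex.mul_re, Complex.ofReal_re,
        Complex.ofReal_im, Complex.conj_re, Complex.conj_im, Complex.zero_re, Complex.zero_im]
      ring
    rw [this, abs_zero]
    positivity
  by_cases hw : w = 0
  · subst hw
    have : ((logNonlinearity lam z - logNonlinearity lam 0) * (starRingEnd ℂ) (z - 0)).im = 0 := by
      simp only [logNonlinearity_eq, map_sub, map_zero]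
      simp only [Complex.mul_im, Complex.sub_re, Complex.sub_im, Complex.mul_re, Complex.ofReal_re,
        Complex.ofReal_im, Complex.conj_re, Complex.conj_im, Complex.zero_re, Complex.zero_im]
      ring
    rw [this, abs_zero]
    positivity
  have hz' := norm_pos_iff.2 hz
  have hw' := norm_pos_iff.2 hw
  have h1 : ((logNonlinearity lam z - logNonlinearity lam w) * (starRingEnd ℂ) (z - w)).im =
      2 * lam * ((Real.log ‖w‖ - Real.log ‖z‖) * (z * (starRingEnd ℂ) w).im) := by
    simp only [logNonlinearity_eq, map_sub]
    simp only [Complex.mul_im, Complex.sub_re, Complex.sub_im, Complex.mul_re, Complex.ofReal_re,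
        Complex.ofReal_im, Complex.conj_re, Complex.conj_im]
    ring
  have h2 : (z * (starRingEnd ℂ) w).im = ((z - w) * (starRingEnd ℂ) w).im := by
    simp only [Complex.mul_im, Complex.sub_re, Complex.sub_im, Complex.conj_re, Complex.conj_im]
    ring
  have h3 : (z * (starRingEnd ℂ) w).im = ((z - w) * (starRingEnd ℂ) z).im := by
    simp only [Complex.mul_im, Complex.sub_re, Complex.sub_im, Complex.conj_re, Complex.conj_im]
    ring
  have h4 : |(z * (starRingEnd ℂ) w).im| ≤ ‖z - w‖ * min ‖w‖ ‖z‖ := by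
    rcases min_choice ‖w‖ ‖z‖ with h | h <;> rw [h]
    · rw [h2]
      simpa using Complex.abs_im_le_norm ((z - w) * (starRingEnd ℂ) w)
    · rw [h3]
      simpa using Complex.abs_im_le_norm ((z - w) * (starRingEnd ℂ) z)
  have h5 := abs_log_sub_log_mul_le hw' hz'
  have h6 : |‖w‖ - ‖z‖| ≤ ‖z - w‖ := by
    rw [norm_sub_rev]; exact abs_norm_sub_norm_le w z
  rw [h1, abs_mul, abs_mul, abs_mul, abs_of_pos (show (0 : ℝ) < 2 by norm_num)]
  refine mul_le_mul_of_nonneg_left ?_ (by positivity)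
  calc |Real.log ‖w‖ - Real.log ‖z‖| * |(z * (starRingEnd ℂ) w).im|
      ≤ |Real.log ‖w‖ - Real.log ‖z‖| * (‖z - w‖ * min ‖w‖ ‖z‖) := by gcongr
    _ = (|Real.log ‖w‖ - Real.log ‖z‖| * min ‖w‖ ‖z‖) * ‖z - w‖ := by ring
    _ ≤ ‖z - w‖ * ‖z - w‖ := by
        gcongr
        exact h5.trans h6
    _ = ‖z - w‖ ^ 2 := by ring

/-- A strongly measurable curve in `L²` has a jointly measurable representative. -/
theorem exists_measurable_uncurry_ae_eq {α X : Type*} [MeasurableSpace α] [MeasurableSpace X]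
    {μ : Measure X} [SecondCountableTopology (Lp ℂ 2 μ)] (f : α → Lp ℂ 2 μ)
    (hf : StronglyMeasurable f) :
    ∃ U : α → X → ℂ, Measurable (Function.uncurry U) ∧ ∀ t, U t =ᵐ[μ] f t := by
  classical
  set q : ℕ → Lp ℂ 2 μ := TopologicalSpace.denseSeq (Lp ℂ 2 μ) with hq
  have hex : ∀ (k : ℕ) (t : α), ∃ j, dist (f t) (q j) < (1 / 2 : ℝ) ^ k := fun k t =>
    (TopologicalSpace.denseRange_denseSeq (Lp ℂ 2 μ)).exists_dist_lt (f t) (by positivity)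
  set idx : ℕ → α → ℕ := fun k t => Nat.find (hex k t) with hidx
  have hidx_meas : ∀ k, Measurable (idx k) := fun k =>
    measurable_find (hex k) fun j =>
      (hf.dist stronglyMeasurable_const).measurable measurableSet_Iio
  have hidx_spec : ∀ k t, dist (f t) (q (idx k t)) < (1 / 2 : ℝ) ^ k := fun k t =>
    Nat.find_spec (hex k t)
  have hqm : ∀ j, StronglyMeasurable (q j : X → ℂ) := fun j => Lp.stronglyMeasurable (q j)
  set S : ℕ → α × X → ℂ := fun k p => (q (idx k p.1) : X → ℂ) p.2 with hS
  have hSm : ∀ k, StronglyMeasurable (S k) := by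
    intro k
    have h1 : Measurable fun p : ℕ × X => (q p.1 : X → ℂ) p.2 :=
      measurable_from_prod_countable_right fun j => (hqm j).measurable
    exact (h1.comp (((hidx_meas k).comp measurable_fst).prodMk measurable_snd)).stronglyMeasurable
  refine ⟨fun t x => limUnder atTop fun k => S k (t, x), ?_, ?_⟩
  · exact (StronglyMeasurable.limUnder (l := atTop) hSm).measurable
  intro t
  have hlim : Tendsto (fun k => q (idx k t)) atTop (𝓝 (f t)) := by
    rw [tendsto_iff_dist_tendsto_zero]
    refine squeeze_zero (fun _ => dist_nonneg) (fun k => ?_)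
      (tendsto_pow_atTop_nhds_zero_of_lt_one (r := (1 / 2 : ℝ)) (by norm_num) (by norm_num))
    rw [dist_comm]
    exact (hidx_spec k t).le
  have hcau : ∀ᵐ x ∂μ, ∃ l, Tendsto (fun k => (q (idx k t) : X → ℂ) x) atTop (𝓝 l) := by
    refine Lp.ae_tendsto_of_cauchy_eLpNorm (p := 2) (B := fun N => ENNReal.ofReal (2 * (1 / 2) ^ N))
      (fun k => Lp.aestronglyMeasurable _) (by norm_num) ?_ ?_
    · rw [← ENNReal.ofReal_tsum_of_nonneg (fun _ => by positivity)]
      · exact ENNReal.ofReal_ne_top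
      · exact (summable_geometric_of_lt_one (by norm_num) (by norm_num)).mul_left 2
    · intro N n m hn hm
      have h2 : dist (q (idx n t)) (q (idx m t)) < 2 * (1 / 2) ^ N := by
        have h3 := dist_triangle_left (q (idx n t)) (q (idx m t)) (f t)
        have h4 := hidx_spec n t
        have h5 := hidx_spec m t
        have h6 : (1 / 2 : ℝ) ^ n ≤ (1 / 2) ^ N :=
          pow_le_pow_of_le_one (by norm_num) (by norm_num) hn
        have h7 : (1 / 2 : ℝ) ^ m ≤ (1 / 2) ^ N :=
          pow_le_pow_of_le_one (by norm_num) (by norm_num) hm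
        linarith
      have h8 := Lp.edist_def (q (idx n t)) (q (idx m t))
      rw [← h8, edist_dist]
      exact (ENNReal.ofReal_lt_ofReal_iff (by positivity)).2 h2
  obtain ⟨ns, hmono0, hns⟩ := (tendstoInMeasure_of_tendsto_Lp hlim).exists_seq_tendsto_ae
  filter_upwards [hcau, hns] with x ⟨l, hl⟩ hx
  have hmono : Tendsto ns atTop atTop := by
    have : StrictMono ns := hmono0
    exact this.tendsto_atTop
  have : l = f t x := tendsto_nhds_unique (hl.comp hmono) hx
  rw [← this]
  exact hl.limUnder_eq

/-- Product rule for primitives of integrable functions. -/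
theorem integral_mul_integral_eq {h k : ℝ → ℂ} {t : ℝ} (ht : 0 ≤ t)
    (hh : IntegrableOn h (Set.Ioc 0 t)) (hk : IntegrableOn k (Set.Ioc 0 t)) :
    (∫ s in (0 : ℝ)..t, h s) * (∫ s in (0 : ℝ)..t, k s) =
      ∫ s in (0 : ℝ)..t, (h s * (∫ r in (0 : ℝ)..s, k r) + (∫ r in (0 : ℝ)..s, h r) * k s) := by
  set ν := (volume : Measure ℝ).restrict (Set.Ioc 0 t) with hν
  have hh' : Integrable h ν := hh
  have hk' : Integrable k ν := hk
  have hprod : Integrable (fun p : ℝ × ℝ => h p.1 * k p.2) (ν.prod ν) := hh'.mul_prod hk'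
  have hm1 : MeasurableSet {p : ℝ × ℝ | p.2 ≤ p.1} := measurableSet_le measurable_snd measurable_fst
  have hi1 := hprod.indicator hm1
  have hi2 := hprod.indicator hm1.compl
  have hsec1 : ∀ s ∈ Set.Ioc 0 t, (∫ r, {p : ℝ × ℝ | p.2 ≤ p.1}.indicator
      (fun p : ℝ × ℝ => h p.1 * k p.2) (s, r) ∂ν) = h s * ∫ r in (0 : ℝ)..s, k r := by
    intro s hs
    have : (fun r => {p : ℝ × ℝ | p.2 ≤ p.1}.indicator (fun p : ℝ × ℝ => h p.1 * k p.2) (s, r)) =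
        (Set.Iic s).indicator fun r => h s * k r := by
      funext r
      simp only [Set.indicator_apply, Set.mem_ofPred_eq, Set.mem_Iic]
    rw [this, integral_indicator measurableSet_Iic, hν, Measure.restrict_restrict measurableSet_Iic,
      intervalIntegral.integral_of_le hs.1.le, integral_const_mul]
    congr 3
    ext r
    simp only [Set.mem_inter_iff, Set.mem_Iic, Set.mem_Ioc]
    constructor
    · rintro ⟨h1, h2, h3⟩; exact ⟨h2, h1⟩
    · rintro ⟨h1, h2⟩; exact ⟨h2, h1, h2.trans hs.2⟩
  have hsec2 : ∀ r ∈ Set.Ioc 0 t, (∫ s, {p : ℝ × ℝ | p.2 ≤ p.1}ᶜ.indicator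
      (fun p : ℝ × ℝ => h p.1 * k p.2) (s, r) ∂ν) = (∫ s in (0 : ℝ)..r, h s) * k r := by
    intro r hr
    have : (fun s => {p : ℝ × ℝ | p.2 ≤ p.1}ᶜ.indicator (fun p : ℝ × ℝ => h p.1 * k p.2) (s, r)) =
        (Set.Iio r).indicator fun s => h s * k r := by
      funext s
      simp only [Set.indicator_apply, Set.mem_compl_iff, Set.mem_ofPred_eq, Set.mem_Iio, not_le]
    rw [this, integral_indicator measurableSet_Iio, hν, Measure.restrict_restrict measurableSet_Iio,
      intervalIntegral.integral_of_le hr.1.le, integral_mul_const, integral_Ioc_eq_integral_Ioo]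
    congr 3
    ext s
    simp only [Set.mem_inter_iff, Set.mem_Iio, Set.mem_Ioc, Set.mem_Ioo]
    constructor
    · rintro ⟨h1, h2, h3⟩; exact ⟨h2, h1⟩
    · rintro ⟨h1, h2⟩; exact ⟨h2, h1, h2.le.trans hr.2⟩
  have e1 : (∫ p, {p : ℝ × ℝ | p.2 ≤ p.1}.indicator (fun p : ℝ × ℝ => h p.1 * k p.2) p ∂(ν.prod ν))
      = ∫ s, h s * (∫ r in (0 : ℝ)..s, k r) ∂ν := by
    rw [integral_prod _ hi1]
    exact setIntegral_congr_fun measurableSet_Ioc hsec1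
  have e2 : (∫ p, {p : ℝ × ℝ | p.2 ≤ p.1}ᶜ.indicator
      (fun p : ℝ × ℝ => h p.1 * k p.2) p ∂(ν.prod ν))
      = ∫ s, (∫ r in (0 : ℝ)..s, h r) * k s ∂ν := by
    rw [integral_prod_symm _ hi2]
    exact setIntegral_congr_fun measurableSet_Ioc hsec2
  have f1 : Integrable (fun s => h s * (∫ r in (0 : ℝ)..s, k r)) ν :=
    hi1.integral_prod_left.congr ((ae_restrict_iff' measurableSet_Ioc).2 (.of_forall hsec1))
  have f2 : Integrable (fun s => (∫ r in (0 : ℝ)..s, h r) * k s) ν :=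
    hi2.integral_prod_right.congr ((ae_restrict_iff' measurableSet_Ioc).2 (.of_forall hsec2))
  rw [intervalIntegral.integral_of_le ht, intervalIntegral.integral_of_le ht,
    intervalIntegral.integral_of_le ht, ← hν, integral_add f1 f2, ← e1, ← e2,
    ← integral_add hi1 hi2, ← integral_prod_mul]
  congr 1
  funext p
  exact (congrFun (Set.indicator_self_add_compl {p : ℝ × ℝ | p.2 ≤ p.1}
    (fun p : ℝ × ℝ => h p.1 * k p.2)) p).symm

/-- Integration by parts of a primitive against a continuously differentiable function. -/
theorem integral_primitive_mul_deriv {h φ φ' : ℝ → ℂ} {t : ℝ} (ht : 0 ≤ t)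
    (hh : IntegrableOn h (Set.Ioc 0 t)) (hφ : ∀ s, HasDerivAt φ (φ' s) s) (hφ' : Continuous φ') :
    ∫ s in (0 : ℝ)..t, (∫ r in (0 : ℝ)..s, h r) * φ' s =
      (∫ s in (0 : ℝ)..t, h s) * φ t - ∫ s in (0 : ℝ)..t, h s * φ s := by
  have hφc : Continuous φ := continuous_iff_continuousAt.2 fun s => (hφ s).continuousAt
  have hprim : ∀ s, ∫ r in (0 : ℝ)..s, φ' r = φ s - φ 0 := fun s =>
    intervalIntegral.integral_eq_sub_of_hasDerivAt (fun r _ => hφ r) (hφ'.intervalIntegrable _ _)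
  have hI : IntervalIntegrable h volume 0 t := (intervalIntegrable_iff_integrableOn_Ioc_of_le ht).2 hh
  have hcont : ContinuousOn (fun s => ∫ r in (0 : ℝ)..s, h r) (Set.uIcc 0 t) :=
    intervalIntegral.continuousOn_primitive_interval' hI Set.left_mem_uIcc
  have key := integral_mul_integral_eq ht hh (hφ'.integrableOn_Ioc (a := 0) (b := t))
  simp only [hprim] at key
  have i1 : IntervalIntegrable (fun s => h s * φ s) volume 0 t := hI.mul_continuousOn hφc.continuousOn
  have i2 : IntervalIntegrable (fun s => h s * φ 0) volume 0 t := hI.mul_const _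
  have i3 : IntervalIntegrable (fun s => (∫ r in (0 : ℝ)..s, h r) * φ' s) volume 0 t :=
    (hcont.mul hφ'.continuousOn).intervalIntegrable
  have e : ∀ s, h s * (φ s - φ 0) + (∫ r in (0 : ℝ)..s, h r) * φ' s =
      (h s * φ s - h s * φ 0) + (∫ r in (0 : ℝ)..s, h r) * φ' s := fun s => by ring
  simp only [e] at key
  rw [intervalIntegral.integral_add (i1.sub i2) i3, intervalIntegral.integral_sub i1 i2,
    intervalIntegral.integral_mul_const] at key
  linear_combination -key

/-- Gronwall's inequality for bounded measurable functions without inhomogeneity. -/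
theorem ae_eq_zero_of_le_const_mul_integral {y : ℝ → ℝ} {T C : ℝ} (hT : 0 ≤ T) (hC : 0 ≤ C)
    (hy0 : ∀ t, 0 ≤ y t) (hy : IntegrableOn y (Set.Ioc 0 T))
    (h : ∀ᵐ t ∂volume.restrict (Set.Ioc 0 T), y t ≤ C * ∫ s in (0 : ℝ)..t, y s) :
    ∀ᵐ t ∂volume.restrict (Set.Ioc 0 T), y t = 0 := by
  have hI : IntervalIntegrable y volume 0 T := (intervalIntegrable_iff_integrableOn_Ioc_of_le hT).2 hy
  set Y : ℝ → ℝ := fun t => ∫ s in (0 : ℝ)..t, y s with hY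
  have hYc : ContinuousOn Y (Set.Icc 0 T) := by
    have := intervalIntegral.continuousOn_primitive_interval' hI Set.left_mem_uIcc
    rwa [Set.uIcc_of_le hT] at this
  have hY0 : ∀ t ∈ Set.Icc 0 T, 0 ≤ Y t := fun t ht =>
    intervalIntegral.integral_nonneg ht.1 fun s _ => hy0 s
  have hYint : IntervalIntegrable Y volume 0 T := by
    apply ContinuousOn.intervalIntegrable
    rwa [Set.uIcc_of_le hT]
  have hYle : ∀ t ∈ Set.Icc 0 T, Y t ≤ C * ∫ s in (0 : ℝ)..t, Y s := by
    intro t ht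
    rw [← intervalIntegral.integral_const_mul]
    refine intervalIntegral.integral_mono_ae_restrict ht.1 ?_ ?_ ?_
    · exact hI.mono_set (by rw [Set.uIcc_of_le ht.1, Set.uIcc_of_le hT]; gcongr; exact ht.2)
    · exact (hYint.mono_set
        (by rw [Set.uIcc_of_le ht.1, Set.uIcc_of_le hT]; gcongr; exact ht.2)).const_mul C
    · rw [Measure.restrict_congr_set Ioc_ae_eq_Icc.symm]
      exact ae_restrict_of_ae_restrict_of_subset (Set.Ioc_subset_Ioc_right ht.2) h
  have hYbound : ∃ B, 0 ≤ B ∧ ∀ t ∈ Set.Icc 0 T, Y t ≤ B := by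
    obtain ⟨B, hB⟩ := isCompact_Icc.bddAbove_image hYc
    refine ⟨max B 0, le_max_right _ _, fun t ht => le_max_of_le_left (hB ⟨t, ht, rfl⟩)⟩
  obtain ⟨B, hB0, hB⟩ := hYbound
  have iter : ∀ n : ℕ, ∀ t ∈ Set.Icc 0 T, Y t ≤ B * ((C * t) ^ n / n.factorial) := by
    intro n
    induction n with
    | zero => intro t ht; simpa using hB t ht
    | succ n ih =>
      intro t ht
      refine (hYle t ht).trans ?_
      have h1 : ∫ s in (0 : ℝ)..t, Y s ≤ ∫ s in (0 : ℝ)..t, B * ((C * s) ^ n / n.factorial) := by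
        refine intervalIntegral.integral_mono_on ht.1 ?_ ?_ ?_
        · exact hYint.mono_set
            (by rw [Set.uIcc_of_le ht.1, Set.uIcc_of_le hT]; gcongr; exact ht.2)
        · exact Continuous.intervalIntegrable (by fun_prop) _ _
        · exact fun s hs => ih s ⟨hs.1, hs.2.trans ht.2⟩
      have h2 : ∫ s in (0 : ℝ)..t, B * ((C * s) ^ n / n.factorial) =
          B * C ^ n / n.factorial * (t ^ (n + 1) / (n + 1)) := by
        have : ∀ s : ℝ, B * ((C * s) ^ n / n.factorial) = B * C ^ n / n.factorial * s ^ n := by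
          intro s; rw [mul_pow]; ring
        simp only [this]
        rw [intervalIntegral.integral_const_mul, integral_pow]
        simp
      calc C * ∫ s in (0 : ℝ)..t, Y s ≤ C * (B * C ^ n / n.factorial * (t ^ (n + 1) / (n + 1))) := by
            rw [← h2]; gcongr
        _ = B * ((C * t) ^ (n + 1) / (n + 1).factorial) := by
            rw [Nat.factorial_succ]
            push_cast
            rw [mul_pow]
            field_simp
            ring
  have hYz : ∀ t ∈ Set.Icc 0 T, Y t ≤ 0 := by
    intro t ht
    have := (FloorSemiring.tendsto_pow_div_factorial_atTop (C * t)).const_mul B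
    rw [mul_zero] at this
    exact ge_of_tendsto' this fun n => iter n t ht
  filter_upwards [h, ae_restrict_mem measurableSet_Ioc] with t ht htm
  have := hYz t ⟨htm.1.le, htm.2⟩
  exact le_antisymm (ht.trans (by nlinarith)) (hy0 t)

theorem IsCompact.exists_subset_Icc_of_subset_Ioo {K : Set ℝ} (hK : IsCompact K) {a b : ℝ}
    (hab : a < b) (h : K ⊆ Set.Ioo a b) : ∃ c d, a < c ∧ d < b ∧ K ⊆ Set.Icc c d := by
  rcases K.eq_empty_or_nonempty with rfl | hne
  · exact ⟨(a + b) / 2, (a + b) / 2, by linarith, by linarith, Set.empty_subset _⟩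
  · obtain ⟨c, hc, hc'⟩ := hK.exists_isLeast hne
    obtain ⟨d, hd, hd'⟩ := hK.exists_isGreatest hne
    exact ⟨c, d, (h hc).1, (h hd).2, fun x hx => ⟨hc' hx, hd' hx⟩⟩

/-- A smooth function supported in a compact subinterval of `(0, T)`. -/
def IsIntervalTest (T : ℝ) (χ : ℝ → ℝ) : Prop :=
  ContDiff ℝ ∞ χ ∧ ∃ a b, 0 < a ∧ b < T ∧ ∀ t, t ∉ Set.Icc a b → χ t = 0

theorem isIntervalTest_primitive {T : ℝ} {ζ : ℝ → ℝ} (hζ : ContDiff ℝ ∞ ζ) {K : Set ℝ} (hT : 0 < T)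
    (hK : IsCompact K) (hKT : K ⊆ Set.Ioo 0 T) (hζK : ∀ t, t ∉ K → ζ t = 0)
    (h0 : ∫ s in (0 : ℝ)..T, ζ s = 0) : IsIntervalTest T fun t => ∫ s in (0 : ℝ)..t, ζ s := by
  obtain ⟨c, d, hc, hd, hcd⟩ := hK.exists_subset_Icc_of_subset_Ioo hT hKT
  have hder : ∀ t, HasDerivAt (fun t => ∫ s in (0 : ℝ)..t, ζ s) (ζ t) t := fun t =>
    hζ.continuous.integral_hasStrictDerivAt 0 t |>.hasDerivAt
  have hz : ∀ a b : ℝ, (∀ s ∈ Set.uIcc a b, s ∉ Set.Icc c d) → ∫ s in a..b, ζ s = 0 := by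
    intro a b h
    rw [intervalIntegral.integral_congr (g := fun _ => (0 : ℝ))]
    · simp
    · exact fun s hs => hζK s fun hsK => h s hs (hcd hsK)
  refine ⟨?_, c, d, hc, hd, fun t ht => ?_⟩
  · rw [contDiff_infty_iff_deriv]
    refine ⟨fun t => (hder t).differentiableAt, ?_⟩
    rw [funext fun t => (hder t).deriv]
    exact hζ
  · rw [Set.mem_Icc, not_and_or, not_le, not_le] at ht
    rcases ht with ht | ht
    · refine hz _ _ fun s hs hs' => ?_
      have := hs.2
      have := max_lt hc ht
      exact absurd hs'.1 (by linarith)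
    · have hi : ∀ a b : ℝ, IntervalIntegrable ζ volume a b := fun a b =>
        hζ.continuous.intervalIntegrable a b
      have h1 := intervalIntegral.integral_add_adjacent_intervals (hi 0 T) (hi T t)
      rw [h0, zero_add] at h1
      refine h1.symm.trans ?_
      refine hz _ _ fun s hs hs' => ?_
      have := hs.1
      have := lt_min hd ht
      exact absurd hs'.2 (by linarith)

theorem exists_isIntervalTest_integral_eq_one {T : ℝ} (hT : 0 < T) :
    ∃ χ : ℝ → ℝ, ContDiff ℝ ∞ χ ∧ (∃ K, IsCompact K ∧ K ⊆ Set.Ioo 0 T ∧ ∀ t, t ∉ K → χ t = 0) ∧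
      ∫ s in (0 : ℝ)..T, χ s = 1 := by
  let f : ContDiffBump (T / 2) := ⟨T / 8, T / 4, by positivity, by linarith⟩
  have hK : ∀ t, t ∉ Metric.closedBall (T / 2) (T / 4) → f.normed volume t = 0 := fun t ht => by
    have : t ∉ Function.support (f.normed volume) := by
      rw [f.support_normed_eq]
      exact fun h => ht (Metric.ball_subset_closedBall h)
    simpa using this
  have hKT : Metric.closedBall (T / 2) (T / 4) ⊆ Set.Ioo 0 T := by
    intro t ht
    rw [Metric.mem_closedBall, Real.dist_eq, abs_le] at ht
    exact ⟨by linarith, by linarith⟩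
  refine ⟨f.normed volume, f.contDiff_normed,
    ⟨_, isCompact_closedBall _ _, hKT, hK⟩, ?_⟩
  rw [intervalIntegral.integral_of_le hT.le, ← f.integral_normed (μ := volume)]
  refine setIntegral_eq_integral_of_forall_compl_eq_zero fun t ht => hK t fun h => ht ?_
  exact Set.Ioo_subset_Ioc_self (hKT h)

instance neBot_nhdsGT_inf_ae : (𝓝[>] (0 : ℝ) ⊓ ae volume).NeBot := by
  rw [Filter.inf_neBot_iff]
  intro s hs s' hs'
  obtain ⟨ε, hε, hεs⟩ := mem_nhdsGT_iff_exists_Ioo_subset.1 hs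
  by_contra hne
  have hsub : Set.Ioo 0 ε ⊆ s'ᶜ := fun t ht ht' => hne ⟨t, hεs ht, ht'⟩
  have h0 := measure_mono_null hsub hs'
  rw [Real.volume_Ioo, ENNReal.ofReal_eq_zero] at h0
  have : (0 : ℝ) < ε := hε
  linarith

/-- The lemma of du Bois-Reymond: a function with integrable weak derivative is a primitive. -/
theorem ae_eq_primitive_of_weak_deriv {f h : ℝ → ℂ} {c₀ : ℂ} {T : ℝ} (hT : 0 < T)
    (hf : IntegrableOn f (Set.Ioc 0 T)) (hh : IntegrableOn h (Set.Ioc 0 T))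
    (hw : ∀ χ : ℝ → ℝ, IsIntervalTest T χ →
      ∫ t in Set.Icc 0 T, (f t * ((deriv χ t : ℝ) : ℂ) + h t * (χ t : ℂ)) = 0)
    (h0 : Tendsto f (𝓝[>] (0 : ℝ) ⊓ ae volume) (𝓝 c₀)) :
    ∀ᵐ t ∂volume.restrict (Set.Ioc 0 T), f t = c₀ + ∫ s in (0 : ℝ)..t, h s := by
  have hI : IntervalIntegrable h volume 0 T :=
    (intervalIntegrable_iff_integrableOn_Ioc_of_le hT.le).2 hh
  have hfI : IntervalIntegrable f volume 0 T :=
    (intervalIntegrable_iff_integrableOn_Ioc_of_le hT.le).2 hf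
  have hHc : ContinuousOn (fun s => ∫ r in (0 : ℝ)..s, h r) (Set.uIcc 0 T) :=
    intervalIntegral.continuousOn_primitive_interval' hI Set.left_mem_uIcc
  set g : ℝ → ℂ := fun t => f t - ∫ s in (0 : ℝ)..t, h s with hg
  have hgI : IntervalIntegrable g volume 0 T := hfI.sub hHc.intervalIntegrable
  have hmul : ∀ {F : ℝ → ℂ} {ζ : ℝ → ℝ}, IntervalIntegrable F volume 0 T → Continuous ζ →
      IntervalIntegrable (fun s => F s * (ζ s : ℂ)) volume 0 T := fun hF hζ =>
    hF.mul_continuousOn (Complex.continuous_ofReal.comp hζ).continuousOn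
  have hgw : ∀ χ : ℝ → ℝ, IsIntervalTest T χ → ∫ t in (0 : ℝ)..T, g t * ((deriv χ t : ℝ) : ℂ) = 0 := by
    intro χ hχ
    obtain ⟨a, b, ha, hb, hab⟩ := hχ.2
    have hχT : χ T = 0 := hab T fun hm => absurd hm.2 (by linarith)
    have hder : Continuous (deriv χ) := hχ.1.continuous_deriv (by norm_num)
    have hd : ∀ s, HasDerivAt (fun s => (χ s : ℂ)) ((deriv χ s : ℝ) : ℂ) s := fun s =>
      ((hχ.1.differentiable (by norm_num)) s).hasDerivAt.ofReal_comp
    have h1 := integral_primitive_mul_deriv hT.le hh hd (Complex.continuous_ofReal.comp hder)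
    have h2 := hw χ hχ
    rw [integral_Icc_eq_integral_Ioc, ← intervalIntegral.integral_of_le hT.le,
      intervalIntegral.integral_add (hmul hfI hder) (hmul hI hχ.1.continuous)] at h2
    rw [hχT] at h1
    have h3 : ∀ t, g t * ((deriv χ t : ℝ) : ℂ) = f t * ((deriv χ t : ℝ) : ℂ) -
        (∫ s in (0 : ℝ)..t, h s) * ((deriv χ t : ℝ) : ℂ) := fun t => sub_mul _ _ _
    simp only [h3]
    rw [intervalIntegral.integral_sub (hmul hfI hder) (hmul hHc.intervalIntegrable hder), h1]
    simp only [Complex.ofReal_zero, mul_zero, zero_sub, sub_neg_eq_add]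
    exact h2
  obtain ⟨χ₀, hχ₀, ⟨K₀, hK₀, hK₀T, hχK₀⟩, hone⟩ := exists_isIntervalTest_integral_eq_one hT
  set c : ℂ := ∫ t in (0 : ℝ)..T, g t * (χ₀ t : ℂ) with hc
  have hconst : ∀ᵐ t ∂volume, t ∈ Set.Ioo 0 T → g t - c = 0 := by
    refine isOpen_Ioo.ae_eq_zero_of_integral_contDiff_smul_eq_zero ?_ ?_
    · have : IntegrableOn (fun t => g t - c) (Set.Ioo 0 T) :=
        ((hgI.1.mono_set Set.Ioo_subset_Ioc_self).sub
          (integrableOn_const (by simp)))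
      exact this.locallyIntegrableOn
    intro θ hθ hθc hθT
    have hθI : ∀ t, t ∉ tsupport θ → θ t = 0 := fun t ht => image_eq_zero_of_notMem_tsupport ht
    set I : ℝ := ∫ s in (0 : ℝ)..T, θ s with hIdef
    have hζ : ContDiff ℝ ∞ fun t => θ t - I * χ₀ t := hθ.sub (contDiff_const.mul hχ₀)
    have htest := isIntervalTest_primitive hζ hT (hθc.isCompact.union hK₀)
      (Set.union_subset hθT hK₀T)
      (fun t ht => by
        rw [Set.mem_union, not_or] at ht
        simp only [hθI t ht.1, hχK₀ t ht.2, mul_zero, sub_zero])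
      (by
        rw [intervalIntegral.integral_sub (hθ.continuous.intervalIntegrable _ _)
          ((hχ₀.continuous.intervalIntegrable _ _).const_mul I),
          intervalIntegral.integral_const_mul, hone, mul_one, sub_self])
    have h1 := hgw _ htest
    have hder : ∀ t, deriv (fun t => ∫ s in (0 : ℝ)..t, (θ s - I * χ₀ s)) t = θ t - I * χ₀ t :=
      fun t => (hζ.continuous.integral_hasStrictDerivAt 0 t).hasDerivAt.deriv
    simp only [hder] at h1
    have h2 : ∀ t, g t * ((θ t - I * χ₀ t : ℝ) : ℂ) =
        g t * (θ t : ℂ) - (I : ℂ) * (g t * (χ₀ t : ℂ)) := fun t => by push_cast; ring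
    simp only [h2] at h1
    rw [intervalIntegral.integral_sub (hmul hgI hθ.continuous)
      ((hmul hgI hχ₀.continuous).const_mul _), intervalIntegral.integral_const_mul, ← hc] at h1
    have h3 : ∫ t, θ t • (g t - c) = ∫ t in (0 : ℝ)..T, (g t * (θ t : ℂ) - (θ t : ℂ) * c) := by
      rw [intervalIntegral.integral_of_le hT.le]
      rw [← setIntegral_eq_integral_of_forall_compl_eq_zero (s := Set.Ioc 0 T)]
      · refine integral_congr_ae (.of_forall fun t => ?_)
        simp only [Complex.real_smul]
        ring
      · intro t ht
        rw [hθI t fun h => ht (Set.Ioo_subset_Ioc_self (hθT h)), zero_smul]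
    have hθI' : IntervalIntegrable (fun t => (θ t : ℂ)) volume 0 T :=
      (Complex.continuous_ofReal.comp hθ.continuous).intervalIntegrable _ _
    rw [h3, intervalIntegral.integral_sub (hmul hgI hθ.continuous) (hθI'.mul_const c),
      intervalIntegral.integral_mul_const, intervalIntegral.integral_ofReal]
    exact h1
  have hcc : c = c₀ := by
    have e1 : ∀ᶠ t in 𝓝[>] (0 : ℝ) ⊓ ae volume, g t = c := by
      have m1 : ∀ᶠ t in 𝓝[>] (0 : ℝ), t ∈ Set.Ioo 0 T := Ioo_mem_nhdsGT hT
      filter_upwards [m1.filter_mono inf_le_left, hconst.filter_mono inf_le_right] with t ht ht'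
      exact sub_eq_zero.1 (ht' ht)
    have hH0 : Tendsto (fun t => ∫ s in (0 : ℝ)..t, h s) (𝓝[>] (0 : ℝ) ⊓ ae volume) (𝓝 0) := by
      have := (hHc 0 Set.left_mem_uIcc).tendsto
      rw [intervalIntegral.integral_same, Set.uIcc_of_le hT.le] at this
      refine this.mono_left (inf_le_left.trans ?_)
      rw [← nhdsWithin_Ioo_eq_nhdsGT hT]
      exact nhdsWithin_mono _ Set.Ioo_subset_Icc_self
    have e2 : Tendsto g (𝓝[>] (0 : ℝ) ⊓ ae volume) (𝓝 (c₀ - 0)) := h0.sub hH0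
    rw [sub_zero] at e2
    exact tendsto_nhds_unique (tendsto_const_nhds.congr' (e1.mono fun t ht => ht.symm)) e2
  rw [Measure.restrict_congr_set Ioo_ae_eq_Ioc.symm]
  filter_upwards [(ae_restrict_iff' measurableSet_Ioo).2 hconst] with t ht
  rw [← hcc, ← sub_eq_zero.1 ht]
  simp [hg]

open UnitAddTorus in
theorem mFourier_coe_apply {d : ℕ} (n : Fin d → ℤ) (x : Fin d → ℝ) :
    mFourier n (fun j => (x j : UnitAddCircle)) =
      Complex.exp (2 * Real.pi * Complex.I * ∑ j, (n j : ℂ) * (x j : ℂ)) := by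
  simp only [mFourier, ContinuousMap.coe_mk, fourier_coe_apply]
  rw [← Complex.exp_sum]
  congr 1
  rw [Finset.mul_sum]
  refine Finset.sum_congr rfl fun j _ => ?_
  push_cast
  ring

open UnitAddTorus in
theorem mFourier_add_single {d : ℕ} (n : Fin d → ℤ) (x : UnitAddTorus (Fin d)) (j : Fin d) (h : ℝ) :
    mFourier n (x + Pi.single j (h : UnitAddCircle)) =
      mFourier n x * Complex.exp (2 * Real.pi * Complex.I * n j * h) := by
  have h1 : mFourier n (Pi.single j (h : UnitAddCircle)) =
      Complex.exp (2 * Real.pi * Complex.I * n j * h) := by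
    have e : (Pi.single j (h : UnitAddCircle) : UnitAddTorus (Fin d)) =
        fun k => (((Pi.single j h : Fin d → ℝ) k : ℝ) : UnitAddCircle) := by
      funext k
      by_cases hk : k = j
      · subst hk; simp
      · simp [hk]
    rw [e, mFourier_coe_apply]
    congr 1
    rw [Finset.sum_eq_single j]
    · simp only [Pi.single_eq_same]; ring
    · intro k _ hk; simp [hk]
    · simp
  rw [← h1]
  simp only [mFourier, ContinuousMap.coe_mk, ← Finset.prod_mul_distrib]
  refine Finset.prod_congr rfl fun k _ => ?_
  simp only [fourier_apply, Pi.add_apply, smul_add, AddCircle.toCircle_add, Circle.coe_mul]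

/-- The eigenvalue `|2πn|²` of `-Δ` on `𝕋^d`. -/
noncomputable def laplaceEigenvalue {d : ℕ} (n : Fin d → ℤ) : ℝ :=
  (2 * Real.pi) ^ 2 * ∑ j, (n j : ℝ) ^ 2

theorem laplaceEigenvalue_neg {d : ℕ} (n : Fin d → ℤ) :
    laplaceEigenvalue (-n) = laplaceEigenvalue n := by
  simp [laplaceEigenvalue]

theorem iteratedDeriv_two_const_mul_cexp (c a : ℂ) :
    iteratedDeriv 2 (fun h : ℝ => c * Complex.exp (a * h)) 0 = c * a ^ 2 := by
  have hd : ∀ c : ℂ, deriv (fun h : ℝ => c * Complex.exp (a * h)) =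
      fun h : ℝ => (c * a) * Complex.exp (a * h) := by
    intro c
    funext h
    have h1 : HasDerivAt (fun h : ℝ => a * (h : ℂ)) (a * 1) h :=
      Complex.ofRealCLM.hasDerivAt.const_mul a
    have h2 := (h1.cexp.const_mul c).deriv
    rw [h2]
    ring
  rw [iteratedDeriv_succ, iteratedDeriv_one, hd, hd]
  simp
  ring

open UnitAddTorus in
theorem torusLaplacian_const_mul_mFourier {d : ℕ} (c : ℂ) (n : Fin d → ℤ)
    (x : UnitAddTorus (Fin d)) :
    torusLaplacian (fun x => c * mFourier n x) x =
      -(laplaceEigenvalue n : ℂ) * (c * mFourier n x) := by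
  unfold torusLaplacian laplaceEigenvalue
  have h : ∀ j, iteratedDeriv 2 (fun h : ℝ => c * mFourier n (x + Pi.single j (h : UnitAddCircle))) 0
      = (c * mFourier n x) * (2 * Real.pi * Complex.I * n j) ^ 2 := by
    intro j
    simp only [mFourier_add_single]
    rw [← iteratedDeriv_two_const_mul_cexp]
    simp only [mul_assoc]
  simp only [h]
  rw [← Finset.mul_sum]
  push_cast
  simp only [mul_pow, Complex.I_sq]
  rw [← Finset.mul_sum]
  ring

theorem contDiff_mFourier_coe {d : ℕ} (n : Fin d → ℤ) :
    ContDiff ℝ ∞ fun x : Fin d → ℝ =>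
      UnitAddTorus.mFourier n (fun j => (x j : UnitAddCircle)) := by
  simp only [mFourier_coe_apply]
  refine ContDiff.cexp (contDiff_const.mul (ContDiff.sum fun j _ => contDiff_const.mul ?_))
  exact Complex.ofRealCLM.contDiff.comp (contDiff_apply ℝ ℝ j)

theorem isSmoothOnTorus_mFourier {d : ℕ} (n : Fin d → ℤ) :
    IsSmoothOnTorus (UnitAddTorus.mFourier n : UnitAddTorus (Fin d) → ℂ) :=
  contDiff_mFourier_coe n

theorem isSpaceTimeTest_mul_mFourier {d : ℕ} {T : ℝ} {χ : ℝ → ℝ} (hχ : IsIntervalTest T χ)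
    (n : Fin d → ℤ) :
    IsSpaceTimeTest T fun t (x : UnitAddTorus (Fin d)) => (χ t : ℂ) * UnitAddTorus.mFourier n x where
  smooth := by
    refine ContDiff.mul ?_ ((contDiff_mFourier_coe n).comp contDiff_snd)
    exact Complex.ofRealCLM.contDiff.comp (hχ.1.comp contDiff_fst)
  compactSupport := by
    obtain ⟨a, b, ha, hb, hab⟩ := hχ.2
    exact ⟨a, b, ha, hb, fun t ht x => by simp [hab t ht]⟩

/-- The Fourier coefficient `∫ f e_{-n}`. -/
noncomputable def torusCoeff {d : ℕ} (f : UnitAddTorus (Fin d) → ℂ) (n : Fin d → ℤ) : ℂ :=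
  ∫ x, f x * UnitAddTorus.mFourier (-n) x ∂(torusMeasure d)

theorem torusCoeff_congr_ae {d : ℕ} {f g : UnitAddTorus (Fin d) → ℂ} (h : f =ᵐ[torusMeasure d] g)
    (n : Fin d → ℤ) : torusCoeff f n = torusCoeff g n :=
  integral_congr_ae (h.mono fun x hx => by simp only [hx])

theorem norm_mFourier_apply {d : ℕ} (n : Fin d → ℤ) (x : UnitAddTorus (Fin d)) :
    ‖UnitAddTorus.mFourier n x‖ = 1 := by
  simp only [UnitAddTorus.mFourier, ContinuousMap.coe_mk, norm_prod, fourier_apply, Circle.norm_coe,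
    Finset.prod_const_one]

theorem MeasureTheory.Integrable.mul_mFourier {d : ℕ} {f : UnitAddTorus (Fin d) → ℂ}
    (hf : Integrable f (torusMeasure d)) (n : Fin d → ℤ) :
    Integrable (fun x => f x * UnitAddTorus.mFourier n x) (torusMeasure d) :=
  hf.mul_bdd (c := 1) (UnitAddTorus.mFourier n).continuous.aestronglyMeasurable
    (.of_forall fun x => (norm_mFourier_apply n x).le)

theorem norm_torusCoeff_le {d : ℕ} (f : UnitAddTorus (Fin d) → ℂ) (n : Fin d → ℤ) :
    ‖torusCoeff f n‖ ≤ ∫ x, ‖f x‖ ∂(torusMeasure d) := by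
  refine (norm_integral_le_integral_norm _).trans_eq ?_
  simp only [norm_mul, norm_mFourier_apply, mul_one]

theorem torusCoeff_sub {d : ℕ} {f g : UnitAddTorus (Fin d) → ℂ} (hf : Integrable f (torusMeasure d))
    (hg : Integrable g (torusMeasure d)) (n : Fin d → ℤ) :
    torusCoeff (fun x => f x - g x) n = torusCoeff f n - torusCoeff g n := by
  unfold torusCoeff
  simp only [sub_mul]
  exact integral_sub (hf.mul_mFourier _) (hg.mul_mFourier _)

theorem torusCoeff_const_mul {d : ℕ} (c : ℂ) (f : UnitAddTorus (Fin d) → ℂ) (n : Fin d → ℤ) :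
    torusCoeff (fun x => c * f x) n = c * torusCoeff f n := by
  unfold torusCoeff
  simp only [mul_assoc]
  exact integral_const_mul _ _

theorem mFourierBasis_repr_eq_torusCoeff {d : ℕ} (f : L2Torus d) (n : Fin d → ℤ) :
    UnitAddTorus.mFourierBasis.repr f n = torusCoeff f n := by
  refine (UnitAddTorus.mFourierBasis_repr f n).trans ?_
  unfold UnitAddTorus.mFourierCoeff torusCoeff
  refine integral_congr_ae (.of_forall fun x => ?_)
  simp only [smul_eq_mul, mul_comm]

theorem measurable_torusCoeff {α : Type*} [MeasurableSpace α] {d : ℕ}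
    {U : α → UnitAddTorus (Fin d) → ℂ} (hU : Measurable (Function.uncurry U)) (n : Fin d → ℤ) :
    Measurable fun t => torusCoeff (U t) n := by
  have h : StronglyMeasurable (Function.uncurry fun t x => U t x * UnitAddTorus.mFourier (-n) x) :=
    (hU.mul ((UnitAddTorus.mFourier (-n)).continuous.measurable.comp measurable_snd)).stronglyMeasurable
  exact h.integral_prod_right.measurable

/-- A jointly measurable family `U t ∈ L²(𝕋^d)` with `‖U t‖²_{L²} ≤ M` for all times `t`. -/
structure IsBoundedCurve {d : ℕ} (M : ℝ) (U : ℝ → UnitAddTorus (Fin d) → ℂ) : Prop where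
  measurable : Measurable (Function.uncurry U)
  memLp : ∀ t, MemLp (U t) 2 (torusMeasure d)
  bound : ∀ t, ∫ x, ‖U t x‖ ^ 2 ∂(torusMeasure d) ≤ M

theorem exists_isBoundedCurve {d : ℕ} {ν : Measure ℝ} {u : ℝ → L2Torus d}
    (hu : AEStronglyMeasurable u ν) {M : ℝ} (hM : ∀ᵐ t ∂ν, ‖u t‖ ≤ M) (hM0 : 0 ≤ M) :
    ∃ U : ℝ → UnitAddTorus (Fin d) → ℂ, IsBoundedCurve (M ^ 2) U ∧
      ∀ᵐ t ∂ν, U t =ᵐ[torusMeasure d] u t := by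
  have : Fact ((2 : ℝ≥0∞) ≠ ⊤) := ⟨by norm_num⟩
  have : SecondCountableTopology UnitAddCircle :=
    inferInstanceAs (SecondCountableTopology (ℝ ⧸ AddSubgroup.zmultiples (1 : ℝ)))
  have : SecondCountableTopology (Lp ℂ 2 (torusMeasure d)) := Lp.SecondCountableTopology
  have hms : MeasurableSet {t | ‖hu.mk u t‖ ≤ M} :=
    hu.stronglyMeasurable_mk.norm.measurable measurableSet_Iic
  obtain ⟨U, hU, hUe⟩ := exists_measurable_uncurry_ae_eq
    ({t | ‖hu.mk u t‖ ≤ M}.indicator (hu.mk u)) (hu.stronglyMeasurable_mk.indicator hms)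
  have hb : ∀ t, ‖{t | ‖hu.mk u t‖ ≤ M}.indicator (hu.mk u) t‖ ≤ M := by
    intro t
    by_cases ht : t ∈ {t | ‖hu.mk u t‖ ≤ M}
    · rw [Set.indicator_of_mem ht]; exact ht
    · rw [Set.indicator_of_notMem ht, norm_zero]; exact hM0
  refine ⟨U, ⟨hU, fun t => (Lp.memLp _).ae_eq (hUe t).symm, fun t => ?_⟩, ?_⟩
  · set f := {t | ‖hu.mk u t‖ ≤ M}.indicator (hu.mk u) t with hf
    have h1 : ∫ x, ‖U t x‖ ^ 2 ∂(torusMeasure d) = ‖f‖ ^ 2 := by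
      rw [integral_congr_ae ((hUe t).mono fun x hx => by simp only [hx, hf] :
        _ =ᵐ[torusMeasure d] fun x => ‖f x‖ ^ 2)]
      have h2 := congrArg RCLike.re (L2.inner_def (𝕜 := ℂ) f f)
      rw [← integral_re (L2.integrable_inner f f), inner_self_eq_norm_sq] at h2
      rw [h2]
      refine integral_congr_ae (.of_forall fun x => ?_)
      simp only [inner_self_eq_norm_sq]
    rw [h1]
    exact pow_le_pow_left₀ (norm_nonneg _) (hb t) 2
  · filter_upwards [hu.ae_eq_mk, hM] with t ht htM
    refine (hUe t).trans ?_
    rw [Set.indicator_of_mem (by rw [Set.mem_ofPred_eq, ← ht]; exact htM), ← ht]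

section bounded

variable {d : ℕ} {M : ℝ} {U : ℝ → UnitAddTorus (Fin d) → ℂ}

theorem IsBoundedCurve.measurable_apply (hU : IsBoundedCurve M U) (t : ℝ) : Measurable (U t) :=
  hU.measurable.comp measurable_prodMk_left

theorem IsBoundedCurve.integrable (hU : IsBoundedCurve M U) (t : ℝ) :
    Integrable (U t) (torusMeasure d) :=
  (hU.memLp t).integrable (by norm_num)

theorem IsBoundedCurve.integrable_sq (hU : IsBoundedCurve M U) (t : ℝ) :
    Integrable (fun x => ‖U t x‖ ^ 2) (torusMeasure d) :=
  (hU.memLp t).integrable_norm_pow (by norm_num)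

theorem IsBoundedCurve.integrable_logNonlinearity (hU : IsBoundedCurve M U) (lam t : ℝ) :
    Integrable (fun x => logNonlinearity lam (U t x)) (torusMeasure d) := by
  refine Integrable.mono' (((integrable_const (1 : ℝ)).add (hU.integrable_sq t)).const_mul (8 * |lam|))
    ((continuous_logNonlinearity lam).measurable.comp (hU.measurable_apply t)).aestronglyMeasurable
    (.of_forall fun x => norm_logNonlinearity_le_sq lam _)

theorem IsBoundedCurve.integral_norm_logNonlinearity_le (hU : IsBoundedCurve M U) (lam t : ℝ) :
    ∫ x, ‖logNonlinearity lam (U t x)‖ ∂(torusMeasure d) ≤ 8 * |lam| * (1 + M) := by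
  have hi := (integrable_const (1 : ℝ)).add (hU.integrable_sq t)
  refine (integral_mono (hU.integrable_logNonlinearity lam t).norm (hi.const_mul (8 * |lam|))
    fun x => norm_logNonlinearity_le_sq lam _).trans ?_
  rw [integral_const_mul]
  refine mul_le_mul_of_nonneg_left ?_ (by positivity)
  simp only [Pi.add_apply]
  rw [integral_add (integrable_const _) (hU.integrable_sq t)]
  simpa using hU.bound t

theorem IsBoundedCurve.integral_norm_le (hU : IsBoundedCurve M U) (t : ℝ) :
    ∫ x, ‖U t x‖ ∂(torusMeasure d) ≤ 1 + M := by
  have hi := (integrable_const (1 : ℝ)).add (hU.integrable_sq t)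
  refine (integral_mono (hU.integrable t).norm hi fun x => ?_).trans ?_
  · simp only [Pi.add_apply]
    nlinarith [sq_nonneg (‖U t x‖ - 1 / 2)]
  · simp only [Pi.add_apply]
    rw [integral_add (integrable_const _) (hU.integrable_sq t)]
    simpa using hU.bound t

theorem IsBoundedCurve.measurable_logNonlinearity (hU : IsBoundedCurve M U) (lam : ℝ) :
    Measurable (Function.uncurry fun t x => logNonlinearity lam (U t x)) :=
  (continuous_logNonlinearity lam).measurable.comp hU.measurable

/-- A measurable bounded function is integrable on bounded intervals. -/
theorem integrableOn_Ioc_of_measurable_of_bounded {f : ℝ → ℂ} (hf : Measurable f) {C : ℝ}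
    (hC : ∀ t, ‖f t‖ ≤ C) (a b : ℝ) : IntegrableOn f (Set.Ioc a b) :=
  Measure.integrableOn_of_bounded (M := C) (by simp) hf.aestronglyMeasurable (.of_forall hC)

theorem IsBoundedCurve.norm_torusCoeff_le (hU : IsBoundedCurve M U) (n : Fin d → ℤ) (t : ℝ) :
    ‖torusCoeff (U t) n‖ ≤ 1 + M :=
  (_root_.norm_torusCoeff_le _ _).trans (hU.integral_norm_le t)

theorem IsBoundedCurve.norm_torusCoeff_logNonlinearity_le (hU : IsBoundedCurve M U) (lam : ℝ)
    (n : Fin d → ℤ) (t : ℝ) :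
    ‖torusCoeff (fun x => logNonlinearity lam (U t x)) n‖ ≤ 8 * |lam| * (1 + M) :=
  (_root_.norm_torusCoeff_le _ _).trans (hU.integral_norm_logNonlinearity_le lam t)

/-- The equation for the `n`-th Fourier coefficient, in the sense of distributions. -/
theorem IsBoundedCurve.fourier_weak_equation (hU : IsBoundedCurve M U) {lam T : ℝ}
    {u : ℝ → L2Torus d}
    (hUu : ∀ᵐ t ∂volume.restrict (Set.Icc 0 T), U t =ᵐ[torusMeasure d] u t)
    (hu : SolvesLogNLS lam T u) (n : Fin d → ℤ) {χ : ℝ → ℝ} (hχ : IsIntervalTest T χ) :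
    ∫ t in Set.Icc 0 T, (torusCoeff (U t) n * ((deriv χ t : ℝ) : ℂ) +
      Complex.I * (-(laplaceEigenvalue n : ℂ) * torusCoeff (U t) n +
        torusCoeff (fun x => logNonlinearity lam (U t x)) n) * (χ t : ℂ)) = 0 := by
  have h1 := hu _ (isSpaceTimeTest_mul_mFourier hχ (-n))
  have h2 : ∀ᵐ t ∂volume.restrict (Set.Icc 0 T),
      (∫ x, (u t x * (-Complex.I * deriv (fun τ => (χ τ : ℂ) * UnitAddTorus.mFourier (-n) x) t +
        torusLaplacian (fun x => (χ t : ℂ) * UnitAddTorus.mFourier (-n) x) x) +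
        logNonlinearity lam (u t x) * ((χ t : ℂ) * UnitAddTorus.mFourier (-n) x))
          ∂(torusMeasure d)) = -Complex.I * (torusCoeff (U t) n * ((deriv χ t : ℝ) : ℂ) +
      Complex.I * (-(laplaceEigenvalue n : ℂ) * torusCoeff (U t) n +
        torusCoeff (fun x => logNonlinearity lam (U t x)) n) * (χ t : ℂ)) := by
    filter_upwards [hUu] with t ht
    have hd : HasDerivAt (fun s => (χ s : ℂ)) ((deriv χ t : ℝ) : ℂ) t :=
      ((hχ.1.differentiable (by norm_num)) t).hasDerivAt.ofReal_comp
    have hi1 := (hU.integrable t).mul_mFourier (-n)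
    have hi2 := (hU.integrable_logNonlinearity lam t).mul_mFourier (-n)
    have e : ∀ᵐ x ∂(torusMeasure d),
        (u t x * (-Complex.I * deriv (fun τ => (χ τ : ℂ) * UnitAddTorus.mFourier (-n) x) t +
        torusLaplacian (fun x => (χ t : ℂ) * UnitAddTorus.mFourier (-n) x) x) +
        logNonlinearity lam (u t x) * ((χ t : ℂ) * UnitAddTorus.mFourier (-n) x)) =
        (-Complex.I * ((deriv χ t : ℝ) : ℂ) - laplaceEigenvalue n * (χ t : ℂ)) *
          (U t x * UnitAddTorus.mFourier (-n) x) +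
        (χ t : ℂ) * (logNonlinearity lam (U t x) * UnitAddTorus.mFourier (-n) x) := by
      filter_upwards [ht] with x hx
      rw [← hx, torusLaplacian_const_mul_mFourier, (hd.mul_const _).deriv, laplaceEigenvalue_neg]
      ring
    rw [integral_congr_ae e, integral_add (hi1.const_mul _) (hi2.const_mul _),
      integral_const_mul, integral_const_mul]
    unfold torusCoeff
    linear_combination (-(laplaceEigenvalue n : ℂ) * χ t *
      (∫ x, U t x * UnitAddTorus.mFourier (-n) x ∂(torusMeasure d)) +
      (∫ x, logNonlinearity lam (U t x) * UnitAddTorus.mFourier (-n) x ∂(torusMeasure d)) *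
      χ t) * Complex.I_sq
  rw [integral_congr_ae h2, integral_const_mul] at h1
  simpa using h1

/-- The equation for the `n`-th Fourier coefficient, in integrated form. -/
theorem IsBoundedCurve.fourier_equation (hU : IsBoundedCurve M U) {lam T : ℝ} (hT : 0 < T)
    {u : ℝ → L2Torus d} {u₀ : L2Torus d}
    (hUu : ∀ᵐ t ∂volume.restrict (Set.Icc 0 T), U t =ᵐ[torusMeasure d] u t)
    (hu : SolvesLogNLS lam T u) (hu₀ : HasInitialValue u u₀) (n : Fin d → ℤ) :
    ∀ᵐ t ∂volume.restrict (Set.Ioc 0 T), torusCoeff (U t) n = torusCoeff u₀ n +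
      ∫ s in (0 : ℝ)..t, Complex.I * (-(laplaceEigenvalue n : ℂ) * torusCoeff (U s) n +
        torusCoeff (fun x => logNonlinearity lam (U s x)) n) := by
  have hm1 := measurable_torusCoeff hU.measurable n
  have hm2 := measurable_torusCoeff (hU.measurable_logNonlinearity lam) n
  have i1 := integrableOn_Ioc_of_measurable_of_bounded hm1 (hU.norm_torusCoeff_le n) 0 T
  have i2 := integrableOn_Ioc_of_measurable_of_bounded hm2
    (hU.norm_torusCoeff_logNonlinearity_le lam n) 0 T
  refine ae_eq_primitive_of_weak_deriv hT i1
    (((i1.const_mul (-(laplaceEigenvalue n : ℂ))).add i2).const_mul Complex.I)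
    (fun χ hχ => hU.fourier_weak_equation hUu hu n hχ) ?_
  have h1 := hu₀ _ (isSmoothOnTorus_mFourier (-n))
  refine h1.congr' ?_
  have m1 : ∀ᶠ t in 𝓝[>] (0 : ℝ), t ∈ Set.Ioo 0 T := Ioo_mem_nhdsGT hT
  have m2 := (ae_restrict_iff' measurableSet_Icc).1 hUu
  filter_upwards [m1.filter_mono inf_le_left, m2.filter_mono inf_le_right] with t ht ht'
  exact torusCoeff_congr_ae (ht' (Set.Ioo_subset_Icc_self ht)).symm n

end bounded

section parseval

variable {d : ℕ} {f g : UnitAddTorus (Fin d) → ℂ}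

theorem hasSum_torusCoeff_mul_conj (hf : MemLp f 2 (torusMeasure d))
    (hg : MemLp g 2 (torusMeasure d)) :
    HasSum (fun n => torusCoeff f n * conj (torusCoeff g n))
      (∫ x, f x * conj (g x) ∂(torusMeasure d)) := by
  have h := UnitAddTorus.mFourierBasis.hasSum_inner_mul_inner (hg.toLp g) (hf.toLp f)
  have e1 : ∀ n : Fin d → ℤ, inner ℂ (hg.toLp g) (UnitAddTorus.mFourierBasis n) *
      inner ℂ (UnitAddTorus.mFourierBasis n) (hf.toLp f) =
      torusCoeff f n * conj (torusCoeff g n) := by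
    intro n
    rw [← inner_conj_symm]
    erw [← HilbertBasis.repr_apply_apply, ← HilbertBasis.repr_apply_apply]
    rw [mFourierBasis_repr_eq_torusCoeff, mFourierBasis_repr_eq_torusCoeff,
      torusCoeff_congr_ae hf.coeFn_toLp, torusCoeff_congr_ae hg.coeFn_toLp, mul_comm]
  have e2 : inner ℂ (hg.toLp g) (hf.toLp f) = ∫ x, f x * conj (g x) ∂(torusMeasure d) := by
    rw [L2.inner_def]
    refine integral_congr_ae ?_
    filter_upwards [hf.coeFn_toLp, hg.coeFn_toLp] with x h1 h2
    rw [h1, h2, RCLike.inner_apply]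
  erw [e2] at h
  exact (funext e1) ▸ h

theorem hasSum_norm_torusCoeff_sq (hf : MemLp f 2 (torusMeasure d)) :
    HasSum (fun n => ‖torusCoeff f n‖ ^ 2) (∫ x, ‖f x‖ ^ 2 ∂(torusMeasure d)) := by
  have h := hasSum_torusCoeff_mul_conj hf hf
  simp only [Complex.mul_conj'] at h
  have e : (∫ x, ((‖f x‖ : ℂ)) ^ 2 ∂(torusMeasure d)) =
      ((∫ x, ‖f x‖ ^ 2 ∂(torusMeasure d) : ℝ) : ℂ) := by
    rw [← integral_complex_ofReal]
    push_cast
    rfl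
  rw [e] at h
  exact_mod_cast h

theorem sum_norm_torusCoeff_sq_le (hf : MemLp f 2 (torusMeasure d)) (S : Finset (Fin d → ℤ)) :
    ∑ n ∈ S, ‖torusCoeff f n‖ ^ 2 ≤ ∫ x, ‖f x‖ ^ 2 ∂(torusMeasure d) :=
  sum_le_hasSum S (fun _ _ => sq_nonneg _) (hasSum_norm_torusCoeff_sq hf)

theorem norm_sum_torusCoeff_mul_conj_le (hf : MemLp f 2 (torusMeasure d))
    (hg : MemLp g 2 (torusMeasure d)) (S : Finset (Fin d → ℤ)) {δ : ℝ} (hδ : 0 < δ) :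
    ‖∑ n ∈ S, torusCoeff f n * conj (torusCoeff g n)‖ ≤
      δ⁻¹ * (∫ x, ‖f x‖ ^ 2 ∂(torusMeasure d)) + δ * ∫ x, ‖g x‖ ^ 2 ∂(torusMeasure d) := by
  refine (norm_sum_le _ _).trans ?_
  have h1 := mul_le_mul_of_nonneg_left (sum_norm_torusCoeff_sq_le hf S) (inv_nonneg.2 hδ.le)
  have h2 := mul_le_mul_of_nonneg_left (sum_norm_torusCoeff_sq_le hg S) hδ.le
  refine le_trans ?_ (add_le_add h1 h2)
  rw [Finset.mul_sum, Finset.mul_sum, ← Finset.sum_add_distrib]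
  refine Finset.sum_le_sum fun n _ => ?_
  rw [norm_mul, RCLike.norm_conj]
  set p := ‖torusCoeff f n‖
  set q := ‖torusCoeff g n‖
  have h3 : δ⁻¹ * p ^ 2 + δ * q ^ 2 - p * q = δ⁻¹ * ((p - δ * q / 2) ^ 2 + 3 / 4 * (δ * q) ^ 2) := by
    field_simp
    ring
  have h4 : 0 ≤ δ⁻¹ * ((p - δ * q / 2) ^ 2 + 3 / 4 * (δ * q) ^ 2) := by positivity
  linarith

end parseval

/-- The energy identity for a solution of `a' = i(-Λa + F)`, `a(0) = 0`. -/
theorem ae_norm_sq_eq_integral_im {a F : ℝ → ℂ} {L : ℝ} {T A B : ℝ} (ha : Measurable a)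
    (hF : Measurable F) (hA : ∀ t, ‖a t‖ ≤ A) (hB : ∀ t, ‖F t‖ ≤ B)
    (h : ∀ᵐ t ∂volume.restrict (Set.Ioc 0 T),
      a t = ∫ s in (0 : ℝ)..t, Complex.I * (-(L : ℂ) * a s + F s)) :
    ∀ᵐ t ∂volume.restrict (Set.Ioc 0 T),
      ‖a t‖ ^ 2 = -2 * ∫ s in (0 : ℝ)..t, (F s * conj (a s)).im := by
  filter_upwards [h, ae_restrict_mem measurableSet_Ioc] with t ht htT
  have hi : IntegrableOn (fun s => Complex.I * (-(L : ℂ) * a s + F s)) (Set.Ioc 0 t) :=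
    (((integrableOn_Ioc_of_measurable_of_bounded ha hA 0 t).const_mul _).add
      (integrableOn_Ioc_of_measurable_of_bounded hF hB 0 t)).const_mul _
  have hic : IntegrableOn (fun s => conj (Complex.I * (-(L : ℂ) * a s + F s))) (Set.Ioc 0 t) :=
    (LinearIsometryEquiv.integrable_comp_iff (Complex.conjLIE)).2 hi
  have hconj : ∀ t, 0 ≤ t → ∫ s in (0 : ℝ)..t, conj (Complex.I * (-(L : ℂ) * a s + F s)) =
      conj (∫ s in (0 : ℝ)..t, Complex.I * (-(L : ℂ) * a s + F s)) := by
    intro t h0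
    rw [intervalIntegral.integral_of_le h0, intervalIntegral.integral_of_le h0]
    exact integral_conj
  have key := integral_mul_integral_eq htT.1.le hi hic
  rw [hconj t htT.1.le, ← ht, Complex.mul_conj'] at key
  have e : ∫ s in (0 : ℝ)..t, (Complex.I * (-(L : ℂ) * a s + F s) *
      (∫ r in (0 : ℝ)..s, conj (Complex.I * (-(L : ℂ) * a r + F r))) +
      (∫ r in (0 : ℝ)..s, Complex.I * (-(L : ℂ) * a r + F r)) *
        conj (Complex.I * (-(L : ℂ) * a s + F s))) =
      ∫ s in (0 : ℝ)..t, ((-2 * (F s * conj (a s)).im : ℝ) : ℂ) := by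
    rw [intervalIntegral.integral_of_le htT.1.le, intervalIntegral.integral_of_le htT.1.le]
    refine integral_congr_ae ?_
    filter_upwards [ae_restrict_of_ae_restrict_of_subset (Set.Ioc_subset_Ioc_right htT.2) h,
      ae_restrict_mem measurableSet_Ioc] with s hs hst
    rw [hconj s hst.1.le, ← hs]
    apply Complex.ext <;> simp <;> ring
  rw [e, intervalIntegral.integral_ofReal, intervalIntegral.integral_const_mul] at key
  exact_mod_cast key

theorem integrable_norm_sq_sub {d : ℕ} {f g : UnitAddTorus (Fin d) → ℂ}
    (hf : MemLp f 2 (torusMeasure d)) (hg : MemLp g 2 (torusMeasure d)) :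
    Integrable (fun x => ‖f x - g x‖ ^ 2) (torusMeasure d) :=
  (hf.sub hg).integrable_norm_pow (by norm_num)

section difference

variable {d : ℕ} {M : ℝ} {U V : ℝ → UnitAddTorus (Fin d) → ℂ}

theorem IsBoundedCurve.sub (hU : IsBoundedCurve M U) (hV : IsBoundedCurve M V) :
    IsBoundedCurve (4 * M) fun t x => U t x - V t x where
  measurable := hU.measurable.sub hV.measurable
  memLp t := (hU.memLp t).sub (hV.memLp t)
  bound t := by
    have h1 := (hU.integrable_sq t).const_mul 2
    have h2 := (hV.integrable_sq t).const_mul 2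
    refine (integral_mono (integrable_norm_sq_sub (hU.memLp t) (hV.memLp t)) (h1.add h2)
      fun x => ?_).trans ?_
    · simp only [Pi.add_apply]
      have := norm_sub_le (U t x) (V t x)
      have h0 := norm_nonneg (U t x - V t x)
      nlinarith [sq_nonneg (‖U t x‖ - ‖V t x‖)]
    · simp only [Pi.add_apply]
      rw [integral_add h1 h2, integral_const_mul, integral_const_mul]
      linarith [hU.bound t, hV.bound t]

/-- The difference of the nonlinearities. -/
noncomputable def logDiff (lam : ℝ) (z w : ℂ) : ℂ := logNonlinearity lam z - logNonlinearity lam w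

open Classical in
/-- The part of `logDiff` on the set where both arguments have modulus at most `R`. -/
noncomputable def logDiffLow (lam R : ℝ) (z w : ℂ) : ℂ :=
  if ‖z‖ ≤ R ∧ ‖w‖ ≤ R then logDiff lam z w else 0

open Classical in
/-- The part of `logDiff` on the set where one of the arguments has modulus greater than `R`. -/
noncomputable def logDiffHigh (lam R : ℝ) (z w : ℂ) : ℂ :=
  if ‖z‖ ≤ R ∧ ‖w‖ ≤ R then 0 else logDiff lam z w

theorem logDiffLow_eq_sub (lam R : ℝ) (z w : ℂ) :
    logDiffLow lam R z w = logDiff lam z w - logDiffHigh lam R z w := by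
  unfold logDiffLow logDiffHigh
  split_ifs <;> simp

theorem norm_logDiffHigh_le (lam R : ℝ) (z w : ℂ) : ‖logDiffHigh lam R z w‖ ≤ ‖logDiff lam z w‖ := by
  unfold logDiffHigh
  split_ifs <;> simp

theorem norm_logDiffLow_le (lam R : ℝ) (z w : ℂ) :
    ‖logDiffLow lam R z w‖ ≤ 16 * |lam| * (1 + R ^ 2) := by
  unfold logDiffLow
  split_ifs with h
  · refine (norm_sub_le _ _).trans ?_
    have h1 := norm_logNonlinearity_le_sq lam z
    have h2 := norm_logNonlinearity_le_sq lam w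
    have h3 := pow_le_pow_left₀ (norm_nonneg z) h.1 2
    have h4 := pow_le_pow_left₀ (norm_nonneg w) h.2 2
    nlinarith [abs_nonneg lam]
  · rw [norm_zero]
    positivity

theorem abs_im_logDiffLow_mul_conj_le (lam R : ℝ) (z w : ℂ) :
    |(logDiffLow lam R z w * conj (z - w)).im| ≤ 2 * |lam| * ‖z - w‖ ^ 2 := by
  unfold logDiffLow
  split_ifs with h
  · exact abs_im_logNonlinearity_sub_mul_conj_le lam z w
  · rw [zero_mul, Complex.zero_im, abs_zero]
    positivity

theorem tendsto_logDiffHigh (lam : ℝ) (z w : ℂ) :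
    Tendsto (fun R : ℕ => logDiffHigh lam R z w) atTop (𝓝 0) := by
  refine tendsto_const_nhds.congr' ?_
  have h1 := tendsto_natCast_atTop_atTop (R := ℝ)
  filter_upwards [h1.eventually_ge_atTop ‖z‖, h1.eventually_ge_atTop ‖w‖] with R hz hw
  rw [logDiffHigh, if_pos ⟨hz, hw⟩]

theorem measurable_logDiff (hU : IsBoundedCurve M U) (hV : IsBoundedCurve M V) (lam : ℝ) :
    Measurable (Function.uncurry fun t x => logDiff lam (U t x) (V t x)) :=
  (hU.measurable_logNonlinearity lam).sub (hV.measurable_logNonlinearity lam)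

theorem measurable_logDiffHigh (hU : IsBoundedCurve M U) (hV : IsBoundedCurve M V) (lam R : ℝ) :
    Measurable (Function.uncurry fun t x => logDiffHigh lam R (U t x) (V t x)) := by
  classical
  refine Measurable.ite ?_ measurable_const (measurable_logDiff hU hV lam)
  exact (measurableSet_le hU.measurable.norm measurable_const).inter
    (measurableSet_le hV.measurable.norm measurable_const)

theorem measurable_logDiffLow (hU : IsBoundedCurve M U) (hV : IsBoundedCurve M V) (lam R : ℝ) :
    Measurable (Function.uncurry fun t x => logDiffLow lam R (U t x) (V t x)) := by
  classical
  refine Measurable.ite ?_ (measurable_logDiff hU hV lam) measurable_const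
  exact (measurableSet_le hU.measurable.norm measurable_const).inter
    (measurableSet_le hV.measurable.norm measurable_const)

theorem integrable_logDiff (hU : IsBoundedCurve M U) (hV : IsBoundedCurve M V) (lam t : ℝ) :
    Integrable (fun x => logDiff lam (U t x) (V t x)) (torusMeasure d) :=
  (hU.integrable_logNonlinearity lam t).sub (hV.integrable_logNonlinearity lam t)

theorem integrable_logDiffHigh (hU : IsBoundedCurve M U) (hV : IsBoundedCurve M V) (lam R t : ℝ) :
    Integrable (fun x => logDiffHigh lam R (U t x) (V t x)) (torusMeasure d) :=
  (integrable_logDiff hU hV lam t).mono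
    ((measurable_logDiffHigh hU hV lam R).comp measurable_prodMk_left).aestronglyMeasurable
    (.of_forall fun _ => norm_logDiffHigh_le _ _ _ _)

theorem integral_norm_logDiff_le (hU : IsBoundedCurve M U) (hV : IsBoundedCurve M V) (lam t : ℝ) :
    ∫ x, ‖logDiff lam (U t x) (V t x)‖ ∂(torusMeasure d) ≤ 16 * |lam| * (1 + M) := by
  have h1 := (hU.integrable_logNonlinearity lam t).norm
  have h2 := (hV.integrable_logNonlinearity lam t).norm
  refine (integral_mono (integrable_logDiff hU hV lam t).norm (h1.add h2)
    fun x => norm_sub_le _ _).trans ?_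
  simp only [Pi.add_apply]
  rw [integral_add h1 h2]
  linarith [hU.integral_norm_logNonlinearity_le lam t, hV.integral_norm_logNonlinearity_le lam t]

theorem norm_torusCoeff_logDiff_le (hU : IsBoundedCurve M U) (hV : IsBoundedCurve M V) (lam : ℝ)
    (n : Fin d → ℤ) (t : ℝ) :
    ‖torusCoeff (fun x => logDiff lam (U t x) (V t x)) n‖ ≤ 16 * |lam| * (1 + M) :=
  (norm_torusCoeff_le _ _).trans (integral_norm_logDiff_le hU hV lam t)

theorem norm_torusCoeff_logDiffHigh_le (hU : IsBoundedCurve M U) (hV : IsBoundedCurve M V)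
    (lam R : ℝ) (n : Fin d → ℤ) (t : ℝ) :
    ‖torusCoeff (fun x => logDiffHigh lam R (U t x) (V t x)) n‖ ≤ 16 * |lam| * (1 + M) :=
  (norm_torusCoeff_le _ _).trans <| (integral_mono (integrable_logDiffHigh hU hV lam R t).norm
    (integrable_logDiff hU hV lam t).norm fun _ => norm_logDiffHigh_le _ _ _ _).trans
    (integral_norm_logDiff_le hU hV lam t)

theorem memLp_logDiffLow (hU : IsBoundedCurve M U) (hV : IsBoundedCurve M V) (lam R t : ℝ) :
    MemLp (fun x => logDiffLow lam R (U t x) (V t x)) 2 (torusMeasure d) :=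
  MemLp.of_bound
    ((measurable_logDiffLow hU hV lam R).comp measurable_prodMk_left).aestronglyMeasurable
    (16 * |lam| * (1 + R ^ 2)) (.of_forall fun _ => norm_logDiffLow_le _ _ _ _)

/-- The equation for the difference of two solutions on the Fourier side. -/
def FourierDifferenceEquation (lam T : ℝ) (U V : ℝ → UnitAddTorus (Fin d) → ℂ) : Prop :=
  ∀ n, ∀ᵐ t ∂volume.restrict (Set.Ioc 0 T), torusCoeff (fun x => U t x - V t x) n =
    ∫ s in (0 : ℝ)..t, Complex.I * (-(laplaceEigenvalue n : ℂ) *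
      torusCoeff (fun x => U s x - V s x) n + torusCoeff (fun x => logDiff lam (U s x) (V s x)) n)

theorem fourierDifferenceEquation (hU : IsBoundedCurve M U) (hV : IsBoundedCurve M V)
    {lam T : ℝ} (hT : 0 < T) {u v : ℝ → L2Torus d} {u₀ : L2Torus d}
    (hUu : ∀ᵐ t ∂volume.restrict (Set.Icc 0 T), U t =ᵐ[torusMeasure d] u t)
    (hVv : ∀ᵐ t ∂volume.restrict (Set.Icc 0 T), V t =ᵐ[torusMeasure d] v t)
    (hu : SolvesLogNLS lam T u) (hu₀ : HasInitialValue u u₀)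
    (hv : SolvesLogNLS lam T v) (hv₀ : HasInitialValue v u₀) :
    FourierDifferenceEquation lam T U V := by
  intro n
  filter_upwards [hU.fourier_equation hT hUu hu hu₀ n, hV.fourier_equation hT hVv hv hv₀ n,
    ae_restrict_mem measurableSet_Ioc] with t h1 h2 ht
  have hi : ∀ {W : ℝ → UnitAddTorus (Fin d) → ℂ}, IsBoundedCurve M W →
      IntervalIntegrable (fun s => Complex.I * (-(laplaceEigenvalue n : ℂ) * torusCoeff (W s) n +
        torusCoeff (fun x => logNonlinearity lam (W s x)) n)) volume 0 t := by
    intro W hW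
    rw [intervalIntegrable_iff_integrableOn_Ioc_of_le ht.1.le]
    exact (((integrableOn_Ioc_of_measurable_of_bounded (measurable_torusCoeff hW.measurable n)
      (hW.norm_torusCoeff_le n) 0 t).const_mul _).add
      (integrableOn_Ioc_of_measurable_of_bounded
        (measurable_torusCoeff (hW.measurable_logNonlinearity lam) n)
      (hW.norm_torusCoeff_logNonlinearity_le lam n) 0 t)).const_mul _
  rw [torusCoeff_sub (hU.integrable t) (hV.integrable t), h1, h2, add_sub_add_left_eq_sub,
    ← intervalIntegral.integral_sub (hi hU) (hi hV)]
  refine intervalIntegral.integral_congr fun s _ => ?_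
  simp only [torusCoeff_sub (hU.integrable s) (hV.integrable s), logDiff,
    torusCoeff_sub (hU.integrable_logNonlinearity lam s) (hV.integrable_logNonlinearity lam s)]
  ring

end difference

section core

variable {d : ℕ} {M : ℝ} {U V : ℝ → UnitAddTorus (Fin d) → ℂ}

theorem measurable_integral_norm_sq {α : Type*} [MeasurableSpace α]
    {W : α → UnitAddTorus (Fin d) → ℂ} (hW : Measurable (Function.uncurry W)) :
    Measurable fun t => ∫ x, ‖W t x‖ ^ 2 ∂(torusMeasure d) :=
  StronglyMeasurable.measurable (StronglyMeasurable.integral_prod_right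
    (f := fun t x => ‖W t x‖ ^ 2) (hW.norm.pow_const 2).stronglyMeasurable)

theorem IsBoundedCurve.integrableOn_norm_sq (hU : IsBoundedCurve M U) (a b : ℝ) :
    IntegrableOn (fun t => ∫ x, ‖U t x‖ ^ 2 ∂(torusMeasure d)) (Set.Ioc a b) := by
  refine Measure.integrableOn_of_bounded (M := M) (by simp)
    (measurable_integral_norm_sq hU.measurable).aestronglyMeasurable (.of_forall fun t => ?_)
  rw [Real.norm_of_nonneg (integral_nonneg fun x => sq_nonneg _)]
  exact hU.bound t

/-- Passage to the limit in the part of the energy identity with bounded nonlinearity. -/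
theorem tendsto_integral_sum_logDiffLow (hU : IsBoundedCurve M U) (hV : IsBoundedCurve M V)
    (lam R t : ℝ) :
    Tendsto (fun S : Finset (Fin d → ℤ) => ∫ s in (0 : ℝ)..t, ∑ n ∈ S,
        torusCoeff (fun x => logDiffLow lam R (U s x) (V s x)) n *
          conj (torusCoeff (fun x => U s x - V s x) n)) atTop
      (𝓝 (∫ s in (0 : ℝ)..t, ∫ x, logDiffLow lam R (U s x) (V s x) * conj (U s x - V s x)
        ∂(torusMeasure d))) := by
  have hW := hU.sub hV
  have hm1 := fun n : Fin d → ℤ => measurable_torusCoeff (measurable_logDiffLow hU hV lam R) n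
  have hm2 := fun n : Fin d → ℤ => measurable_torusCoeff hW.measurable n
  refine intervalIntegral.tendsto_integral_filter_of_dominated_convergence
    (fun _ => (16 * |lam| * (1 + R ^ 2)) ^ 2 + 4 * M) ?_ ?_ (by simp) ?_
  · refine .of_forall fun S => Measurable.aestronglyMeasurable ?_
    exact Finset.measurable_sum _ fun n _ =>
      (hm1 n).mul (Complex.continuous_conj.measurable.comp (hm2 n))
  · refine .of_forall fun S => .of_forall fun s _ => ?_
    refine (norm_sum_torusCoeff_mul_conj_le (memLp_logDiffLow hU hV lam R s) (hW.memLp s) S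
      one_pos).trans ?_
    rw [inv_one, one_mul, one_mul]
    refine add_le_add ?_ (hW.bound s)
    have h1 : ∀ x, ‖logDiffLow lam R (U s x) (V s x)‖ ^ 2 ≤ (16 * |lam| * (1 + R ^ 2)) ^ 2 :=
      fun x => pow_le_pow_left₀ (norm_nonneg _) (norm_logDiffLow_le _ _ _ _) 2
    refine (integral_mono ((memLp_logDiffLow hU hV lam R s).integrable_norm_pow (by norm_num))
      (integrable_const _) h1).trans ?_
    simp
  · exact .of_forall fun s _ => hasSum_torusCoeff_mul_conj (memLp_logDiffLow hU hV lam R s)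
      (hW.memLp s)

/-- Two curves with the same initial value whose difference solves the equation coincide, provided
that the pairing of the large part of the nonlinearity with the difference is negligible. -/
theorem ae_eq_of_high_part_small (hU : IsBoundedCurve M U) (hV : IsBoundedCurve M V)
    {lam T : ℝ} (hT : 0 < T) (hEq : FourierDifferenceEquation lam T U V)
    (hE : ∀ t ∈ Set.Ioo 0 T, ∀ ε > 0, ∃ R : ℝ, ∀ S : Finset (Fin d → ℤ),
      ‖∫ s in (0 : ℝ)..t, ∑ n ∈ S, torusCoeff (fun x => logDiffHigh lam R (U s x) (V s x)) n *
        conj (torusCoeff (fun x => U s x - V s x) n)‖ ≤ ε) :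
    ∀ᵐ t ∂volume.restrict (Set.Ioc 0 T), U t =ᵐ[torusMeasure d] V t := by
  have hW := hU.sub hV
  set y : ℝ → ℝ := fun t => ∫ x, ‖U t x - V t x‖ ^ 2 ∂(torusMeasure d) with hy
  have hy0 : ∀ t, 0 ≤ y t := fun t => integral_nonneg fun x => sq_nonneg _
  have hyI : ∀ a b, IntegrableOn y (Set.Ioc a b) := hW.integrableOn_norm_sq
  have hen : ∀ᵐ t ∂volume.restrict (Set.Ioc 0 T), ∀ n,
      ‖torusCoeff (fun x => U t x - V t x) n‖ ^ 2 = -2 * ∫ s in (0 : ℝ)..t,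
        (torusCoeff (fun x => logDiff lam (U s x) (V s x)) n *
          conj (torusCoeff (fun x => U s x - V s x) n)).im :=
    ae_all_iff.2 fun n => ae_norm_sq_eq_integral_im (measurable_torusCoeff hW.measurable n)
      (measurable_torusCoeff (measurable_logDiff hU hV lam) n) (hW.norm_torusCoeff_le n)
      (norm_torusCoeff_logDiff_le hU hV lam n) (hEq n)
  have hmain : ∀ᵐ t ∂volume.restrict (Set.Ioc 0 T), y t ≤ 4 * |lam| * ∫ s in (0 : ℝ)..t, y s := by
    have hlt : ∀ᵐ t ∂volume.restrict (Set.Ioc 0 T), t ∈ Set.Ioo 0 T := by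
      rw [Measure.restrict_congr_set Ioo_ae_eq_Ioc.symm]
      exact ae_restrict_mem measurableSet_Ioo
    filter_upwards [hen, hlt] with t ht htT
    refine le_of_forall_pos_le_add fun ε hε => ?_
    obtain ⟨R, hR⟩ := hE t htT (ε / 2) (by positivity)
    have hint : ∀ {P : ℝ → UnitAddTorus (Fin d) → ℂ} {B : ℝ}, Measurable (Function.uncurry P) →
        ∀ n, (∀ s, ‖torusCoeff (P s) n‖ ≤ B) → IntervalIntegrable (fun s => torusCoeff (P s) n *
          conj (torusCoeff (fun x => U s x - V s x) n)) volume 0 t := by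
      intro P B hP n hB
      rw [intervalIntegrable_iff_integrableOn_Ioc_of_le htT.1.le]
      refine integrableOn_Ioc_of_measurable_of_bounded (C := B * (1 + 4 * M))
        ((measurable_torusCoeff hP n).mul
          (Complex.continuous_conj.measurable.comp (measurable_torusCoeff hW.measurable n)))
        (fun s => ?_) 0 t
      simp only [Pi.mul_apply, Function.comp_apply, norm_mul, RCLike.norm_conj]
      exact mul_le_mul (hB s) (hW.norm_torusCoeff_le n s) (norm_nonneg _)
        ((norm_nonneg _).trans (hB s))
    have hiD := fun n => hint (measurable_logDiff hU hV lam) n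
      (norm_torusCoeff_logDiff_le hU hV lam n)
    have hiH := fun n => hint (measurable_logDiffHigh hU hV lam R) n
      (norm_torusCoeff_logDiffHigh_le hU hV lam R n)
    have hLow : ∀ s n, torusCoeff (fun x => logDiffLow lam R (U s x) (V s x)) n =
        torusCoeff (fun x => logDiff lam (U s x) (V s x)) n -
        torusCoeff (fun x => logDiffHigh lam R (U s x) (V s x)) n := by
      intro s n
      rw [← torusCoeff_sub (integrable_logDiff hU hV lam s) (integrable_logDiffHigh hU hV lam R s)]
      simp only [logDiffLow_eq_sub]
    have him : ∀ {f : ℝ → ℂ}, IntervalIntegrable f volume 0 t →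
        ∫ s in (0 : ℝ)..t, (f s).im = (∫ s in (0 : ℝ)..t, f s).im := by
      intro f hf
      rw [intervalIntegral.integral_of_le htT.1.le, intervalIntegral.integral_of_le htT.1.le]
      exact integral_im hf.1
    have hS : ∀ S : Finset (Fin d → ℤ), ∑ n ∈ S, ‖torusCoeff (fun x => U t x - V t x) n‖ ^ 2 ≤
        -2 * (∫ s in (0 : ℝ)..t, ∑ n ∈ S,
          torusCoeff (fun x => logDiffLow lam R (U s x) (V s x)) n *
            conj (torusCoeff (fun x => U s x - V s x) n)).im + ε := by
      intro S
      have e1 : ∑ n ∈ S, ‖torusCoeff (fun x => U t x - V t x) n‖ ^ 2 =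
          -2 * (∑ n ∈ S, ∫ s in (0 : ℝ)..t, torusCoeff (fun x => logDiff lam (U s x) (V s x)) n *
            conj (torusCoeff (fun x => U s x - V s x) n)).im := by
        rw [Complex.im_sum, Finset.mul_sum]
        refine Finset.sum_congr rfl fun n _ => ?_
        rw [ht n, him (hiD n)]
      have e2 : ∑ n ∈ S, (∫ s in (0 : ℝ)..t, torusCoeff (fun x => logDiff lam (U s x) (V s x)) n *
            conj (torusCoeff (fun x => U s x - V s x) n)) =
          (∫ s in (0 : ℝ)..t, ∑ n ∈ S,
            torusCoeff (fun x => logDiffLow lam R (U s x) (V s x)) n *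
            conj (torusCoeff (fun x => U s x - V s x) n)) +
          ∫ s in (0 : ℝ)..t, ∑ n ∈ S,
            torusCoeff (fun x => logDiffHigh lam R (U s x) (V s x)) n *
            conj (torusCoeff (fun x => U s x - V s x) n) := by
        simp only [hLow, sub_mul]
        rw [intervalIntegral.integral_finsetSum fun n _ => hiH n,
          intervalIntegral.integral_finsetSum fun n _ => (hiD n).sub (hiH n),
          ← Finset.sum_add_distrib]
        refine Finset.sum_congr rfl fun n _ => ?_
        rw [intervalIntegral.integral_sub (hiD n) (hiH n)]
        ring
      rw [e1, e2, Complex.add_im]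
      have h1 := (Complex.abs_im_le_norm _).trans (hR S)
      rw [abs_le] at h1
      linarith [h1.1]
    have hlimL := hasSum_norm_torusCoeff_sq (hW.memLp t)
    have hlimR := ((Complex.continuous_im.tendsto _).comp
      (tendsto_integral_sum_logDiffLow hU hV lam R t)).const_mul (-2) |>.add_const ε
    have hle := le_of_tendsto_of_tendsto' hlimL hlimR hS
    refine hle.trans (add_le_add_left ?_ ε)
    have hbd : ∀ s, |(∫ x, logDiffLow lam R (U s x) (V s x) * conj (U s x - V s x)
        ∂(torusMeasure d)).im| ≤ 2 * |lam| * y s := by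
      intro s
      have hi : Integrable (fun x => logDiffLow lam R (U s x) (V s x) * conj (U s x - V s x))
          (torusMeasure d) :=
        (memLp_logDiffLow hU hV lam R s).integrable_mul (hW.memLp s).star
      have h1 : (∫ x, logDiffLow lam R (U s x) (V s x) * conj (U s x - V s x)
        ∂(torusMeasure d)).im = ∫ x, (logDiffLow lam R (U s x) (V s x) * conj (U s x - V s x)).im
        ∂(torusMeasure d) := (integral_im hi).symm
      rw [h1, hy, ← integral_const_mul]
      refine abs_integral_le_integral_abs.trans (integral_mono hi.im.abs
        ((hW.integrable_sq s).const_mul _) fun x => abs_im_logDiffLow_mul_conj_le lam R _ _)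
    have hmeas : Measurable fun s => ∫ x, logDiffLow lam R (U s x) (V s x) * conj (U s x - V s x)
        ∂(torusMeasure d) := by
      refine StronglyMeasurable.measurable (StronglyMeasurable.integral_prod_right
        (f := fun s x => logDiffLow lam R (U s x) (V s x) * conj (U s x - V s x))
        (Measurable.stronglyMeasurable ?_))
      exact (measurable_logDiffLow hU hV lam R).mul
        (Complex.continuous_conj.measurable.comp hW.measurable)
    have hIm : IntervalIntegrable (fun s => ∫ x, logDiffLow lam R (U s x) (V s x) *
        conj (U s x - V s x) ∂(torusMeasure d)) volume 0 t := by
      rw [intervalIntegrable_iff_integrableOn_Ioc_of_le htT.1.le]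
      refine integrableOn_Ioc_of_measurable_of_bounded
        (C := (16 * |lam| * (1 + R ^ 2)) * (1 + 4 * M)) hmeas (fun s => ?_) 0 t
      refine (norm_integral_le_integral_norm _).trans ?_
      have hb : ∀ x, ‖logDiffLow lam R (U s x) (V s x) * conj (U s x - V s x)‖ ≤
          (16 * |lam| * (1 + R ^ 2)) * ‖U s x - V s x‖ := by
        intro x
        rw [norm_mul, RCLike.norm_conj]
        exact mul_le_mul_of_nonneg_right (norm_logDiffLow_le _ _ _ _) (norm_nonneg _)
      refine (integral_mono_of_nonneg (.of_forall fun x => norm_nonneg _)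
        ((hW.integrable s).norm.const_mul _) (.of_forall hb)).trans ?_
      rw [integral_const_mul]
      exact mul_le_mul_of_nonneg_left (hW.integral_norm_le s) (by positivity)
    rw [← him hIm, ← intervalIntegral.integral_const_mul, ← intervalIntegral.integral_const_mul]
    refine intervalIntegral.integral_mono_on htT.1.le ?_ ?_ fun s _ => ?_
    · exact (IntervalIntegrable.const_mul ⟨hIm.1.im, hIm.2.im⟩ _)
    · exact ((intervalIntegrable_iff_integrableOn_Ioc_of_le htT.1.le).2 (hyI 0 t)).const_mul _
    · have := (abs_le.1 (hbd s)).1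
      linarith
  filter_upwards [ae_eq_zero_of_le_const_mul_integral hT.le (by positivity) hy0 (hyI 0 T) hmain]
    with t ht
  have h1 := (integral_eq_zero_iff_of_nonneg (fun x => sq_nonneg _) (hW.integrable_sq t)).1 ht
  filter_upwards [h1] with x hx
  have h2 : ‖U t x - V t x‖ ^ 2 = 0 := hx
  exact sub_eq_zero.1 (norm_eq_zero.1 (pow_eq_zero_iff two_ne_zero |>.1 h2))

end core

section high

variable {d : ℕ} {M : ℝ} {U V : ℝ → UnitAddTorus (Fin d) → ℂ}

theorem measurable_integral_logDiffHigh_rpow (hU : IsBoundedCurve M U) (hV : IsBoundedCurve M V)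
    (lam R p : ℝ) :
    Measurable fun s => ∫ x, ‖logDiffHigh lam R (U s x) (V s x)‖ ^ p ∂(torusMeasure d) :=
  StronglyMeasurable.measurable (StronglyMeasurable.integral_prod_right
    (f := fun s x => ‖logDiffHigh lam R (U s x) (V s x)‖ ^ p)
    ((measurable_logDiffHigh hU hV lam R).norm.pow_const p).stronglyMeasurable)

theorem integrable_logDiffHigh_rpow (hU : IsBoundedCurve M U) (hV : IsBoundedCurve M V)
    {lam p : ℝ} (hp : 0 < p) (R s : ℝ)
    (h : Integrable (fun x => ‖logDiff lam (U s x) (V s x)‖ ^ p) (torusMeasure d)) :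
    Integrable (fun x => ‖logDiffHigh lam R (U s x) (V s x)‖ ^ p) (torusMeasure d) := by
  refine h.mono' (((measurable_logDiffHigh hU hV lam R).comp
    measurable_prodMk_left).norm.pow_const p).aestronglyMeasurable (.of_forall fun x => ?_)
  rw [Real.norm_of_nonneg (by positivity)]
  exact Real.rpow_le_rpow (norm_nonneg _) (norm_logDiffHigh_le _ _ _ _) hp.le

theorem integral_logDiffHigh_rpow_le (hU : IsBoundedCurve M U) (hV : IsBoundedCurve M V)
    {lam p : ℝ} (hp : 0 < p) (R s : ℝ)
    (h : Integrable (fun x => ‖logDiff lam (U s x) (V s x)‖ ^ p) (torusMeasure d)) :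
    ∫ x, ‖logDiffHigh lam R (U s x) (V s x)‖ ^ p ∂(torusMeasure d) ≤
      ∫ x, ‖logDiff lam (U s x) (V s x)‖ ^ p ∂(torusMeasure d) :=
  integral_mono (integrable_logDiffHigh_rpow hU hV hp R s h) h fun _ =>
    Real.rpow_le_rpow (norm_nonneg _) (norm_logDiffHigh_le _ _ _ _) hp.le

theorem tendsto_integral_logDiffHigh_rpow (hU : IsBoundedCurve M U) (hV : IsBoundedCurve M V)
    {lam p B t : ℝ} (hp : 0 < p) (ht : 0 ≤ t)
    (h : ∀ᵐ s ∂volume.restrict (Set.Ioc 0 t),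
      Integrable (fun x => ‖logDiff lam (U s x) (V s x)‖ ^ p) (torusMeasure d) ∧
      ∫ x, ‖logDiff lam (U s x) (V s x)‖ ^ p ∂(torusMeasure d) ≤ B) :
    Tendsto (fun R : ℕ => ∫ s in (0 : ℝ)..t,
      ∫ x, ‖logDiffHigh lam R (U s x) (V s x)‖ ^ p ∂(torusMeasure d)) atTop (𝓝 0) := by
  rw [show 𝓝 (0 : ℝ) = 𝓝 (∫ s in (0 : ℝ)..t, (0 : ℝ)) by simp]
  have h' := (ae_restrict_iff' measurableSet_Ioc).1 h
  refine intervalIntegral.tendsto_integral_filter_of_dominated_convergence (fun _ => B) ?_ ?_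
    (by simp) ?_
  · exact .of_forall fun R =>
      (measurable_integral_logDiffHigh_rpow hU hV lam R p).aestronglyMeasurable
  · refine .of_forall fun R => ?_
    filter_upwards [h'] with s hs hst
    rw [Set.uIoc_of_le ht] at hst
    rw [Real.norm_of_nonneg (integral_nonneg fun x => by positivity)]
    exact (integral_logDiffHigh_rpow_le hU hV hp R s (hs hst).1).trans (hs hst).2
  · filter_upwards [h'] with s hs hst
    rw [Set.uIoc_of_le ht] at hst
    rw [show 𝓝 (0 : ℝ) = 𝓝 (∫ x : UnitAddTorus (Fin d), (0 : ℝ) ∂(torusMeasure d)) by simp]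
    refine tendsto_integral_filter_of_dominated_convergence
      (fun x => ‖logDiff lam (U s x) (V s x)‖ ^ p) ?_ ?_ (hs hst).1 ?_
    · exact .of_forall fun R => (integrable_logDiffHigh_rpow hU hV hp R s
        (hs hst).1).aestronglyMeasurable
    · refine .of_forall fun R => .of_forall fun x => ?_
      rw [Real.norm_of_nonneg (by positivity)]
      exact Real.rpow_le_rpow (norm_nonneg _) (norm_logDiffHigh_le _ _ _ _) hp.le
    · refine .of_forall fun x => ?_
      have h1 := ((tendsto_logDiffHigh lam (U s x) (V s x)).norm).rpow_const (p := p) (Or.inr hp.le)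
      rwa [norm_zero, Real.zero_rpow hp.ne'] at h1

/-- If the nonlinearity is bounded in `L²`, then the pairing of its large part with the difference
is negligible. -/
theorem high_part_small_of_sq_integrable (hU : IsBoundedCurve M U) (hV : IsBoundedCurve M V)
    {lam B t : ℝ} (ht : 0 ≤ t)
    (h : ∀ᵐ s ∂volume.restrict (Set.Ioc 0 t),
      Integrable (fun x => ‖logDiff lam (U s x) (V s x)‖ ^ (2 : ℝ)) (torusMeasure d) ∧
      ∫ x, ‖logDiff lam (U s x) (V s x)‖ ^ (2 : ℝ) ∂(torusMeasure d) ≤ B) {ε : ℝ} (hε : 0 < ε) :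
    ∃ R : ℝ, ∀ S : Finset (Fin d → ℤ),
      ‖∫ s in (0 : ℝ)..t, ∑ n ∈ S, torusCoeff (fun x => logDiffHigh lam R (U s x) (V s x)) n *
        conj (torusCoeff (fun x => U s x - V s x) n)‖ ≤ ε := by
  have hW := hU.sub hV
  have hM : 0 ≤ 4 * M := (integral_nonneg fun x => sq_nonneg _).trans (hW.bound 0)
  obtain ⟨δ, hδ, hδε⟩ : ∃ δ > 0, δ * (4 * M) * t ≤ ε / 2 := by
    refine ⟨ε / 2 / (4 * M * t + 1), by positivity, ?_⟩
    rw [mul_assoc, div_mul_eq_mul_div, div_le_iff₀ (by positivity)]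
    nlinarith
  have hlim := tendsto_integral_logDiffHigh_rpow hU hV two_pos ht h
  obtain ⟨R, hR⟩ := (hlim.eventually (gt_mem_nhds (show 0 < δ * (ε / 2) by positivity))).exists
  refine ⟨R, fun S => ?_⟩
  have hI : IntervalIntegrable (fun s => ∫ x, ‖logDiffHigh lam R (U s x) (V s x)‖ ^ (2 : ℝ)
      ∂(torusMeasure d)) volume 0 t := by
    rw [intervalIntegrable_iff_integrableOn_Ioc_of_le ht]
    refine Measure.integrableOn_of_bounded (M := B) (by simp)
      (measurable_integral_logDiffHigh_rpow hU hV lam R 2).aestronglyMeasurable ?_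
    filter_upwards [h] with s hs
    rw [Real.norm_of_nonneg (integral_nonneg fun x => by positivity)]
    exact (integral_logDiffHigh_rpow_le hU hV two_pos R s hs.1).trans hs.2
  have hle := intervalIntegral.norm_integral_le_of_norm_le ht (f := fun s => ∑ n ∈ S,
      torusCoeff (fun x => logDiffHigh lam R (U s x) (V s x)) n *
        conj (torusCoeff (fun x => U s x - V s x) n))
      (g := fun s => δ⁻¹ * (∫ x, ‖logDiffHigh lam R (U s x) (V s x)‖ ^ (2 : ℝ) ∂(torusMeasure d))
        + δ * (4 * M)) (μ := volume) ?_ ((hI.const_mul _).add (by simp))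
  · refine hle.trans ?_
    rw [intervalIntegral.integral_add (hI.const_mul _) (by simp), intervalIntegral.integral_const_mul,
      intervalIntegral.integral_const, smul_eq_mul, sub_zero]
    have h1 : δ⁻¹ * (∫ s in (0 : ℝ)..t,
        ∫ x, ‖logDiffHigh lam R (U s x) (V s x)‖ ^ (2 : ℝ) ∂(torusMeasure d)) ≤ ε / 2 := by
      rw [inv_mul_le_iff₀ hδ]
      exact hR.le
    linarith
  · filter_upwards [(ae_restrict_iff' measurableSet_Ioc).1 h] with s hs hst
    have hHi := integrable_logDiffHigh_rpow hU hV two_pos R s (hs hst).1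
    have hmem : MemLp (fun x => logDiffHigh lam R (U s x) (V s x)) 2 (torusMeasure d) := by
      refine (memLp_two_iff_integrable_sq_norm ((measurable_logDiffHigh hU hV lam R).comp
        measurable_prodMk_left).aestronglyMeasurable).2 ?_
      simpa only [Real.rpow_two, Function.comp_apply, Function.uncurry_apply_pair] using hHi
    refine (norm_sum_torusCoeff_mul_conj_le hmem (hW.memLp s) S hδ).trans ?_
    simp only [Real.rpow_two]
    exact add_le_add le_rfl (mul_le_mul_of_nonneg_left (hW.bound s) hδ.le)

end high

section sobolev

variable {d : ℕ}

/-- The trigonometric polynomial with the Fourier coefficients of `f` in the finite set `S`. -/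
noncomputable def fourierPartialSum (f : UnitAddTorus (Fin d) → ℂ) (S : Finset (Fin d → ℤ))
    (x : UnitAddTorus (Fin d)) : ℂ :=
  ∑ n ∈ S, torusCoeff f n * UnitAddTorus.mFourier n x

theorem torusCoeff_mFourier [DecidableEq (Fin d → ℤ)] (m n : Fin d → ℤ) :
    torusCoeff (fun x => UnitAddTorus.mFourier m x) n = if m = n then 1 else 0 := by
  have h : MemLp (fun x => UnitAddTorus.mFourier m x) 2 (torusMeasure d) :=
    MemLp.of_bound (UnitAddTorus.mFourier m).continuous.aestronglyMeasurable 1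
      (.of_forall fun x => (norm_mFourier_apply m x).le)
  have h1 := mFourierBasis_repr_eq_torusCoeff (UnitAddTorus.mFourierBasis m) n
  have h2 : torusCoeff (UnitAddTorus.mFourierBasis m : L2Torus d) n =
      torusCoeff (fun x => UnitAddTorus.mFourier m x) n := by
    refine torusCoeff_congr_ae ?_ n
    rw [UnitAddTorus.coe_mFourierBasis]
    exact UnitAddTorus.coeFn_mFourierLp 2 m
  rw [← h2, ← h1]
  erw [HilbertBasis.repr_self]
  rw [lp.single_apply]
  by_cases hmn : m = n
  · subst hmn; simp
  · rw [if_neg hmn]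
    simp [Ne.symm hmn]

theorem continuous_fourierPartialSum (f : UnitAddTorus (Fin d) → ℂ) (S : Finset (Fin d → ℤ)) :
    Continuous (fourierPartialSum f S) :=
  continuous_finsetSum _ fun n _ => continuous_const.mul (UnitAddTorus.mFourier n).continuous

theorem norm_fourierPartialSum_le (f : UnitAddTorus (Fin d) → ℂ) (S : Finset (Fin d → ℤ))
    (x : UnitAddTorus (Fin d)) : ‖fourierPartialSum f S x‖ ≤ ∑ n ∈ S, ‖torusCoeff f n‖ := by
  refine (norm_sum_le _ _).trans_eq ?_
  simp only [norm_mul, norm_mFourier_apply, mul_one]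

theorem memLp_fourierPartialSum (f : UnitAddTorus (Fin d) → ℂ) (S : Finset (Fin d → ℤ)) :
    MemLp (fourierPartialSum f S) 2 (torusMeasure d) :=
  MemLp.of_bound (continuous_fourierPartialSum f S).aestronglyMeasurable _
    (.of_forall (norm_fourierPartialSum_le f S))

open Classical in
theorem torusCoeff_sub_fourierPartialSum {f : UnitAddTorus (Fin d) → ℂ}
    (hf : Integrable f (torusMeasure d)) (S : Finset (Fin d → ℤ)) (n : Fin d → ℤ) :
    torusCoeff (fun x => f x - fourierPartialSum f S x) n = if n ∈ S then 0 else torusCoeff f n := by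
  rw [torusCoeff_sub hf ((memLp_fourierPartialSum f S).integrable (by norm_num))]
  have h : torusCoeff (fourierPartialSum f S) n = ∑ m ∈ S, torusCoeff f m * if m = n then 1 else 0 := by
    unfold fourierPartialSum
    simp only [← torusCoeff_mFourier, ← torusCoeff_const_mul]
    unfold torusCoeff
    simp only [Finset.sum_mul]
    refine integral_finsetSum _ fun m _ => ?_
    refine Integrable.mul_mFourier ?_ _
    exact ((UnitAddTorus.mFourier m).continuous.integrable_of_hasCompactSupport
      (HasCompactSupport.of_compactSpace _)).const_mul _
  rw [h]
  simp only [mul_ite, mul_one, mul_zero, Finset.sum_ite_eq']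
  split_ifs <;> simp

open Classical in
/-- A function in a bounded subset of `H^s` has small `L²` mass where it is large. -/
theorem setLIntegral_sq_le_of_sobolev {s K : ℝ} (hs : 0 < s) (hK : 1 ≤ K)
    {f : UnitAddTorus (Fin d) → ℂ} (hf : MemLp f 2 (torusMeasure d)) (hfm : Measurable f)
    (hfK : ∀ S : Finset (Fin d → ℤ),
      ∑ n ∈ S, (1 + laplaceEigenvalue n) ^ s * ‖torusCoeff f n‖ ^ 2 ≤ K ^ 2) (j : ℕ) :
    ∫⁻ x in {x | 2 * K * (3 * 2 ^ j) ^ d < ‖f x‖}, ENNReal.ofReal (‖f x‖ ^ 2) ∂(torusMeasure d) ≤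
      ENNReal.ofReal (4 * K ^ 2 * ((1 / 4 : ℝ) ^ s) ^ j) := by
  have hL : ∀ n : Fin d → ℤ, 0 ≤ laplaceEigenvalue n := fun n => by
    unfold laplaceEigenvalue; positivity
  set S : Finset (Fin d → ℤ) := Fintype.piFinset fun _ => Finset.Icc (-(2 ^ j : ℤ)) (2 ^ j) with hS
  have hcard : (S.card : ℝ) ≤ (3 * 2 ^ j) ^ d := by
    rw [hS, Fintype.card_piFinset_const, Int.card_Icc]
    have h1 : ((2 : ℤ) ^ j + 1 - -(2 ^ j : ℤ)).toNat ≤ 3 * 2 ^ j := by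
      have : (1 : ℤ) ≤ 2 ^ j := one_le_pow₀ (by norm_num)
      have h2 : (((3 * 2 ^ j : ℕ)) : ℤ) = 3 * 2 ^ j := by push_cast; ring
      omega
    exact_mod_cast Nat.pow_le_pow_left h1 d
  have hcoeff : ∀ n, ‖torusCoeff f n‖ ≤ K := by
    intro n
    have h1 := hfK {n}
    rw [Finset.sum_singleton] at h1
    have h2 : 1 ≤ (1 + laplaceEigenvalue n) ^ s :=
      Real.one_le_rpow (by linarith [hL n]) hs.le
    have h3 : ‖torusCoeff f n‖ ^ 2 ≤ K ^ 2 := by nlinarith [sq_nonneg ‖torusCoeff f n‖]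
    exact (pow_le_pow_iff_left₀ (norm_nonneg _) (by linarith) two_ne_zero).1 h3
  have hp : ∀ x, ‖fourierPartialSum f S x‖ ≤ K * (3 * 2 ^ j) ^ d := by
    intro x
    refine (norm_fourierPartialSum_le f S x).trans ((Finset.sum_le_card_nsmul S _ K
      fun n _ => hcoeff n).trans ?_)
    rw [nsmul_eq_mul, mul_comm]
    exact mul_le_mul_of_nonneg_left hcard (by linarith)
  set r : UnitAddTorus (Fin d) → ℂ := fun x => f x - fourierPartialSum f S x with hr
  have hrm : MemLp r 2 (torusMeasure d) := hf.sub (memLp_fourierPartialSum f S)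
  have hr2 : ∫ x, ‖r x‖ ^ 2 ∂(torusMeasure d) ≤ K ^ 2 * ((1 / 4 : ℝ) ^ s) ^ j := by
    refine hasSum_le_of_sum_le (hasSum_norm_torusCoeff_sq hrm) fun A => ?_
    rw [mul_comm, ← div_le_iff₀' (by positivity), Finset.sum_div]
    refine le_trans (Finset.sum_le_sum fun n _ => ?_) (hfK A)
    rw [hr, torusCoeff_sub_fourierPartialSum (hf.integrable (by norm_num))]
    have hLs : 0 ≤ (1 + laplaceEigenvalue n) ^ s := Real.rpow_nonneg (by linarith [hL n]) s
    split_ifs with hn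
    · simp only [norm_zero, ne_eq, OfNat.ofNat_ne_zero, not_false_eq_true, zero_pow, zero_div]
      positivity
    · rw [div_le_iff₀ (by positivity)]
      have h1 : (4 : ℝ) ^ j ≤ 1 + laplaceEigenvalue n := by
        simp only [hS, Fintype.mem_piFinset, not_forall] at hn
        obtain ⟨i, hi⟩ := hn
        have h2 : (2 : ℤ) ^ j ≤ |n i| := by
          by_contra hlt
          rw [not_le, abs_lt] at hlt
          exact hi (Finset.mem_Icc.2 ⟨hlt.1.le, hlt.2.le⟩)
        have h3 : (2 : ℝ) ^ j ≤ |(n i : ℝ)| := by exact_mod_cast h2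
        have h4 : (4 : ℝ) ^ j ≤ (n i : ℝ) ^ 2 := by
          rw [← sq_abs]
          calc (4 : ℝ) ^ j = (2 ^ j) ^ 2 := by rw [← pow_mul, mul_comm, pow_mul]; norm_num
            _ ≤ _ := pow_le_pow_left₀ (by positivity) h3 2
        have h5 : (n i : ℝ) ^ 2 ≤ ∑ j, (n j : ℝ) ^ 2 :=
          Finset.single_le_sum (f := fun j => (n j : ℝ) ^ 2) (fun _ _ => sq_nonneg _)
            (Finset.mem_univ i)
        unfold laplaceEigenvalue
        have h6 : 1 ≤ (2 * Real.pi) ^ 2 := by nlinarith [Real.pi_gt_three]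
        nlinarith [sq_nonneg (n i : ℝ)]
      have h2 : 1 ≤ (1 + laplaceEigenvalue n) ^ s * ((1 / 4 : ℝ) ^ s) ^ j := by
        rw [← Real.rpow_natCast, ← Real.rpow_mul (by norm_num), mul_comm s, Real.rpow_mul (by norm_num),
          Real.rpow_natCast, ← Real.mul_rpow (by linarith [hL n]) (by positivity)]
        refine Real.one_le_rpow ?_ hs.le
        rw [one_div, inv_pow, ← div_eq_mul_inv, one_le_div (by positivity)]
        exact h1
      nlinarith [sq_nonneg ‖torusCoeff f n‖]
  have hpt : ∀ x ∈ {x | 2 * K * (3 * 2 ^ j) ^ d < ‖f x‖}, ‖f x‖ ^ 2 ≤ 4 * ‖r x‖ ^ 2 := by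
    intro x hx
    have h1 : ‖f x‖ ≤ ‖r x‖ + ‖fourierPartialSum f S x‖ := by
      have := norm_add_le (r x) (fourierPartialSum f S x)
      rwa [hr, sub_add_cancel] at this
    have h2 := hp x
    have h3 : 2 * K * (3 * 2 ^ j) ^ d < ‖f x‖ := hx
    have h4 : ‖f x‖ ≤ 2 * ‖r x‖ := by linarith
    nlinarith [norm_nonneg (f x), norm_nonneg (r x)]
  have hms : MeasurableSet {x | 2 * K * (3 * 2 ^ j) ^ d < ‖f x‖} :=
    measurableSet_lt measurable_const hfm.norm
  calc ∫⁻ x in {x | 2 * K * (3 * 2 ^ j) ^ d < ‖f x‖}, ENNReal.ofReal (‖f x‖ ^ 2) ∂(torusMeasure d)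
      ≤ ∫⁻ x in {x | 2 * K * (3 * 2 ^ j) ^ d < ‖f x‖}, ENNReal.ofReal (4 * ‖r x‖ ^ 2)
        ∂(torusMeasure d) :=
        setLIntegral_mono' hms fun x hx => ENNReal.ofReal_le_ofReal (hpt x hx)
    _ ≤ ∫⁻ x, ENNReal.ofReal (4 * ‖r x‖ ^ 2) ∂(torusMeasure d) := setLIntegral_le_lintegral _ _
    _ = ENNReal.ofReal (∫ x, 4 * ‖r x‖ ^ 2 ∂(torusMeasure d)) :=
        (ofReal_integral_eq_lintegral_ofReal ((hrm.integrable_norm_pow (by norm_num)).const_mul 4)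
          (.of_forall fun x => by positivity)).symm
    _ ≤ _ := by
        refine ENNReal.ofReal_le_ofReal ?_
        rw [integral_const_mul, mul_assoc]
        exact mul_le_mul_of_nonneg_left hr2 (by norm_num)

/-- Layer decomposition of `(r log r)²` along thresholds growing geometrically. -/
theorem mul_log_sq_le_layers {α β : ℝ} (hα : 0 ≤ α) (hβ : 0 < β) {H : ℕ → ℝ}
    (hH : ∀ j, 0 < H j) (hHlog : ∀ j, Real.log (H j) = α + β * j) {r : ℝ} (hr : 0 ≤ r) :
    ENNReal.ofReal ((r * |Real.log r|) ^ 2) ≤ 1 + ENNReal.ofReal (α ^ 2) * ENNReal.ofReal (r ^ 2) +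
      ∑' j : ℕ, ENNReal.ofReal ((α + β * (j + 1)) ^ 2) *
        (Set.Ioi (H j)).indicator (fun r => ENNReal.ofReal (r ^ 2)) r := by
  rcases le_or_gt r 1 with h1 | h1
  · have : (r * |Real.log r|) ^ 2 ≤ 1 := by
      rcases hr.eq_or_lt with rfl | hr0
      · simp
      have h2 := Real.abs_log_mul_self_lt r hr0 h1
      rw [abs_mul, abs_of_pos hr0, mul_comm] at h2
      exact pow_le_one₀ (by positivity) h2.le
    refine le_trans ?_ (le_trans le_self_add le_self_add)
    exact (ENNReal.ofReal_le_ofReal this).trans (by simp)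
  have hr0 : 0 < r := by linarith
  have hlog : 0 ≤ Real.log r := Real.log_nonneg h1.le
  rw [abs_of_nonneg hlog]
  have hbd : ∀ {c : ℝ}, Real.log r ≤ c → ENNReal.ofReal ((r * Real.log r) ^ 2) ≤
      ENNReal.ofReal (c ^ 2) * ENNReal.ofReal (r ^ 2) := by
    intro c hc
    rw [← ENNReal.ofReal_mul (sq_nonneg _), ← mul_pow]
    refine ENNReal.ofReal_le_ofReal (pow_le_pow_left₀ (by positivity) ?_ 2)
    rw [mul_comm]
    exact mul_le_mul_of_nonneg_right hc hr
  rcases le_or_gt r (H 0) with h0 | h0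
  · refine le_trans (hbd ?_) (le_trans le_add_self le_self_add)
    have := Real.log_le_log hr0 h0
    rw [hHlog] at this
    simpa using this
  · have hex : ∃ j, r ≤ H j := by
      obtain ⟨j, hj⟩ := exists_nat_ge (Real.log r / β)
      refine ⟨j, (Real.log_le_log_iff hr0 (hH j)).1 ?_⟩
      rw [hHlog]
      rw [div_le_iff₀ hβ] at hj
      linarith
    have hj0 : Nat.find hex ≠ 0 := fun h => by
      have := Nat.find_spec hex
      rw [h] at this
      linarith
    obtain ⟨j, hj⟩ := Nat.exists_eq_succ_of_ne_zero hj0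
    have hj1 : H j < r := not_le.1 (Nat.find_min hex (by omega))
    have hj2 : r ≤ H (j + 1) := by
      have := Nat.find_spec hex
      rwa [hj] at this
    refine le_trans ?_ (le_trans (ENNReal.le_tsum j) le_add_self)
    rw [Set.indicator_of_mem (by exact hj1)]
    refine hbd ?_
    have := Real.log_le_log hr0 hj2
    rw [hHlog] at this
    push_cast at this
    exact this

/-- On bounded subsets of `H^s`, `s > 0`, the nonlinearity is bounded in `L²`. -/
theorem exists_integral_logNonlinearity_sq_le {s K : ℝ} (hs : 0 < s) (hK : 1 ≤ K) (lam : ℝ)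
    (hd : 1 ≤ d) :
    ∃ C : ℝ, ∀ f : UnitAddTorus (Fin d) → ℂ, MemLp f 2 (torusMeasure d) → Measurable f →
      (∀ S : Finset (Fin d → ℤ),
        ∑ n ∈ S, (1 + laplaceEigenvalue n) ^ s * ‖torusCoeff f n‖ ^ 2 ≤ K ^ 2) →
      Integrable (fun x => ‖logNonlinearity lam (f x)‖ ^ 2) (torusMeasure d) ∧
      ∫ x, ‖logNonlinearity lam (f x)‖ ^ 2 ∂(torusMeasure d) ≤ C := by
  set α : ℝ := Real.log (2 * K) + d * Real.log 3 with hα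
  set β : ℝ := d * Real.log 2 with hβ
  have hα0 : 0 ≤ α := add_nonneg (Real.log_nonneg (by linarith))
    (mul_nonneg (Nat.cast_nonneg _) (Real.log_nonneg (by norm_num)))
  have hβ0 : 0 < β := mul_pos (by exact_mod_cast hd) (Real.log_pos (by norm_num))
  set H : ℕ → ℝ := fun j => 2 * K * (3 * 2 ^ j) ^ d with hH
  have hH0 : ∀ j, 0 < H j := fun j => by positivity
  have hHlog : ∀ j, Real.log (H j) = α + β * j := by
    intro j
    simp only [hH, hα, hβ]
    rw [Real.log_mul (x := 2 * K) (by positivity) (by positivity), Real.log_pow,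
      Real.log_mul (x := 3) (by norm_num) (by positivity), Real.log_pow]
    ring
  set ρ : ℝ := (1 / 4 : ℝ) ^ s with hρ
  have hρ0 : 0 < ρ := by positivity
  have hρ1 : ρ < 1 := Real.rpow_lt_one (by norm_num) (by norm_num) hs
  have hsum : Summable fun j : ℕ => (α + β * (j + 1)) ^ 2 * (4 * K ^ 2 * ρ ^ j) := by
    have hn : ‖ρ‖ < 1 := by rwa [Real.norm_of_nonneg hρ0.le]
    have h0 := (summable_pow_mul_geometric_of_norm_lt_one 0 hn).mul_left (4 * K ^ 2 * (α + β) ^ 2)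
    have h1 := (summable_pow_mul_geometric_of_norm_lt_one 1 hn).mul_left
      (4 * K ^ 2 * (2 * (α + β) * β))
    have h2 := (summable_pow_mul_geometric_of_norm_lt_one 2 hn).mul_left (4 * K ^ 2 * β ^ 2)
    refine ((h0.add h1).add h2).congr fun j => ?_
    ring
  set Z : ℝ := ∑' j : ℕ, (α + β * (j + 1)) ^ 2 * (4 * K ^ 2 * ρ ^ j) with hZ
  have hZ0 : 0 ≤ Z := tsum_nonneg fun j => by positivity
  refine ⟨(2 * |lam|) ^ 2 * (1 + α ^ 2 * K ^ 2 + Z), fun f hf hfm hfK => ?_⟩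
  have hf2 : ∫ x, ‖f x‖ ^ 2 ∂(torusMeasure d) ≤ K ^ 2 := by
    refine hasSum_le_of_sum_le (hasSum_norm_torusCoeff_sq hf) fun A => ?_
    refine le_trans (Finset.sum_le_sum fun n _ => ?_) (hfK A)
    have hL : 0 ≤ laplaceEigenvalue n := by unfold laplaceEigenvalue; positivity
    have h2 : 1 ≤ (1 + laplaceEigenvalue n) ^ s := Real.one_le_rpow (by linarith) hs.le
    nlinarith [sq_nonneg ‖torusCoeff f n‖]
  have hm2 : Measurable fun x => ENNReal.ofReal (‖f x‖ ^ 2) := (hfm.norm.pow_const 2).ennreal_ofReal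
  have hmain : ∫⁻ x, ENNReal.ofReal ((‖f x‖ * |Real.log ‖f x‖|) ^ 2) ∂(torusMeasure d) ≤
      ENNReal.ofReal (1 + α ^ 2 * K ^ 2 + Z) := by
    have hind : ∀ j x, (Set.Ioi (H j)).indicator (fun r => ENNReal.ofReal (r ^ 2)) ‖f x‖ =
        {x | H j < ‖f x‖}.indicator (fun x => ENNReal.ofReal (‖f x‖ ^ 2)) x := by
      intro j x
      simp only [Set.indicator_apply, Set.mem_ofPred_eq, Set.mem_Ioi]
    have hms : ∀ j, MeasurableSet {x | H j < ‖f x‖} := fun j =>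
      measurableSet_lt measurable_const hfm.norm
    calc ∫⁻ x, ENNReal.ofReal ((‖f x‖ * |Real.log ‖f x‖|) ^ 2) ∂(torusMeasure d)
        ≤ ∫⁻ x, (1 + ENNReal.ofReal (α ^ 2) * ENNReal.ofReal (‖f x‖ ^ 2) +
          ∑' j : ℕ, ENNReal.ofReal ((α + β * (j + 1)) ^ 2) *
          {x | H j < ‖f x‖}.indicator (fun x => ENNReal.ofReal (‖f x‖ ^ 2)) x) ∂(torusMeasure d) := by
          refine lintegral_mono fun x => ?_
          simp only [← hind]
          exact mul_log_sq_le_layers hα0 hβ0 hH0 hHlog (norm_nonneg _)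
      _ = 1 + ENNReal.ofReal (α ^ 2) * (∫⁻ x, ENNReal.ofReal (‖f x‖ ^ 2) ∂(torusMeasure d)) +
          ∑' j : ℕ, ENNReal.ofReal ((α + β * (j + 1)) ^ 2) *
          ∫⁻ x in {x | H j < ‖f x‖}, ENNReal.ofReal (‖f x‖ ^ 2) ∂(torusMeasure d) := by
          rw [lintegral_add_left (by fun_prop),
            lintegral_add_left measurable_const, lintegral_const_mul _ hm2,
            lintegral_tsum fun j => ((hm2.indicator (hms j)).const_mul _).aemeasurable]
          simp only [lintegral_const, measure_univ, mul_one]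
          congr 2
          funext j
          rw [lintegral_const_mul _ (hm2.indicator (hms j)), lintegral_indicator (hms j)]
      _ ≤ 1 + ENNReal.ofReal (α ^ 2) * ENNReal.ofReal (K ^ 2) +
          ∑' j : ℕ, ENNReal.ofReal ((α + β * (j + 1)) ^ 2) *
          ENNReal.ofReal (4 * K ^ 2 * ρ ^ j) := by
          gcongr with j
          · rw [← ofReal_integral_eq_lintegral_ofReal (hf.integrable_norm_pow (by norm_num))
              (.of_forall fun x => sq_nonneg _)]
            exact ENNReal.ofReal_le_ofReal hf2
          · exact setLIntegral_sq_le_of_sobolev hs hK hf hfm hfK j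
      _ = ENNReal.ofReal (1 + α ^ 2 * K ^ 2 + Z) := by
          rw [ENNReal.ofReal_add (by positivity) hZ0, ENNReal.ofReal_add (by norm_num) (by positivity),
            ENNReal.ofReal_mul (sq_nonneg _), ENNReal.ofReal_one, hZ,
            ENNReal.ofReal_tsum_of_nonneg (fun j => by positivity) hsum]
          congr 2
          funext j
          rw [ENNReal.ofReal_mul (sq_nonneg _)]
  have hmeas : Measurable fun x => (‖f x‖ * |Real.log ‖f x‖|) ^ 2 :=
    ((hfm.norm.mul (Real.measurable_log.comp hfm.norm).abs).pow_const 2)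
  have hint : Integrable (fun x => (‖f x‖ * |Real.log ‖f x‖|) ^ 2) (torusMeasure d) := by
    refine ⟨hmeas.aestronglyMeasurable, ?_⟩
    rw [hasFiniteIntegral_iff_ofReal (.of_forall fun x => sq_nonneg _)]
    exact hmain.trans_lt ENNReal.ofReal_lt_top
  have hle : ∫ x, (‖f x‖ * |Real.log ‖f x‖|) ^ 2 ∂(torusMeasure d) ≤ 1 + α ^ 2 * K ^ 2 + Z := by
    rw [integral_eq_lintegral_of_nonneg_ae (.of_forall fun x => sq_nonneg _)
      hmeas.aestronglyMeasurable]
    exact ENNReal.toReal_le_of_le_ofReal (by positivity) hmain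
  simp only [norm_logNonlinearity, mul_pow _ (_ * _)]
  refine ⟨hint.const_mul _, ?_⟩
  rw [integral_const_mul]
  exact mul_le_mul_of_nonneg_left hle (sq_nonneg _)

end sobolev

section sums

theorem exists_sum_one_add_abs_rpow_le {c : ℝ} (hc : 0 < c) :
    ∃ C : ℝ, ∀ (a : ℝ) (A : Finset ℤ), ∑ k ∈ A, (1 + |c * k + a|) ^ (-(4 / 3) : ℝ) ≤ C := by
  have hs : Summable fun k : ℤ => (1 + |(k : ℝ)|) ^ (-(4 / 3) : ℝ) := by
    refine Summable.of_nonneg_of_le (fun k => by positivity) (fun k => ?_)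
      ((Real.summable_one_div_int_add_rpow (1 / 2) (4 / 3)).2 (by norm_num))
    have h0 : (0 : ℝ) < |(k : ℝ) + 1 / 2| := by
      rw [abs_pos]
      intro h
      have h2 : ((2 * k + 1 : ℤ) : ℝ) = 0 := by push_cast; linarith
      have h3 : (2 * k + 1 : ℤ) = 0 := by exact_mod_cast h2
      omega
    rw [one_div, ← Real.rpow_neg h0.le]
    refine Real.rpow_le_rpow_of_nonpos h0 ?_ (by norm_num)
    refine (abs_add_le _ _).trans ?_
    rw [abs_of_pos (show (0 : ℝ) < 1 / 2 by norm_num)]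
    linarith
  set c₀ : ℝ := min 1 c / 2 with hc₀
  have hc₀0 : 0 < c₀ := by positivity
  refine ⟨c₀ ^ (-(4 / 3) : ℝ) * ∑' k : ℤ, (1 + |(k : ℝ)|) ^ (-(4 / 3) : ℝ), fun a A => ?_⟩
  set m : ℤ := ⌊a / c⌋ with hm
  have hpt : ∀ k : ℤ, (1 + |c * k + a|) ^ (-(4 / 3) : ℝ) ≤
      c₀ ^ (-(4 / 3) : ℝ) * (1 + |((k + m : ℤ) : ℝ)|) ^ (-(4 / 3) : ℝ) := by
    intro k
    rw [← Real.mul_rpow hc₀0.le (by positivity)]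
    refine Real.rpow_le_rpow_of_nonpos (by positivity) ?_ (by norm_num)
    have h1 : (m : ℝ) ≤ a / c := Int.floor_le _
    have h2 : a / c < m + 1 := Int.lt_floor_add_one _
    have h3 : c * k + a = c * (((k + m : ℤ) : ℝ) + (a / c - m)) := by
      push_cast
      field_simp
      ring
    rw [h3, abs_mul, abs_of_pos hc]
    set q : ℝ := ((k + m : ℤ) : ℝ)
    have h4 : |q| - 1 ≤ |q + (a / c - m)| := by
      have := abs_sub_abs_le_abs_sub q (-(a / c - m))
      rw [abs_neg, sub_neg_eq_add, abs_of_nonneg (by linarith : 0 ≤ a / c - m)] at this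
      linarith
    have h5 : min 1 c ≤ c := min_le_right _ _
    have h6 : min 1 c ≤ 1 := min_le_left _ _
    have h7 : min 1 c * |q + (a / c - m)| ≤ c * |q + (a / c - m)| :=
      mul_le_mul_of_nonneg_right h5 (abs_nonneg _)
    have h8 : min 1 c * (|q| - 1) ≤ min 1 c * |q + (a / c - m)| :=
      mul_le_mul_of_nonneg_left h4 (by positivity)
    have h9 : 0 ≤ min 1 c * |q + (a / c - m)| := by positivity
    rw [hc₀]
    linarith
  refine (Finset.sum_le_sum fun k _ => hpt k).trans ?_
  rw [← Finset.mul_sum]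
  refine mul_le_mul_of_nonneg_left ?_ (by positivity)
  have h1 : ∑ k ∈ A, (1 + |((k + m : ℤ) : ℝ)|) ^ (-(4 / 3) : ℝ) =
      ∑ k ∈ A.map (addRightEmbedding m), (1 + |(k : ℝ)|) ^ (-(4 / 3) : ℝ) := by
    rw [Finset.sum_map]
    rfl
  rw [h1]
  exact hs.sum_le_tsum _ fun k _ => by positivity

theorem exists_abs_sq_add_ge (κ : ℝ) :
    ∃ ρ : ℝ, ∀ x : ℝ, (min |x - ρ| |x + ρ|) ^ 2 ≤ |x ^ 2 + κ| := by
  rcases le_total 0 κ with h | h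
  · refine ⟨0, fun x => ?_⟩
    rw [sub_zero, add_zero, min_self, sq_abs, abs_of_nonneg (by positivity)]
    linarith
  · refine ⟨Real.sqrt (-κ), fun x => ?_⟩
    have h1 : x ^ 2 + κ = (x - Real.sqrt (-κ)) * (x + Real.sqrt (-κ)) := by
      have := Real.sq_sqrt (show 0 ≤ -κ by linarith)
      linarith [this, sq (Real.sqrt (-κ))]
    rw [h1, abs_mul, sq]
    exact mul_le_mul (min_le_left _ _) (min_le_right _ _) (by positivity) (abs_nonneg _)

theorem exists_sum_one_add_abs_quadratic_rpow_le {β : ℝ} (hβ : 0 < β) :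
    ∃ C : ℝ, ∀ (a κ : ℝ) (A : Finset ℤ),
      ∑ n ∈ A, (1 + |2 * β * ((n : ℝ) + a) ^ 2 + κ|) ^ (-(2 / 3) : ℝ) ≤ C := by
  obtain ⟨C, hC⟩ := exists_sum_one_add_abs_rpow_le one_pos
  set c : ℝ := min 1 (2 * β) / 2 with hc
  have hc0 : 0 < c := by positivity
  refine ⟨c ^ (-(2 / 3) : ℝ) * (C + C), fun a κ A => ?_⟩
  obtain ⟨ρ, hρ⟩ := exists_abs_sq_add_ge (κ / (2 * β))
  have hpt : ∀ n : ℤ, (1 + |2 * β * ((n : ℝ) + a) ^ 2 + κ|) ^ (-(2 / 3) : ℝ) ≤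
      c ^ (-(2 / 3) : ℝ) * ((1 + |1 * (n : ℝ) + (a - ρ)|) ^ (-(4 / 3) : ℝ) +
        (1 + |1 * (n : ℝ) + (a + ρ)|) ^ (-(4 / 3) : ℝ)) := by
    intro n
    have e1 : 1 * (n : ℝ) + (a - ρ) = n + a - ρ := by ring
    have e2 : 1 * (n : ℝ) + (a + ρ) = n + a + ρ := by ring
    rw [e1, e2]
    set x : ℝ := n + a
    set m : ℝ := min |x - ρ| |x + ρ| with hm
    have hm0 : 0 ≤ m := by positivity
    have h1 : 2 * β * x ^ 2 + κ = 2 * β * (x ^ 2 + κ / (2 * β)) := by field_simp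
    have h2 : c * (1 + m) ^ 2 ≤ 1 + |2 * β * x ^ 2 + κ| := by
      rw [h1, abs_mul, abs_of_pos (by positivity)]
      have h3 := mul_le_mul_of_nonneg_left (hρ x) (show 0 ≤ min 1 (2 * β) by positivity)
      have h4 : min 1 (2 * β) * |x ^ 2 + κ / (2 * β)| ≤ 2 * β * |x ^ 2 + κ / (2 * β)| :=
        mul_le_mul_of_nonneg_right (min_le_right _ _) (abs_nonneg _)
      have h5 : min 1 (2 * β) ≤ 1 := min_le_left _ _
      have h6 : c * (1 + m) ^ 2 ≤ min 1 (2 * β) * (1 + m ^ 2) := by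
        rw [hc]
        have h7 : 0 < min 1 (2 * β) := by positivity
        nlinarith [mul_nonneg h7.le (sq_nonneg (1 - m))]
      nlinarith
    refine (Real.rpow_le_rpow_of_nonpos (by positivity) h2 (by norm_num)).trans ?_
    rw [Real.mul_rpow hc0.le (by positivity)]
    refine mul_le_mul_of_nonneg_left ?_ (by positivity)
    rw [← Real.rpow_natCast, ← Real.rpow_mul (by positivity)]
    norm_num only [Nat.cast_ofNat]
    rcases min_choice |x - ρ| |x + ρ| with h | h
    · rw [hm, h]
      exact le_add_of_nonneg_right (by positivity)
    · rw [hm, h]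
      exact le_add_of_nonneg_left (by positivity)
  refine (Finset.sum_le_sum fun n _ => hpt n).trans ?_
  rw [← Finset.mul_sum, Finset.sum_add_distrib]
  exact mul_le_mul_of_nonneg_left (add_le_add (hC _ A) (hC _ A)) (by positivity)

theorem inv_mul_le_rpow {p q y : ℝ} (hp : 1 ≤ p) (hq : 1 ≤ q) (hy : 0 ≤ y) (h : 1 + y ≤ p + q) :
    (p * q)⁻¹ ≤ 2 * (1 + y) ^ (-(2 / 3) : ℝ) * (p ^ (-(4 / 3) : ℝ) + q ^ (-(4 / 3) : ℝ)) := by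
  wlog hpq : p ≤ q generalizing p q
  · have := this hq hp (by linarith) (le_of_not_ge hpq)
    rwa [mul_comm q p, add_comm (q ^ _)] at this
  have hp0 : 0 < p := by linarith
  have hq0 : 0 < q := by linarith
  have h1 : (p * q)⁻¹ ≤ p ^ (-(4 / 3) : ℝ) * q ^ (-(2 / 3) : ℝ) := by
    have e1 : (p * q)⁻¹ = p ^ (-(4 / 3) : ℝ) * q ^ (-(2 / 3) : ℝ) *
        (p ^ (1 / 3 : ℝ) * q ^ (-(1 / 3) : ℝ)) := by
      calc (p * q)⁻¹ = p ^ (-1 : ℝ) * q ^ (-1 : ℝ) := by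
            rw [Real.rpow_neg_one, Real.rpow_neg_one, mul_inv]
        _ = (p ^ (-(4 / 3) : ℝ) * p ^ (1 / 3 : ℝ)) * (q ^ (-(2 / 3) : ℝ) * q ^ (-(1 / 3) : ℝ)) := by
            rw [← Real.rpow_add hp0, ← Real.rpow_add hq0]
            norm_num
        _ = _ := by ring
    rw [e1]
    refine mul_le_of_le_one_right (by positivity) ?_
    rw [Real.rpow_neg hq0.le, ← div_eq_mul_inv, div_le_one (by positivity)]
    exact Real.rpow_le_rpow hp0.le hpq (by norm_num)
  have h2 : q ^ (-(2 / 3) : ℝ) ≤ 2 * (1 + y) ^ (-(2 / 3) : ℝ) := by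
    have h3 : (1 + y) / 2 ≤ q := by linarith
    refine (Real.rpow_le_rpow_of_nonpos (by positivity) h3 (by norm_num)).trans ?_
    rw [Real.div_rpow (by positivity) (by norm_num), div_eq_mul_inv, mul_comm,
      ← Real.rpow_neg (by norm_num), neg_neg]
    refine mul_le_mul_of_nonneg_right ?_ (by positivity)
    have := Real.rpow_le_rpow_of_exponent_le (x := 2) (by norm_num) (show (2 / 3 : ℝ) ≤ 1 by norm_num)
    rwa [Real.rpow_one] at this
  calc (p * q)⁻¹ ≤ p ^ (-(4 / 3) : ℝ) * q ^ (-(2 / 3) : ℝ) := h1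
    _ ≤ p ^ (-(4 / 3) : ℝ) * (2 * (1 + y) ^ (-(2 / 3) : ℝ)) := by gcongr
    _ = 2 * (1 + y) ^ (-(2 / 3) : ℝ) * p ^ (-(4 / 3) : ℝ) := by ring
    _ ≤ _ := by
        refine mul_le_mul_of_nonneg_left ?_ (by positivity)
        exact le_add_of_nonneg_right (by positivity)

/-- The counting estimate behind the periodic `L⁴` Strichartz inequality. -/
theorem exists_sum_parabola_le {α β : ℝ} (hα : 0 < α) (hβ : 0 < β) :
    ∃ C : ℝ, ∀ (K N : ℤ) (S : Finset (ℤ × ℤ)), ∑ γ ∈ S, ((1 + |α * γ.1 + β * (γ.2 : ℝ) ^ 2|) *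
      (1 + |α * ((K - γ.1 : ℤ) : ℝ) + β * ((N - γ.2 : ℤ) : ℝ) ^ 2|))⁻¹ ≤ C := by
  obtain ⟨C₁, hC₁⟩ := exists_sum_one_add_abs_rpow_le hα
  obtain ⟨C₂, hC₂⟩ := exists_sum_one_add_abs_quadratic_rpow_le hβ
  have hC₁0 : 0 ≤ C₁ := by simpa using hC₁ 0 ∅
  refine ⟨2 * (C₁ + C₁) * C₂, fun K N S => ?_⟩
  set Y : ℤ → ℝ := fun n => 2 * β * ((n : ℝ) + (-(N : ℝ) / 2)) ^ 2 + (α * K + β * (N : ℝ) ^ 2 / 2)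
    with hY
  have hpt : ∀ γ : ℤ × ℤ, ((1 + |α * γ.1 + β * (γ.2 : ℝ) ^ 2|) *
      (1 + |α * ((K - γ.1 : ℤ) : ℝ) + β * ((N - γ.2 : ℤ) : ℝ) ^ 2|))⁻¹ ≤
      2 * (1 + |Y γ.2|) ^ (-(2 / 3) : ℝ) *
        ((1 + |α * γ.1 + β * (γ.2 : ℝ) ^ 2|) ^ (-(4 / 3) : ℝ) +
         (1 + |α * γ.1 + (β * (γ.2 : ℝ) ^ 2 - Y γ.2)|) ^ (-(4 / 3) : ℝ)) := by
    rintro ⟨k, n⟩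
    have e : α * ((K - k : ℤ) : ℝ) + β * ((N - n : ℤ) : ℝ) ^ 2 =
        -(α * k + (β * (n : ℝ) ^ 2 - Y n)) := by
      rw [hY]
      push_cast
      ring
    simp only [e, abs_neg]
    refine inv_mul_le_rpow (by linarith [abs_nonneg (α * (k : ℝ) + β * (n : ℝ) ^ 2)])
      (by linarith [abs_nonneg (α * (k : ℝ) + (β * (n : ℝ) ^ 2 - Y n))]) (abs_nonneg _) ?_
    have h1 := abs_sub (α * (k : ℝ) + β * (n : ℝ) ^ 2) (α * (k : ℝ) + (β * (n : ℝ) ^ 2 - Y n))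
    have h2 : (α * (k : ℝ) + β * (n : ℝ) ^ 2) - (α * (k : ℝ) + (β * (n : ℝ) ^ 2 - Y n)) = Y n := by
      ring
    rw [h2] at h1
    linarith
  have hsub : S ⊆ S.image Prod.fst ×ˢ S.image Prod.snd := fun γ hγ =>
    Finset.mem_product.2 ⟨Finset.mem_image_of_mem _ hγ, Finset.mem_image_of_mem _ hγ⟩
  refine (Finset.sum_le_sum fun γ _ => hpt γ).trans
    ((Finset.sum_le_sum_of_subset_of_nonneg hsub fun γ _ _ => by positivity).trans ?_)
  rw [Finset.sum_product_right]
  have hin : ∀ n : ℤ, ∑ k ∈ S.image Prod.fst, 2 * (1 + |Y n|) ^ (-(2 / 3) : ℝ) *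
        ((1 + |α * k + β * (n : ℝ) ^ 2|) ^ (-(4 / 3) : ℝ) +
         (1 + |α * k + (β * (n : ℝ) ^ 2 - Y n)|) ^ (-(4 / 3) : ℝ)) ≤
         2 * (C₁ + C₁) * (1 + |Y n|) ^ (-(2 / 3) : ℝ) := by
    intro n
    rw [← Finset.mul_sum, Finset.sum_add_distrib]
    have := add_le_add (hC₁ (β * (n : ℝ) ^ 2) (S.image Prod.fst))
      (hC₁ (β * (n : ℝ) ^ 2 - Y n) (S.image Prod.fst))
    calc _ ≤ 2 * (1 + |Y n|) ^ (-(2 / 3) : ℝ) * (C₁ + C₁) :=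
          mul_le_mul_of_nonneg_left this (by positivity)
      _ = _ := by ring
  refine (Finset.sum_le_sum fun n _ => hin n).trans ?_
  rw [← Finset.mul_sum]
  exact mul_le_mul_of_nonneg_left (hC₂ _ _ _) (by positivity)

end sums

section bilinear

variable {Γ Ω : Type*} [AddCommGroup Γ] [DecidableEq Γ] [MeasurableSpace Ω] {ν : Measure Ω}
  {E : Γ → Ω → ℂ} {w : Γ → ℝ} {L C : ℝ}

/-- An orthogonal system of unimodular characters. -/
structure IsCharacterSystem (ν : Measure Ω) (L : ℝ) (E : Γ → Ω → ℂ) : Prop where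
  measurable : ∀ γ, Measurable (E γ)
  norm_eq_one : ∀ γ z, ‖E γ z‖ = 1
  map_add : ∀ γ δ z, E (γ + δ) z = E γ z * E δ z
  orthogonal : ∀ γ δ, ∫ z, E γ z * conj (E δ z) ∂ν = if γ = δ then (L : ℂ) else 0

theorem IsCharacterSystem.norm_sum_le (hE : IsCharacterSystem ν L E) (c : Γ → ℂ) (S : Finset Γ)
    (z : Ω) : ‖∑ γ ∈ S, c γ * E γ z‖ ≤ ∑ γ ∈ S, ‖c γ‖ := by
  refine (_root_.norm_sum_le _ _).trans_eq ?_
  simp only [norm_mul, hE.norm_eq_one, mul_one]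

theorem IsCharacterSystem.measurable_sum (hE : IsCharacterSystem ν L E) (c : Γ → ℂ) (S : Finset Γ) :
    Measurable fun z => ∑ γ ∈ S, c γ * E γ z :=
  Finset.measurable_sum _ fun γ _ => (hE.measurable γ).const_mul _

theorem IsCharacterSystem.integral_norm_sum_sq [IsFiniteMeasure ν] (hE : IsCharacterSystem ν L E) (c : Γ → ℂ)
    (S : Finset Γ) : ∫ z, ‖∑ γ ∈ S, c γ * E γ z‖ ^ 2 ∂ν = L * ∑ γ ∈ S, ‖c γ‖ ^ 2 := by
  have hi : ∀ γ δ, Integrable (fun z => E γ z * conj (E δ z)) ν := fun γ δ =>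
    Integrable.of_bound ((hE.measurable γ).mul
      (Complex.continuous_conj.measurable.comp (hE.measurable δ))).aestronglyMeasurable 1
      (.of_forall fun z => by
        simp only [norm_mul, RCLike.norm_conj, hE.norm_eq_one, mul_one, le_refl])
  have h : ((∫ z, ‖∑ γ ∈ S, c γ * E γ z‖ ^ 2 ∂ν : ℝ) : ℂ) =
      ((L * ∑ γ ∈ S, ‖c γ‖ ^ 2 : ℝ) : ℂ) := by
    rw [← integral_complex_ofReal]
    have e : ∀ z, ((‖∑ γ ∈ S, c γ * E γ z‖ ^ 2 : ℝ) : ℂ) =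
        ∑ γ ∈ S, ∑ δ ∈ S, (c γ * conj (c δ)) * (E γ z * conj (E δ z)) := by
      intro z
      rw [Complex.ofReal_pow, ← Complex.mul_conj', map_sum, Finset.sum_mul_sum]
      refine Finset.sum_congr rfl fun γ _ => Finset.sum_congr rfl fun δ _ => ?_
      rw [map_mul]
      ring
    simp only [e]
    rw [integral_finsetSum _ fun γ _ => integrable_finsetSum _ fun δ _ => (hi γ δ).const_mul _]
    have e2 : ∀ γ ∈ S, ∫ z, ∑ δ ∈ S, (c γ * conj (c δ)) * (E γ z * conj (E δ z)) ∂ν =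
        L * (‖c γ‖ : ℂ) ^ 2 := by
      intro γ hγ
      rw [integral_finsetSum _ fun δ _ => (hi γ δ).const_mul _]
      simp only [integral_const_mul, hE.orthogonal, mul_ite, mul_zero]
      rw [Finset.sum_ite_eq, if_pos hγ, Complex.mul_conj', mul_comm]
    rw [Finset.sum_congr rfl e2, ← Finset.mul_sum]
    push_cast
    rfl
  exact_mod_cast h

/-- The `L⁴` estimate for trigonometric polynomials, from a bound for the convolution of the
inverse weight with itself. -/
theorem IsCharacterSystem.integral_norm_sum_pow_four_le [IsFiniteMeasure ν]
    (hE : IsCharacterSystem ν L E) (hL : 0 ≤ L)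
    (hw : ∀ γ, 0 < w γ) (hC : ∀ η (S : Finset Γ), ∑ γ ∈ S, (w γ * w (η - γ))⁻¹ ≤ C)
    (c : Γ → ℂ) (S : Finset Γ) :
    ∫ z, ‖∑ γ ∈ S, c γ * E γ z‖ ^ 4 ∂ν ≤ L * C * (∑ γ ∈ S, w γ * ‖c γ‖ ^ 2) ^ 2 := by
  set Q : Finset Γ := (S ×ˢ S).image fun p => p.1 + p.2 with hQ
  set fib : Γ → Finset (Γ × Γ) := fun η => (S ×ˢ S).filter fun p => p.1 + p.2 = η with hfib
  set D : Γ → ℂ := fun η => ∑ p ∈ fib η, c p.1 * c p.2 with hD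
  have hmaps : ∀ p ∈ S ×ˢ S, p.1 + p.2 ∈ Q := fun p hp => Finset.mem_image_of_mem _ hp
  have hsq : ∀ z, ‖∑ γ ∈ S, c γ * E γ z‖ ^ 4 = ‖∑ η ∈ Q, D η * E η z‖ ^ 2 := by
    intro z
    have e : (∑ γ ∈ S, c γ * E γ z) * (∑ γ ∈ S, c γ * E γ z) = ∑ η ∈ Q, D η * E η z := by
      rw [Finset.sum_mul_sum, ← Finset.sum_product', ← Finset.sum_fiberwise_of_maps_to hmaps]
      refine Finset.sum_congr rfl fun η _ => ?_
      rw [hD, Finset.sum_mul]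
      refine Finset.sum_congr rfl fun p hp => ?_
      rw [← (Finset.mem_filter.1 hp).2, hE.map_add]
      ring
    rw [← e, norm_mul, ← sq, ← pow_mul]
  simp only [hsq]
  rw [hE.integral_norm_sum_sq, mul_assoc]
  refine mul_le_mul_of_nonneg_left ?_ hL
  have hfibre : ∀ η, ‖D η‖ ^ 2 ≤ C * ∑ p ∈ fib η, (w p.1 * ‖c p.1‖ ^ 2) * (w p.2 * ‖c p.2‖ ^ 2) := by
    intro η
    have h1 : ‖D η‖ ≤ ∑ p ∈ fib η, ‖c p.1‖ * ‖c p.2‖ := by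
      refine (_root_.norm_sum_le _ _).trans_eq ?_
      simp only [norm_mul]
    have h2 : (∑ p ∈ fib η, ‖c p.1‖ * ‖c p.2‖) ^ 2 ≤ (∑ p ∈ fib η, (w p.1 * w p.2)⁻¹) *
        ∑ p ∈ fib η, (w p.1 * ‖c p.1‖ ^ 2) * (w p.2 * ‖c p.2‖ ^ 2) := by
      refine Finset.sum_sq_le_sum_mul_sum_of_sq_le_mul _ (fun p _ => ?_) (fun p _ => ?_) fun p _ => ?_
      · have := hw p.1; have := hw p.2; positivity
      · have := hw p.1; have := hw p.2; positivity
      · have := (hw p.1).ne'; have := (hw p.2).ne'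
        refine le_of_eq ?_
        field_simp
    have h3 : ∑ p ∈ fib η, (w p.1 * w p.2)⁻¹ ≤ C := by
      have hinj : Set.InjOn Prod.fst (fib η : Set (Γ × Γ)) := by
        intro p hp q hq hpq
        have hp' := (Finset.mem_filter.1 (Finset.mem_coe.1 hp)).2
        have hq' := (Finset.mem_filter.1 (Finset.mem_coe.1 hq)).2
        refine Prod.ext hpq ?_
        rw [← hq', hpq] at hp'
        exact add_left_cancel hp'
      refine le_trans (le_of_eq ?_) (hC η ((fib η).image Prod.fst))
      rw [Finset.sum_image hinj]
      refine Finset.sum_congr rfl fun p hp => ?_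
      rw [← (Finset.mem_filter.1 hp).2, add_sub_cancel_left]
    refine (pow_le_pow_left₀ (norm_nonneg _) h1 2).trans (h2.trans ?_)
    refine mul_le_mul_of_nonneg_right h3 (Finset.sum_nonneg fun p _ => ?_)
    have := hw p.1; have := hw p.2; positivity
  refine (Finset.sum_le_sum fun η _ => hfibre η).trans_eq ?_
  rw [← Finset.mul_sum, Finset.sum_fiberwise_of_maps_to hmaps, sq, Finset.sum_mul_sum,
    ← Finset.sum_product']

/-- The dual estimate: the weighted square sum of the coefficients of an `L^{4/3}` function. -/
theorem IsCharacterSystem.sum_norm_coeff_sq_div_le [IsFiniteMeasure ν]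
    (hE : IsCharacterSystem ν L E) (hL : 0 ≤ L)
    (hw : ∀ γ, 0 < w γ) (hC : ∀ η (S : Finset Γ), ∑ γ ∈ S, (w γ * w (η - γ))⁻¹ ≤ C)
    {H : Ω → ℂ} (hH : AEStronglyMeasurable H ν) (hHi : Integrable (fun z => ‖H z‖ ^ (4 / 3 : ℝ)) ν)
    (S : Finset Γ) :
    ∑ γ ∈ S, ‖∫ z, H z * conj (E γ z) ∂ν‖ ^ 2 / w γ ≤
      (L * C) ^ (1 / 2 : ℝ) * (∫ z, ‖H z‖ ^ (4 / 3 : ℝ) ∂ν) ^ (3 / 2 : ℝ) := by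
  have hC0 : 0 ≤ C := by simpa using hC 0 ∅
  set a : Γ → ℂ := fun γ => ∫ z, H z * conj (E γ z) ∂ν with ha
  set A : ℝ := ∑ γ ∈ S, ‖a γ‖ ^ 2 / w γ with hA
  have hA0 : 0 ≤ A := Finset.sum_nonneg fun γ _ => by have := hw γ; positivity
  set p : Ω → ℂ := fun z => ∑ γ ∈ S, (a γ / w γ) * E γ z with hp
  have hpq : Real.HolderConjugate (4 / 3) 4 := by
    rw [Real.holderConjugate_iff]; norm_num
  have hHm : MemLp H (ENNReal.ofReal (4 / 3)) ν := by
    refine (integrable_norm_rpow_iff hH (by simp) (by simp)).1 ?_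
    rw [ENNReal.toReal_ofReal (by norm_num)]
    exact hHi
  have hpm : MemLp p (ENNReal.ofReal 4) ν :=
    MemLp.of_bound (hE.measurable_sum _ S).aestronglyMeasurable _
      (.of_forall (hE.norm_sum_le _ S))
  have hHI : Integrable H ν := hHm.integrable (by rw [← ENNReal.ofReal_one]; gcongr; norm_num)
  have hpair : ∫ z, H z * conj (p z) ∂ν = (A : ℂ) := by
    have e : ∀ z, H z * conj (p z) = ∑ γ ∈ S, conj (a γ / w γ) * (H z * conj (E γ z)) := by
      intro z
      rw [hp, map_sum, Finset.mul_sum]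
      refine Finset.sum_congr rfl fun γ _ => ?_
      rw [map_mul]
      ring
    simp only [e]
    rw [integral_finsetSum]
    · rw [hA]
      push_cast
      refine Finset.sum_congr rfl fun γ _ => ?_
      rw [integral_const_mul, map_div₀, Complex.conj_ofReal]
      change conj (a γ) / w γ * a γ = _
      rw [div_mul_eq_mul_div, mul_comm, Complex.mul_conj']
    · refine fun γ _ => (hHI.mul_bdd (c := 1) ?_ (.of_forall fun z => ?_)).const_mul _
      · exact (Complex.continuous_conj.measurable.comp (hE.measurable γ)).aestronglyMeasurable
      · rw [RCLike.norm_conj, hE.norm_eq_one]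
  have hholder : A ≤ (∫ z, ‖H z‖ ^ (4 / 3 : ℝ) ∂ν) ^ (3 / 4 : ℝ) *
      (∫ z, ‖p z‖ ^ (4 : ℝ) ∂ν) ^ (1 / 4 : ℝ) := by
    have h1 := integral_mul_norm_le_Lp_mul_Lq hpq hHm hpm
    have h2 : A = ‖∫ z, H z * conj (p z) ∂ν‖ := by
      rw [hpair, Complex.norm_real, Real.norm_of_nonneg hA0]
    rw [h2]
    refine (norm_integral_le_integral_norm _).trans ?_
    simp only [norm_mul, RCLike.norm_conj]
    refine h1.trans_eq ?_
    norm_num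
  have hp4 : ∫ z, ‖p z‖ ^ (4 : ℝ) ∂ν ≤ L * C * A ^ 2 := by
    have h1 := hE.integral_norm_sum_pow_four_le hL hw hC (fun γ => a γ / w γ) S
    have h2 : ∑ γ ∈ S, w γ * ‖a γ / w γ‖ ^ 2 = A := by
      refine Finset.sum_congr rfl fun γ _ => ?_
      have := (hw γ).ne'
      rw [norm_div, Complex.norm_real, Real.norm_of_nonneg (hw γ).le]
      field_simp
    rw [h2] at h1
    have h3 : ∀ z, ‖p z‖ ^ (4 : ℝ) = ‖p z‖ ^ 4 := fun z => by
      rw [← Real.rpow_natCast]; norm_num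
    simpa only [h3] using h1
  set J : ℝ := ∫ z, ‖H z‖ ^ (4 / 3 : ℝ) ∂ν with hJ
  have hJ0 : 0 ≤ J := integral_nonneg fun z => by positivity
  rcases hA0.eq_or_lt with h0 | h0
  · rw [← h0]
    positivity
  have h5 : A ≤ J ^ (3 / 4 : ℝ) * ((L * C) ^ (1 / 4 : ℝ) * A ^ (1 / 2 : ℝ)) := by
    refine hholder.trans (mul_le_mul_of_nonneg_left ?_ (by positivity))
    refine (Real.rpow_le_rpow (integral_nonneg fun z => by positivity) hp4 (by norm_num)).trans_eq ?_
    rw [Real.mul_rpow (by positivity) (by positivity), ← Real.rpow_natCast, ← Real.rpow_mul h0.le]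
    norm_num
  have h6 : A ^ 2 ≤ ((L * C) ^ (1 / 2 : ℝ) * J ^ (3 / 2 : ℝ)) * A := by
    refine (pow_le_pow_left₀ h0.le h5 2).trans_eq ?_
    rw [mul_pow, mul_pow, ← Real.rpow_natCast (J ^ _), ← Real.rpow_natCast ((L * C) ^ _),
      ← Real.rpow_natCast (A ^ _), ← Real.rpow_mul hJ0, ← Real.rpow_mul (by positivity),
      ← Real.rpow_mul h0.le]
    norm_num
    ring
  rw [sq] at h6
  exact le_of_mul_le_mul_right h6 h0

end bilinear

section time

/-- The character `e^{2πikt/T}`. -/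
noncomputable def timeChar (T : ℝ) (k : ℤ) (t : ℝ) : ℂ :=
  Complex.exp (2 * Real.pi * Complex.I * k * t / T)

theorem timeChar_eq_fourier (T : ℝ) (k : ℤ) (t : ℝ) :
    timeChar T k t = fourier k (t : AddCircle T) := by
  rw [fourier_coe_apply, timeChar]

theorem norm_timeChar (T : ℝ) (k : ℤ) (t : ℝ) : ‖timeChar T k t‖ = 1 := by
  rw [timeChar_eq_fourier, fourier_apply, Circle.norm_coe]

theorem continuous_timeChar (T : ℝ) (k : ℤ) : Continuous (timeChar T k) := by
  unfold timeChar
  fun_prop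

theorem conj_timeChar (T : ℝ) (k : ℤ) (t : ℝ) : conj (timeChar T k t) = timeChar T (-k) t := by
  rw [timeChar_eq_fourier, timeChar_eq_fourier, fourier_neg]

theorem timeChar_add (T : ℝ) (k l : ℤ) (t : ℝ) :
    timeChar T (k + l) t = timeChar T k t * timeChar T l t := by
  simp only [timeChar_eq_fourier, fourier_add]

theorem hasDerivAt_timeChar (T : ℝ) (k : ℤ) (t : ℝ) :
    HasDerivAt (timeChar T k) (2 * Real.pi * Complex.I * k / T * timeChar T k t) t := by
  have h := hasDerivAt_fourier T k t
  refine (h.congr_of_eventuallyEq (.of_forall fun s => timeChar_eq_fourier T k s)).congr_deriv ?_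
  rw [timeChar_eq_fourier]

theorem integral_timeChar {T : ℝ} (hT : 0 < T) (k : ℤ) :
    ∫ t in (0 : ℝ)..T, timeChar T k t = if k = 0 then (T : ℂ) else 0 := by
  split_ifs with hk
  · simp [hk, timeChar]
  · have hT' : (T : ℂ) ≠ 0 := by exact_mod_cast hT.ne'
    have hk' : (k : ℂ) ≠ 0 := by exact_mod_cast hk
    have hc : 2 * Real.pi * Complex.I * k / T ≠ 0 := by
      have : (Real.pi : ℂ) ≠ 0 := by exact_mod_cast Real.pi_ne_zero
      simp [hT', hk', this]
    have h1 : ∀ t : ℝ, timeChar T k t = Complex.exp (2 * Real.pi * Complex.I * k / T * t) := by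
      intro t
      unfold timeChar
      congr 1
      ring
    simp only [h1]
    rw [integral_exp_mul_complex hc]
    have h2 : 2 * Real.pi * Complex.I * k / T * (T : ℂ) = k * (2 * Real.pi * Complex.I) := by
      field_simp
    rw [h2, Complex.exp_int_mul_two_pi_mul_I]
    simp

/-- Parseval's identity on the interval `(0, T]`. -/
theorem hasSum_integral_mul_conj_timeChar {T : ℝ} (hT : 0 < T) {f g : ℝ → ℂ}
    (hf : MemLp f 2 (volume.restrict (Set.Ioc 0 T)))
    (hg : MemLp g 2 (volume.restrict (Set.Ioc 0 T))) :
    HasSum (fun k => (∫ t in (0 : ℝ)..T, f t * conj (timeChar T k t)) *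
      conj (∫ t in (0 : ℝ)..T, g t * conj (timeChar T k t)))
      (T * ∫ t in (0 : ℝ)..T, f t * conj (g t)) := by
  have : Fact (0 < T) := ⟨hT⟩
  have lift : ∀ {f : ℝ → ℂ}, MemLp f 2 (volume.restrict (Set.Ioc 0 T)) →
      MemLp (AddCircle.liftIoc T 0 f) 2 AddCircle.haarAddCircle := by
    intro f hf
    refine MemLp.haarAddCircle (MemLp.memLp_liftIoc ?_)
    rwa [zero_add]
  have coeff : ∀ (f : ℝ → ℂ) (k : ℤ), fourierCoeff (AddCircle.liftIoc T 0 f) k =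
      (1 / T : ℂ) * ∫ t in (0 : ℝ)..T, f t * conj (timeChar T k t) := by
    intro f k
    rw [fourierCoeff_eq_intervalIntegral _ _ 0, zero_add, Complex.real_smul]
    push_cast
    congr 1
    rw [intervalIntegral.integral_of_le hT.le, intervalIntegral.integral_of_le hT.le]
    refine setIntegral_congr_fun measurableSet_Ioc fun t ht => ?_
    simp only [smul_eq_mul]
    rw [AddCircle.liftIoc_coe_apply (by rwa [zero_add]), conj_timeChar, timeChar_eq_fourier, mul_comm]
  have hsum := fourierBasis.hasSum_inner_mul_inner ((lift hg).toLp _) ((lift hf).toLp _)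
  have e1 : ∀ k : ℤ, inner ℂ ((lift hg).toLp _) (fourierBasis k) *
      inner ℂ (fourierBasis k) ((lift hf).toLp _) =
      (1 / T : ℂ) ^ 2 * ((∫ t in (0 : ℝ)..T, f t * conj (timeChar T k t)) *
      conj (∫ t in (0 : ℝ)..T, g t * conj (timeChar T k t))) := by
    intro k
    rw [← inner_conj_symm, ← HilbertBasis.repr_apply_apply, ← HilbertBasis.repr_apply_apply,
      fourierBasis_repr, fourierBasis_repr, fourierCoeff_congr_ae (lift hf).coeFn_toLp,
      fourierCoeff_congr_ae (lift hg).coeFn_toLp, coeff, coeff, map_mul]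
    simp only [one_div, map_inv₀, Complex.conj_ofReal]
    ring
  have e2 : inner ℂ ((lift hg).toLp _) ((lift hf).toLp _) =
      (1 / T : ℂ) * ∫ t in (0 : ℝ)..T, f t * conj (g t) := by
    rw [L2.inner_def]
    have e3 : ∀ᵐ x ∂(AddCircle.haarAddCircle (T := T)), inner ℂ ((lift hg).toLp _ x)
        ((lift hf).toLp _ x) = AddCircle.liftIoc T 0 (fun t => f t * conj (g t)) x := by
      filter_upwards [(lift hf).coeFn_toLp, (lift hg).coeFn_toLp] with x h1 h2
      rw [h1, h2, RCLike.inner_apply]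
      rfl
    rw [integral_congr_ae e3, AddCircle.integral_haarAddCircle,
      AddCircle.integral_liftIoc_eq_intervalIntegral, zero_add, Complex.real_smul]
    push_cast
    rw [one_div]
  rw [e2, funext e1] at hsum
  have hT' : (T : ℂ) ≠ 0 := by exact_mod_cast hT.ne'
  have h3 := hsum.mul_left ((T : ℂ) ^ 2)
  have e4 : ∀ x : ℂ, (T : ℂ) ^ 2 * ((1 / T : ℂ) ^ 2 * x) = x := fun x => by field_simp
  have e5 : ∀ x : ℂ, (T : ℂ) ^ 2 * ((1 / T : ℂ) * x) = T * x := fun x => by field_simp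
  simp only [e4, e5] at h3
  exact h3

end time

section spaceTime

variable {d : ℕ}

/-- The measure `dt dx` on `(0, T] × 𝕋^d`. -/
noncomputable abbrev spaceTimeMeasure (d : ℕ) (T : ℝ) : Measure (ℝ × UnitAddTorus (Fin d)) :=
  (volume.restrict (Set.Ioc 0 T)).prod (torusMeasure d)

/-- The characters `e^{2πikt/T} e_n(x)`. -/
noncomputable def spaceTimeChar (T : ℝ) (γ : ℤ × (Fin d → ℤ)) (p : ℝ × UnitAddTorus (Fin d)) : ℂ :=
  timeChar T γ.1 p.1 * UnitAddTorus.mFourier γ.2 p.2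

theorem integral_mFourier_mul_conj (m n : Fin d → ℤ) :
    ∫ x, UnitAddTorus.mFourier m x * conj (UnitAddTorus.mFourier n x) ∂(torusMeasure d) =
      if m = n then 1 else 0 := by
  classical
  have h := torusCoeff_mFourier m n
  unfold torusCoeff at h
  simp only [UnitAddTorus.mFourier_neg] at h
  rw [h]

theorem isCharacterSystem_spaceTimeChar {T : ℝ} (hT : 0 < T) :
    IsCharacterSystem (spaceTimeMeasure d T) T (spaceTimeChar (d := d) T) where
  measurable γ := ((continuous_timeChar T γ.1).measurable.comp measurable_fst).mul
    ((UnitAddTorus.mFourier γ.2).continuous.measurable.comp measurable_snd)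
  norm_eq_one γ p := by
    rw [spaceTimeChar, norm_mul, norm_timeChar, norm_mFourier_apply, mul_one]
  map_add γ δ p := by
    simp only [spaceTimeChar, Prod.fst_add, Prod.snd_add, timeChar_add, UnitAddTorus.mFourier_add]
    ring
  orthogonal γ δ := by
    have e : ∀ p : ℝ × UnitAddTorus (Fin d), spaceTimeChar T γ p * conj (spaceTimeChar T δ p) =
        timeChar T (γ.1 - δ.1) p.1 *
          (UnitAddTorus.mFourier γ.2 p.2 * conj (UnitAddTorus.mFourier δ.2 p.2)) := by
      intro p
      simp only [spaceTimeChar, map_mul]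
      rw [sub_eq_add_neg, timeChar_add, conj_timeChar]
      ring
    simp only [e]
    refine (integral_prod_mul (timeChar T (γ.1 - δ.1)) fun x =>
      UnitAddTorus.mFourier γ.2 x * conj (UnitAddTorus.mFourier δ.2 x)).trans ?_
    rw [integral_mFourier_mul_conj, ← intervalIntegral.integral_of_le hT.le,
      integral_timeChar hT]
    simp only [sub_eq_zero, Prod.ext_iff]
    by_cases h1 : γ.1 = δ.1 <;> by_cases h2 : γ.2 = δ.2 <;> simp [h1, h2]

/-- Fubini for the space-time Fourier coefficients. -/
theorem integral_mul_conj_spaceTimeChar {T : ℝ} (hT : 0 < T) {H : ℝ → UnitAddTorus (Fin d) → ℂ}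
    (hH : Integrable (Function.uncurry H) (spaceTimeMeasure d T)) (γ : ℤ × (Fin d → ℤ)) :
    ∫ p, Function.uncurry H p * conj (spaceTimeChar T γ p) ∂(spaceTimeMeasure d T) =
      ∫ t in (0 : ℝ)..T, torusCoeff (H t) γ.2 * conj (timeChar T γ.1 t) := by
  have hi : Integrable (fun p => Function.uncurry H p * conj (spaceTimeChar T γ p))
      (spaceTimeMeasure d T) :=
    hH.mul_bdd (c := 1) (Complex.continuous_conj.measurable.comp
      ((isCharacterSystem_spaceTimeChar hT).measurable γ)).aestronglyMeasurable
      (.of_forall fun p => by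
        rw [RCLike.norm_conj, (isCharacterSystem_spaceTimeChar hT).norm_eq_one])
  rw [integral_prod _ hi, intervalIntegral.integral_of_le hT.le]
  refine integral_congr_ae (.of_forall fun t => ?_)
  simp only [Function.uncurry_apply_pair, spaceTimeChar, map_mul]
  rw [torusCoeff, ← integral_mul_const]
  refine integral_congr_ae (.of_forall fun x => ?_)
  simp only [UnitAddTorus.mFourier_neg]
  ring

/-- The weight `1 + |2πk/T + |2πn|²|` adapted to the Schrödinger equation. -/
noncomputable def parabolaWeight (T : ℝ) (γ : ℤ × (Fin d → ℤ)) : ℝ :=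
  1 + |2 * Real.pi / T * γ.1 + laplaceEigenvalue γ.2|

theorem parabolaWeight_pos (T : ℝ) (γ : ℤ × (Fin d → ℤ)) : 0 < parabolaWeight T γ := by
  unfold parabolaWeight
  positivity

theorem exists_sum_parabolaWeight_le {T : ℝ} (hT : 0 < T) :
    ∃ C : ℝ, ∀ (η : ℤ × (Fin 1 → ℤ)) (S : Finset (ℤ × (Fin 1 → ℤ))),
      ∑ γ ∈ S, (parabolaWeight T γ * parabolaWeight T (η - γ))⁻¹ ≤ C := by
  classical
  obtain ⟨C, hC⟩ := exists_sum_parabola_le (α := 2 * Real.pi / T) (β := (2 * Real.pi) ^ 2)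
    (by positivity) (by positivity)
  refine ⟨C, fun η S => ?_⟩
  have hinj : Set.InjOn (fun γ : ℤ × (Fin 1 → ℤ) => (γ.1, γ.2 0)) (S : Set (ℤ × (Fin 1 → ℤ))) := by
    intro γ _ δ _ h
    simp only [Prod.mk.injEq] at h
    refine Prod.ext h.1 (funext fun i => ?_)
    rw [Subsingleton.elim i 0]
    exact h.2
  have h := hC η.1 (η.2 0) (S.image fun γ => (γ.1, γ.2 0))
  rw [Finset.sum_image hinj] at h
  refine le_trans (le_of_eq (Finset.sum_congr rfl fun γ _ => ?_)) h
  simp only [parabolaWeight, laplaceEigenvalue, Fin.sum_univ_one, Prod.fst_sub, Prod.snd_sub,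
    Pi.sub_apply]

/-- A nonnegative function with uniformly bounded slice integrals is integrable on space-time. -/
theorem integrable_spaceTime_of_slices {T B : ℝ} {f : ℝ × UnitAddTorus (Fin d) → ℝ}
    (hf : Measurable f) (hf0 : ∀ p, 0 ≤ f p)
    (h : ∀ t, Integrable (fun x => f (t, x)) (torusMeasure d))
    (hB : ∀ t, ∫ x, f (t, x) ∂(torusMeasure d) ≤ B) : Integrable f (spaceTimeMeasure d T) := by
  refine (integrable_prod_iff hf.aestronglyMeasurable).2 ⟨.of_forall h, ?_⟩
  have e : ∀ t x, ‖f (t, x)‖ = f (t, x) := fun t x => Real.norm_of_nonneg (hf0 _)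
  simp only [e]
  refine Measure.integrableOn_of_bounded (M := B) (by simp)
    hf.stronglyMeasurable.integral_prod_right'.aestronglyMeasurable (.of_forall fun t => ?_)
  rw [Real.norm_of_nonneg (integral_nonneg fun x => hf0 _)]
  exact hB t

end spaceTime

theorem norm_logDiff_rpow_le (lam : ℝ) (z w : ℂ) :
    ‖logDiff lam z w‖ ^ (4 / 3 : ℝ) ≤
      (2 : ℝ) ^ (4 / 3 : ℝ) * (8 * |lam|) ^ (4 / 3 : ℝ) * (2 + ‖z‖ ^ 2 + ‖w‖ ^ 2) := by
  have h1 : ‖logDiff lam z w‖ ≤ 2 * max ‖logNonlinearity lam z‖ ‖logNonlinearity lam w‖ := by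
    refine (norm_sub_le _ _).trans ?_
    have := le_max_left ‖logNonlinearity lam z‖ ‖logNonlinearity lam w‖
    have := le_max_right ‖logNonlinearity lam z‖ ‖logNonlinearity lam w‖
    linarith
  refine (Real.rpow_le_rpow (norm_nonneg _) h1 (by norm_num)).trans ?_
  rw [Real.mul_rpow (by norm_num) (by positivity), mul_assoc]
  refine mul_le_mul_of_nonneg_left ?_ (by positivity)
  have hc : 0 ≤ (8 * |lam|) ^ (4 / 3 : ℝ) := by positivity
  rcases max_choice ‖logNonlinearity lam z‖ ‖logNonlinearity lam w‖ with h | h <;> rw [h]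
  · refine (norm_logNonlinearity_rpow_le lam z).trans (mul_le_mul_of_nonneg_left ?_ hc)
    nlinarith [sq_nonneg ‖w‖]
  · refine (norm_logNonlinearity_rpow_le lam w).trans (mul_le_mul_of_nonneg_left ?_ hc)
    nlinarith [sq_nonneg ‖z‖]

section slices

variable {d : ℕ} {M : ℝ} {U V : ℝ → UnitAddTorus (Fin d) → ℂ}

theorem integrable_logDiff_rpow (hU : IsBoundedCurve M U) (hV : IsBoundedCurve M V) (lam t : ℝ) :
    Integrable (fun x => ‖logDiff lam (U t x) (V t x)‖ ^ (4 / 3 : ℝ)) (torusMeasure d) ∧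
    ∫ x, ‖logDiff lam (U t x) (V t x)‖ ^ (4 / 3 : ℝ) ∂(torusMeasure d) ≤
      (2 : ℝ) ^ (4 / 3 : ℝ) * (8 * |lam|) ^ (4 / 3 : ℝ) * (2 + M + M) := by
  have hi : Integrable (fun x => 2 + ‖U t x‖ ^ 2 + ‖V t x‖ ^ 2) (torusMeasure d) :=
    ((integrable_const (2 : ℝ)).add (hU.integrable_sq t)).add (hV.integrable_sq t)
  have h1 : Integrable (fun x => ‖logDiff lam (U t x) (V t x)‖ ^ (4 / 3 : ℝ)) (torusMeasure d) := by
    refine (hi.const_mul ((2 : ℝ) ^ (4 / 3 : ℝ) * (8 * |lam|) ^ (4 / 3 : ℝ))).mono'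
      (((measurable_logDiff hU hV lam).comp
        measurable_prodMk_left).norm.pow_const _).aestronglyMeasurable (.of_forall fun x => ?_)
    rw [Real.norm_of_nonneg (by positivity)]
    exact norm_logDiff_rpow_le lam _ _
  refine ⟨h1, (integral_mono h1 (hi.const_mul _) fun x => norm_logDiff_rpow_le lam _ _).trans ?_⟩
  rw [integral_const_mul]
  refine mul_le_mul_of_nonneg_left ?_ (by positivity)
  have hi2 : Integrable (fun x => 2 + ‖U t x‖ ^ 2) (torusMeasure d) :=
    (integrable_const (2 : ℝ)).add (hU.integrable_sq t)
  rw [integral_add hi2 (hV.integrable_sq t),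
    integral_add (integrable_const (2 : ℝ)) (hU.integrable_sq t)]
  have h2 : ∫ _ : UnitAddTorus (Fin d), (2 : ℝ) ∂(torusMeasure d) = 2 := by simp
  rw [h2]
  exact add_le_add (add_le_add le_rfl (hU.bound t)) (hV.bound t)

theorem memLp_logDiff_spaceTime (hU : IsBoundedCurve M U) (hV : IsBoundedCurve M V) (lam T : ℝ) :
    MemLp (Function.uncurry fun t x => logDiff lam (U t x) (V t x)) (ENNReal.ofReal (4 / 3))
      (spaceTimeMeasure d T) := by
  have hm := measurable_logDiff hU hV lam
  refine (integrable_norm_rpow_iff hm.aestronglyMeasurable (by simp) (by simp)).1 ?_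
  rw [ENNReal.toReal_ofReal (by norm_num)]
  exact integrable_spaceTime_of_slices (hm.norm.pow_const _) (fun p => by positivity)
    (fun t => (integrable_logDiff_rpow hU hV lam t).1)
    (fun t => (integrable_logDiff_rpow hU hV lam t).2)

theorem IsBoundedCurve.memLp_spaceTime (hU : IsBoundedCurve M U) (T : ℝ) :
    MemLp (Function.uncurry U) (ENNReal.ofReal (4 / 3)) (spaceTimeMeasure d T) := by
  have h2 : MemLp (Function.uncurry U) 2 (spaceTimeMeasure d T) := by
    refine (memLp_two_iff_integrable_sq_norm hU.measurable.aestronglyMeasurable).2 ?_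
    exact integrable_spaceTime_of_slices (hU.measurable.norm.pow_const 2) (fun p => sq_nonneg _)
      hU.integrable_sq hU.bound
  refine h2.mono_exponent ?_
  rw [← ENNReal.ofReal_ofNat]
  exact ENNReal.ofReal_le_ofReal (by norm_num)

theorem ae_spaceTime_mem (d : ℕ) (T : ℝ) :
    ∀ᵐ p ∂(spaceTimeMeasure d T), p.1 ∈ Set.Ioc 0 T :=
  Measure.quasiMeasurePreserving_fst.ae (ae_restrict_mem measurableSet_Ioc)

end slices

/-- The space-time coefficients of an `L^{4/3}` function on `(0, T] × 𝕋` are square summable with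
the weight `(1 + |2πk/T + |2πn|²|)⁻¹`. -/
theorem exists_sum_coeff_div_parabolaWeight_le {T : ℝ} (hT : 0 < T) :
    ∃ C : ℝ, 0 ≤ C ∧ ∀ H : ℝ → UnitAddTorus (Fin 1) → ℂ,
      MemLp (Function.uncurry H) (ENNReal.ofReal (4 / 3)) (spaceTimeMeasure 1 T) →
      ∀ S : Finset (ℤ × (Fin 1 → ℤ)),
        ∑ γ ∈ S, ‖∫ t in (0 : ℝ)..T, torusCoeff (H t) γ.2 * conj (timeChar T γ.1 t)‖ ^ 2 /
          parabolaWeight T γ ≤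
        C * (∫ p, ‖Function.uncurry H p‖ ^ (4 / 3 : ℝ) ∂(spaceTimeMeasure 1 T)) ^ (3 / 2 : ℝ) := by
  classical
  obtain ⟨C, hC⟩ := exists_sum_parabolaWeight_le hT
  have hC0 : 0 ≤ C := by simpa using hC 0 ∅
  refine ⟨(T * C) ^ (1 / 2 : ℝ), by positivity, fun H hH S => ?_⟩
  have hi := (integrable_norm_rpow_iff hH.1 (by simp) (by simp)).2 hH
  rw [ENNReal.toReal_ofReal (by norm_num)] at hi
  have hI : Integrable (Function.uncurry H) (spaceTimeMeasure 1 T) :=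
    hH.integrable (by rw [← ENNReal.ofReal_one]; gcongr; norm_num)
  have h := (isCharacterSystem_spaceTimeChar hT).sum_norm_coeff_sq_div_le hT.le
    (parabolaWeight_pos T) hC hH.1 hi S
  simpa only [integral_mul_conj_spaceTimeChar hT hI] using h

section equation

variable {d : ℕ} {M : ℝ} {U V : ℝ → UnitAddTorus (Fin d) → ℂ}

/-- The equation for `(T - t)(u - v)` in terms of space-time Fourier coefficients. -/
theorem spaceTime_coeff_equation (hU : IsBoundedCurve M U) (hV : IsBoundedCurve M V)
    {lam T : ℝ} (hT : 0 < T) (hEq : FourierDifferenceEquation lam T U V) (n : Fin d → ℤ) (k : ℤ) :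
    Complex.I * ((2 * Real.pi / T * k + laplaceEigenvalue n : ℝ) : ℂ) *
      (∫ t in (0 : ℝ)..T, torusCoeff (fun x => ((T - t : ℝ) : ℂ) * (U t x - V t x)) n *
        conj (timeChar T k t)) =
      ∫ t in (0 : ℝ)..T, torusCoeff (fun x => Complex.I * ((T - t : ℝ) : ℂ) *
        logDiff lam (U t x) (V t x) - (U t x - V t x)) n * conj (timeChar T k t) := by
  have hW := hU.sub hV
  set a : ℝ → ℂ := fun t => torusCoeff (fun x => U t x - V t x) n with ha
  set F : ℝ → ℂ := fun t => torusCoeff (fun x => logDiff lam (U t x) (V t x)) n with hF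
  have ham : Measurable a := measurable_torusCoeff hW.measurable n
  have hFm : Measurable F := measurable_torusCoeff (measurable_logDiff hU hV lam) n
  have haI : IntegrableOn a (Set.Ioc 0 T) :=
    integrableOn_Ioc_of_measurable_of_bounded ham (hW.norm_torusCoeff_le n) 0 T
  have hFI : IntegrableOn F (Set.Ioc 0 T) :=
    integrableOn_Ioc_of_measurable_of_bounded hFm (norm_torusCoeff_logDiff_le hU hV lam n) 0 T
  have haI' := (intervalIntegrable_iff_integrableOn_Ioc_of_le hT.le).2 haI
  have hFI' := (intervalIntegrable_iff_integrableOn_Ioc_of_le hT.le).2 hFI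
  set c : ℂ := 2 * Real.pi * Complex.I * ((-k : ℤ) : ℂ) / T with hc
  set φ : ℝ → ℂ := fun t => ((T - t : ℝ) : ℂ) * timeChar T (-k) t with hφ
  have hφd : ∀ t, HasDerivAt φ (-timeChar T (-k) t + c * φ t) t := by
    intro t
    have h1 : HasDerivAt (fun t : ℝ => ((T - t : ℝ) : ℂ)) (((-1 : ℝ)) : ℂ) t := by
      exact ((hasDerivAt_id t).const_sub T).ofReal_comp
    refine (h1.mul (hasDerivAt_timeChar T (-k) t)).congr_deriv ?_
    simp only [hφ, hc]
    push_cast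
    ring
  have hφc : Continuous φ := continuous_iff_continuousAt.2 fun t => (hφd t).continuousAt
  have key := integral_primitive_mul_deriv hT.le
    (((haI.const_mul (-(laplaceEigenvalue n : ℂ))).add hFI).const_mul Complex.I) hφd
    ((continuous_timeChar T (-k)).neg.add (hφc.const_mul c))
  have hφT : φ T = 0 := by simp [hφ]
  rw [hφT, mul_zero, zero_sub] at key
  have hae : ∫ s in (0 : ℝ)..T, (∫ r in (0 : ℝ)..s, Complex.I * (-(laplaceEigenvalue n : ℂ) * a r
      + F r)) * (-timeChar T (-k) s + c * φ s) =
      ∫ s in (0 : ℝ)..T, a s * (-timeChar T (-k) s + c * φ s) := by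
    rw [intervalIntegral.integral_of_le hT.le, intervalIntegral.integral_of_le hT.le]
    refine integral_congr_ae ((hEq n).mono fun s hs => ?_)
    simp only
    rw [← hs]
  have key' := hae.symm.trans key
  have i1 : IntervalIntegrable (fun s => a s * timeChar T (-k) s) volume 0 T :=
    haI'.mul_continuousOn (continuous_timeChar T (-k)).continuousOn
  have i2 : IntervalIntegrable (fun s => a s * φ s) volume 0 T := haI'.mul_continuousOn hφc.continuousOn
  have i3 : IntervalIntegrable (fun s => F s * φ s) volume 0 T := hFI'.mul_continuousOn hφc.continuousOn
  have e1 : ∀ s, a s * (-timeChar T (-k) s + c * φ s) =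
      c * (a s * φ s) - a s * timeChar T (-k) s := fun s => by ring
  have e2 : ∀ s, Complex.I * (-(laplaceEigenvalue n : ℂ) * a s + F s) * φ s =
      Complex.I * (F s * φ s) - Complex.I * laplaceEigenvalue n * (a s * φ s) := fun s => by ring
  have key2 : ∫ s in (0 : ℝ)..T, (c * (a s * φ s) - a s * timeChar T (-k) s) =
      -∫ s in (0 : ℝ)..T, (Complex.I * (F s * φ s) -
        Complex.I * laplaceEigenvalue n * (a s * φ s)) := by
    simpa only [e1, e2, Pi.add_apply] using key'
  rw [intervalIntegral.integral_sub (i2.const_mul _) i1,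
    intervalIntegral.integral_sub (i3.const_mul _) (i2.const_mul _),
    intervalIntegral.integral_const_mul, intervalIntegral.integral_const_mul,
    intervalIntegral.integral_const_mul] at key2
  have e3 : ∀ t, torusCoeff (fun x => ((T - t : ℝ) : ℂ) * (U t x - V t x)) n *
      conj (timeChar T k t) = a t * φ t := by
    intro t
    rw [torusCoeff_const_mul, conj_timeChar]
    simp only [ha, hφ]
    ring
  have e4 : ∀ t, torusCoeff (fun x => Complex.I * ((T - t : ℝ) : ℂ) *
      logDiff lam (U t x) (V t x) - (U t x - V t x)) n * conj (timeChar T k t) =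
      Complex.I * (F t * φ t) - a t * timeChar T (-k) t := by
    intro t
    rw [torusCoeff_sub ((integrable_logDiff hU hV lam t).const_mul _) (hW.integrable t),
      torusCoeff_const_mul, conj_timeChar]
    simp only [ha, hφ, hF]
    ring
  simp only [e3, e4]
  rw [intervalIntegral.integral_sub (i3.const_mul _) i1, intervalIntegral.integral_const_mul]
  have e5 : Complex.I * ((2 * Real.pi / T * k + laplaceEigenvalue n : ℝ) : ℂ) =
      Complex.I * laplaceEigenvalue n - c := by
    rw [hc]
    push_cast
    ring
  rw [e5]
  linear_combination -key2

end equation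

section dimensionOne

variable {M : ℝ} {U V : ℝ → UnitAddTorus (Fin 1) → ℂ}

/-- The smoothing of the Schrödinger equation: the space-time coefficients of `(T - t)(u - v)` are
square summable with the weight `1 + |2πk/T + |2πn|²|`. -/
theorem exists_sum_parabolaWeight_mul_coeff_le (hU : IsBoundedCurve M U) (hV : IsBoundedCurve M V)
    {lam T : ℝ} (hT : 0 < T) (hEq : FourierDifferenceEquation lam T U V) :
    ∃ C : ℝ, 0 ≤ C ∧ ∀ S : Finset (ℤ × (Fin 1 → ℤ)), ∑ γ ∈ S, parabolaWeight T γ *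
      ‖∫ t in (0 : ℝ)..T, torusCoeff (fun x => ((T - t : ℝ) : ℂ) * (U t x - V t x)) γ.2 *
        conj (timeChar T γ.1 t)‖ ^ 2 ≤ C := by
  have hWc := hU.sub hV
  obtain ⟨C, hC0, hC⟩ := exists_sum_coeff_div_parabolaWeight_le hT
  have hmT : Measurable fun p : ℝ × UnitAddTorus (Fin 1) => ((T - p.1 : ℝ) : ℂ) :=
    Complex.measurable_ofReal.comp (measurable_const.sub measurable_fst)
  have hbd : ∀ᵐ p ∂(spaceTimeMeasure 1 T), ‖((T - p.1 : ℝ) : ℂ)‖ ≤ T := by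
    filter_upwards [ae_spaceTime_mem 1 T] with p hp
    rw [Complex.norm_real, Real.norm_eq_abs, abs_le]
    constructor <;> linarith [hp.1, hp.2]
  have hWm := hWc.memLp_spaceTime T
  have hFm := memLp_logDiff_spaceTime hU hV lam T
  have h1 : MemLp (Function.uncurry fun t x => ((T - t : ℝ) : ℂ) * (U t x - V t x))
      (ENNReal.ofReal (4 / 3)) (spaceTimeMeasure 1 T) := by
    refine MemLp.of_le_mul (c := T) hWm (hmT.mul hWc.measurable).aestronglyMeasurable ?_
    filter_upwards [hbd] with p hp
    simp only [Function.uncurry]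
    rw [norm_mul]
    exact mul_le_mul_of_nonneg_right hp (norm_nonneg _)
  have h2 : MemLp (Function.uncurry fun t x => Complex.I * ((T - t : ℝ) : ℂ) *
      logDiff lam (U t x) (V t x)) (ENNReal.ofReal (4 / 3)) (spaceTimeMeasure 1 T) := by
    refine MemLp.of_le_mul (c := T) hFm
      ((hmT.const_mul Complex.I).mul (measurable_logDiff hU hV lam)).aestronglyMeasurable ?_
    filter_upwards [hbd] with p hp
    simp only [Function.uncurry]
    rw [norm_mul, norm_mul, Complex.norm_I, one_mul]
    exact mul_le_mul_of_nonneg_right hp (norm_nonneg _)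
  have h3 : MemLp (Function.uncurry fun t x => Complex.I * ((T - t : ℝ) : ℂ) *
      logDiff lam (U t x) (V t x) - (U t x - V t x)) (ENNReal.ofReal (4 / 3))
      (spaceTimeMeasure 1 T) := h2.sub hWm
  refine ⟨2 * (C * (∫ p, ‖Function.uncurry (fun t x => ((T - t : ℝ) : ℂ) * (U t x - V t x)) p‖ ^
      (4 / 3 : ℝ) ∂(spaceTimeMeasure 1 T)) ^ (3 / 2 : ℝ)) +
    2 * (C * (∫ p, ‖Function.uncurry (fun t x => Complex.I * ((T - t : ℝ) : ℂ) *
      logDiff lam (U t x) (V t x) - (U t x - V t x)) p‖ ^ (4 / 3 : ℝ)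
        ∂(spaceTimeMeasure 1 T)) ^ (3 / 2 : ℝ)), by positivity, fun S => ?_⟩
  refine le_trans ?_ (add_le_add (mul_le_mul_of_nonneg_left (hC _ h1 S) two_pos.le)
    (mul_le_mul_of_nonneg_left (hC _ h3 S) two_pos.le))
  rw [Finset.mul_sum, Finset.mul_sum, ← Finset.sum_add_distrib]
  refine Finset.sum_le_sum fun γ _ => ?_
  have heq := congrArg norm (spaceTime_coeff_equation hU hV hT hEq γ.2 γ.1)
  rw [norm_mul, norm_mul, Complex.norm_I, one_mul, Complex.norm_real, Real.norm_eq_abs] at heq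
  rw [← heq]
  set q := ‖∫ t in (0 : ℝ)..T, torusCoeff (fun x => ((T - t : ℝ) : ℂ) * (U t x - V t x)) γ.2 *
        conj (timeChar T γ.1 t)‖
  have hw : parabolaWeight T γ = 1 + |2 * Real.pi / T * γ.1 + laplaceEigenvalue γ.2| := rfl
  have hw0 := parabolaWeight_pos T γ
  set σ := |2 * Real.pi / T * γ.1 + laplaceEigenvalue γ.2|
  rw [← mul_div_assoc, ← mul_div_assoc, ← add_div, le_div_iff₀ hw0, hw]
  nlinarith [mul_nonneg (sq_nonneg q) (sq_nonneg (1 - σ))]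

/-- In dimension one the pairing of the large part of the nonlinearity with the difference is
negligible, by the periodic Strichartz inequality. -/
theorem high_part_small_of_dim_one (hU : IsBoundedCurve M U) (hV : IsBoundedCurve M V)
    {lam T : ℝ} (hT : 0 < T) (hEq : FourierDifferenceEquation lam T U V) {t : ℝ}
    (ht : t ∈ Set.Ioo 0 T) {ε : ℝ} (hε : 0 < ε) :
    ∃ R : ℝ, ∀ S : Finset (Fin 1 → ℤ),
      ‖∫ s in (0 : ℝ)..t, ∑ n ∈ S, torusCoeff (fun x => logDiffHigh lam R (U s x) (V s x)) n *
        conj (torusCoeff (fun x => U s x - V s x) n)‖ ≤ ε := by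
  have hW := hU.sub hV
  obtain ⟨C, hC0, hC⟩ := exists_sum_coeff_div_parabolaWeight_le hT
  obtain ⟨D, hD0, hD⟩ := exists_sum_parabolaWeight_mul_coeff_le hU hV hT hEq
  obtain ⟨δ, hδ, hδε⟩ : ∃ δ > 0, δ * D ≤ T * ε / 2 := by
    refine ⟨T * ε / 2 / (D + 1), by positivity, ?_⟩
    rw [div_mul_eq_mul_div, div_le_iff₀ (by positivity)]
    nlinarith [mul_pos hT hε]
  set b : ℝ := (T - t)⁻¹ with hb
  have hb0 : 0 < b := inv_pos.2 (sub_pos.2 ht.2)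
  set χ : ℝ → ℝ := fun s => if s ≤ t then (T - s)⁻¹ else 0 with hχ
  have hχm : Measurable χ := Measurable.ite measurableSet_Iic
    (measurable_const.sub measurable_id).inv measurable_const
  have hχb : ∀ s, ‖(χ s : ℂ)‖ ≤ b := by
    intro s
    rw [Complex.norm_real, Real.norm_eq_abs]
    simp only [hχ]
    split_ifs with hs
    · have h1 : 0 < T - s := by linarith [ht.2]
      rw [abs_of_pos (inv_pos.2 h1)]
      exact inv_anti₀ (sub_pos.2 ht.2) (by linarith)
    · rw [abs_zero]; exact hb0.le
  have hlim := tendsto_integral_logDiffHigh_rpow (p := 4 / 3) hU hV (by norm_num) hT.le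
    (.of_forall fun s => integrable_logDiff_rpow hU hV lam s)
  have hlim2 : Tendsto (fun R : ℕ => δ⁻¹ * (C * (b ^ (4 / 3 : ℝ) * ∫ s in (0 : ℝ)..T,
      ∫ x, ‖logDiffHigh lam R (U s x) (V s x)‖ ^ (4 / 3 : ℝ) ∂(torusMeasure 1)) ^ (3 / 2 : ℝ)))
      atTop (𝓝 0) := by
    have h1 := (((hlim.const_mul (b ^ (4 / 3 : ℝ))).rpow_const (p := 3 / 2)
      (Or.inr (by norm_num))).const_mul C).const_mul δ⁻¹
    rwa [mul_zero, Real.zero_rpow (by norm_num), mul_zero, mul_zero] at h1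
  obtain ⟨R, hR⟩ := (hlim2.eventually (gt_mem_nhds (show 0 < T * ε / 2 by positivity))).exists
  refine ⟨R, fun S => ?_⟩
  set H : ℝ → UnitAddTorus (Fin 1) → ℂ := fun s x =>
    (χ s : ℂ) * logDiffHigh lam R (U s x) (V s x) with hH
  set Z : ℝ → UnitAddTorus (Fin 1) → ℂ := fun s x => ((T - s : ℝ) : ℂ) * (U s x - V s x) with hZ
  have hHmeas : Measurable (Function.uncurry H) :=
    ((Complex.measurable_ofReal.comp hχm).comp measurable_fst).mul
      (measurable_logDiffHigh hU hV lam R)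
  have hHle : ∀ p : ℝ × UnitAddTorus (Fin 1), ‖Function.uncurry H p‖ ≤
      b * ‖logDiffHigh lam R (U p.1 p.2) (V p.1 p.2)‖ := by
    intro p
    simp only [hH, Function.uncurry]
    rw [norm_mul]
    exact mul_le_mul_of_nonneg_right (hχb _) (norm_nonneg _)
  have hHL : MemLp (Function.uncurry H) (ENNReal.ofReal (4 / 3)) (spaceTimeMeasure 1 T) := by
    refine MemLp.of_le_mul (c := b) (memLp_logDiff_spaceTime hU hV lam T)
      hHmeas.aestronglyMeasurable (.of_forall fun p => (hHle p).trans ?_)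
    exact mul_le_mul_of_nonneg_left (norm_logDiffHigh_le _ _ _ _) hb0.le
  have hHint : ∫ p, ‖Function.uncurry H p‖ ^ (4 / 3 : ℝ) ∂(spaceTimeMeasure 1 T) ≤
      b ^ (4 / 3 : ℝ) * ∫ s in (0 : ℝ)..T,
      ∫ x, ‖logDiffHigh lam R (U s x) (V s x)‖ ^ (4 / 3 : ℝ) ∂(torusMeasure 1) := by
    have hi : Integrable (fun p : ℝ × UnitAddTorus (Fin 1) =>
        ‖logDiffHigh lam R (U p.1 p.2) (V p.1 p.2)‖ ^ (4 / 3 : ℝ)) (spaceTimeMeasure 1 T) :=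
      integrable_spaceTime_of_slices ((measurable_logDiffHigh hU hV lam R).norm.pow_const _)
        (fun p => by positivity)
        (fun s => integrable_logDiffHigh_rpow hU hV (by norm_num) R s
          (integrable_logDiff_rpow hU hV lam s).1)
        (fun s => (integral_logDiffHigh_rpow_le hU hV (by norm_num) R s
          (integrable_logDiff_rpow hU hV lam s).1).trans (integrable_logDiff_rpow hU hV lam s).2)
    have e : ∫ s in (0 : ℝ)..T,
        ∫ x, ‖logDiffHigh lam R (U s x) (V s x)‖ ^ (4 / 3 : ℝ) ∂(torusMeasure 1) =
        ∫ p : ℝ × UnitAddTorus (Fin 1), ‖logDiffHigh lam R (U p.1 p.2) (V p.1 p.2)‖ ^ (4 / 3 : ℝ)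
          ∂(spaceTimeMeasure 1 T) := by
      rw [integral_prod _ hi, intervalIntegral.integral_of_le hT.le]
    rw [e, ← integral_const_mul]
    refine integral_mono_of_nonneg (.of_forall fun p => by positivity) (hi.const_mul _)
      (.of_forall fun p => ?_)
    simp only
    rw [← Real.mul_rpow hb0.le (norm_nonneg _)]
    exact Real.rpow_le_rpow (norm_nonneg _) (hHle p) (by norm_num)
  have hHcoeff : ∀ s n, torusCoeff (H s) n =
      (χ s : ℂ) * torusCoeff (fun x => logDiffHigh lam R (U s x) (V s x)) n := fun s n =>
    torusCoeff_const_mul _ _ _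
  have hZcoeff : ∀ s n, torusCoeff (Z s) n =
      ((T - s : ℝ) : ℂ) * torusCoeff (fun x => U s x - V s x) n := fun s n =>
    torusCoeff_const_mul _ _ _
  have hHmem : ∀ n, MemLp (fun s => torusCoeff (H s) n) 2 (volume.restrict (Set.Ioc 0 T)) := by
    intro n
    refine MemLp.of_bound (measurable_torusCoeff hHmeas n).aestronglyMeasurable
      (b * (16 * |lam| * (1 + M))) (.of_forall fun s => ?_)
    rw [hHcoeff, norm_mul]
    exact mul_le_mul (hχb s) (norm_torusCoeff_logDiffHigh_le hU hV lam R n s) (norm_nonneg _) hb0.le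
  have hZmeas : Measurable (Function.uncurry Z) :=
    (Complex.measurable_ofReal.comp (measurable_const.sub measurable_fst)).mul hW.measurable
  have hZmem : ∀ n, MemLp (fun s => torusCoeff (Z s) n) 2 (volume.restrict (Set.Ioc 0 T)) := by
    intro n
    refine MemLp.of_bound (measurable_torusCoeff hZmeas n).aestronglyMeasurable
      (T * (1 + 4 * M)) ?_
    filter_upwards [ae_restrict_mem measurableSet_Ioc] with s hs
    rw [hZcoeff, norm_mul]
    refine mul_le_mul ?_ (hW.norm_torusCoeff_le n s) (norm_nonneg _) hT.le
    rw [Complex.norm_real, Real.norm_eq_abs, abs_le]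
    constructor <;> linarith [hs.1, hs.2]
  have hpair : ∀ n, ∫ s in (0 : ℝ)..T, torusCoeff (H s) n * conj (torusCoeff (Z s) n) =
      ∫ s in (0 : ℝ)..t, torusCoeff (fun x => logDiffHigh lam R (U s x) (V s x)) n *
        conj (torusCoeff (fun x => U s x - V s x) n) := by
    intro n
    have h0 := setIntegral_eq_of_subset_of_forall_sdiff_eq_zero (μ := volume)
      (f := fun s => torusCoeff (H s) n * conj (torusCoeff (Z s) n)) measurableSet_Ioc
      (Set.Ioc_subset_Ioc_right ht.2.le : Set.Ioc 0 t ⊆ Set.Ioc 0 T) (fun s hs => by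
        have h1 : ¬ s ≤ t := fun h => hs.2 ⟨hs.1.1, h⟩
        simp only [hHcoeff, hχ, if_neg h1, Complex.ofReal_zero, zero_mul])
    rw [intervalIntegral.integral_of_le hT.le, intervalIntegral.integral_of_le ht.1.le, h0]
    refine setIntegral_congr_fun measurableSet_Ioc fun s hs => ?_
    have h1 : (T : ℂ) - s ≠ 0 := by
      have : T - s ≠ 0 := by linarith [hs.2, ht.2]
      exact_mod_cast this
    simp only [hHcoeff, hZcoeff, hχ, if_pos hs.2, map_mul, Complex.conj_ofReal]
    push_cast
    field_simp
  have hint : ∀ n ∈ S, IntervalIntegrable (fun s =>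
      torusCoeff (fun x => logDiffHigh lam R (U s x) (V s x)) n *
        conj (torusCoeff (fun x => U s x - V s x) n)) volume 0 t := by
    intro n _
    rw [intervalIntegrable_iff_integrableOn_Ioc_of_le ht.1.le]
    refine integrableOn_Ioc_of_measurable_of_bounded (C := 16 * |lam| * (1 + M) * (1 + 4 * M))
      ((measurable_torusCoeff (measurable_logDiffHigh hU hV lam R) n).mul
        (Complex.continuous_conj.measurable.comp (measurable_torusCoeff hW.measurable n)))
      (fun s => ?_) 0 t
    simp only [Pi.mul_apply, Function.comp_apply, norm_mul, RCLike.norm_conj]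
    exact mul_le_mul (norm_torusCoeff_logDiffHigh_le hU hV lam R n s) (hW.norm_torusCoeff_le n s)
      (norm_nonneg _) ((norm_nonneg _).trans (norm_torusCoeff_logDiffHigh_le hU hV lam R n s))
  rw [intervalIntegral.integral_finsetSum hint]
  simp only [← hpair]
  have hsum := hasSum_sum fun n (_ : n ∈ S) => hasSum_integral_mul_conj_timeChar hT (hHmem n) (hZmem n)
  rw [← Finset.mul_sum] at hsum
  have hbound : ‖(T : ℂ) * ∑ n ∈ S, ∫ s in (0 : ℝ)..T, torusCoeff (H s) n *
      conj (torusCoeff (Z s) n)‖ ≤ T * ε := by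
    refine le_of_tendsto' hsum.norm fun A => ?_
    rw [← Finset.sum_product' (s := A) (t := S) (f := fun k n =>
      (∫ s in (0 : ℝ)..T, torusCoeff (H s) n * conj (timeChar T k s)) *
        conj (∫ s in (0 : ℝ)..T, torusCoeff (Z s) n * conj (timeChar T k s)))]
    refine (norm_sum_le _ _).trans ?_
    have h1 := mul_le_mul_of_nonneg_left (hC H hHL (A ×ˢ S)) (inv_nonneg.2 hδ.le)
    have h2 := mul_le_mul_of_nonneg_left (hD (A ×ˢ S)) hδ.le
    have h3 : δ⁻¹ * (C * (∫ p, ‖Function.uncurry H p‖ ^ (4 / 3 : ℝ)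
        ∂(spaceTimeMeasure 1 T)) ^ (3 / 2 : ℝ)) ≤ T * ε / 2 := by
      refine le_trans ?_ hR.le
      refine mul_le_mul_of_nonneg_left (mul_le_mul_of_nonneg_left ?_ hC0) (inv_nonneg.2 hδ.le)
      exact Real.rpow_le_rpow (integral_nonneg fun p => by positivity) hHint (by norm_num)
    have h4 := add_le_add (h1.trans h3) (h2.trans hδε)
    rw [Finset.mul_sum, Finset.mul_sum, ← Finset.sum_add_distrib, add_halves] at h4
    refine le_trans (Finset.sum_le_sum fun γ _ => ?_) h4
    rw [norm_mul, RCLike.norm_conj]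
    set p := ‖∫ s in (0 : ℝ)..T, torusCoeff (H s) γ.2 * conj (timeChar T γ.1 s)‖
    set q := ‖∫ s in (0 : ℝ)..T, torusCoeff (Z s) γ.2 * conj (timeChar T γ.1 s)‖
    have hw := parabolaWeight_pos T γ
    set w := parabolaWeight T γ
    have h5 : δ⁻¹ * (p ^ 2 / w) + δ * (w * q ^ 2) - p * q =
        (δ * w)⁻¹ * ((p - δ * w * q / 2) ^ 2 + 3 / 4 * (δ * w * q) ^ 2) := by
      field_simp
      ring
    have h6 : 0 ≤ (δ * w)⁻¹ * ((p - δ * w * q / 2) ^ 2 + 3 / 4 * (δ * w * q) ^ 2) := by positivity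
    linarith
  rw [norm_mul, Complex.norm_real, Real.norm_of_nonneg hT.le] at hbound
  exact le_of_mul_le_mul_left hbound hT

end dimensionOne

theorem SobolevTorus.sum_torusCoeff_le {d : ℕ} {s : ℝ} (f : SobolevTorus d s)
    (S : Finset (Fin d → ℤ)) :
    ∑ n ∈ S, (1 + laplaceEigenvalue n) ^ s * ‖torusCoeff f.toL2 n‖ ^ 2 ≤ ‖f‖ ^ 2 := by
  have h := lp.sum_rpow_le_norm_rpow (p := 2) (by norm_num) (SobolevTorus.toSeq f) S
  have h0 : ‖f‖ = ‖SobolevTorus.toSeq f‖ := rfl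
  simp only [ENNReal.toReal_ofNat, Real.rpow_ofNat] at h
  rw [h0]
  refine (Finset.sum_congr rfl fun n _ => ?_).trans_le h
  have h3 : (SobolevTorus.toSeq f : (Fin d → ℤ) → ℂ) n = weightedCoeff s f.toL2 n := rfl
  rw [h3, weightedCoeff_eq_repr, mFourierBasis_repr_eq_torusCoeff, norm_mul, mul_pow,
    Complex.norm_real, Real.norm_eq_abs, sq_abs]
  congr 1
  rw [sobolevWeight, laplaceEigenvalue, ← Real.rpow_mul_natCast (by positivity)]
  congr 1
  push_cast
  ring

theorem SobolevTorus.norm_toL2_le {d : ℕ} {s : ℝ} (hs : 0 ≤ s) (f : SobolevTorus d s) :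
    ‖f.toL2‖ ≤ ‖f‖ := by
  refine (sq_le_sq₀ (norm_nonneg _) (norm_nonneg _)).1 ?_
  have h : HasSum (fun n => ‖torusCoeff f.toL2 n‖ ^ 2) (‖f.toL2‖ ^ 2) := by
    have h := lp.hasSum_norm (p := 2) (by norm_num) (UnitAddTorus.mFourierBasis.repr f.toL2)
    simpa only [ENNReal.toReal_ofNat, Real.rpow_ofNat, mFourierBasis_repr_eq_torusCoeff,
      LinearIsometryEquiv.norm_map] using h
  refine hasSum_le_of_sum_le h fun S => le_trans (Finset.sum_le_sum fun n _ => ?_)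
    (f.sum_torusCoeff_le S)
  refine le_mul_of_one_le_left (sq_nonneg _) (Real.one_le_rpow ?_ hs)
  have : 0 ≤ laplaceEigenvalue n := by unfold laplaceEigenvalue; positivity
  linarith

theorem SobolevTorus.toL2_injective {d : ℕ} {s : ℝ} :
    Function.Injective (SobolevTorus.toL2 (d := d) (s := s)) :=
  Subtype.val_injective

theorem SobolevTorus.continuous_toL2 {d : ℕ} {s : ℝ} (hs : 0 ≤ s) :
    Continuous (SobolevTorus.toL2 (d := d) (s := s)) :=
  AddMonoidHomClass.continuous_of_bound SobolevTorus.toL2 1 fun f => by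
    rw [one_mul]
    exact f.norm_toL2_le hs

theorem exists_forall_ae_norm_le {α E : Type*} [MeasurableSpace α] {ν : Measure α}
    [NormedAddCommGroup E] (u v : Lp E ⊤ ν) :
    ∃ K : ℝ, 1 ≤ K ∧ (∀ᵐ t ∂ν, ‖u t‖ ≤ K) ∧ ∀ᵐ t ∂ν, ‖v t‖ ≤ K := by
  have key : ∀ w : Lp E ⊤ ν, ∀ᵐ t ∂ν, ‖w t‖ ≤ ‖w‖ := fun w => by
    have hw := Lp.eLpNorm_lt_top w
    rw [eLpNorm_exponent_top] at hw
    filter_upwards [ae_le_eLpNormEssSup (f := w) (μ := ν)] with t ht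
    rw [Lp.norm_def, eLpNorm_exponent_top, ← toReal_enorm]
    exact ENNReal.toReal_mono hw.ne ht
  refine ⟨max 1 (max ‖u‖ ‖v‖), le_max_left _ _, ?_, ?_⟩
  · exact (key u).mono fun t ht => ht.trans ((le_max_left _ _).trans (le_max_right _ _))
  · exact (key v).mono fun t ht => ht.trans ((le_max_right _ _).trans (le_max_right _ _))

theorem ae_Icc_eq_of_ae_Ioc {d : ℕ} {T : ℝ} {U V : ℝ → UnitAddTorus (Fin d) → ℂ}
    {u v : ℝ → L2Torus d}
    (hUu : ∀ᵐ t ∂volume.restrict (Set.Icc 0 T), U t =ᵐ[torusMeasure d] u t)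
    (hVv : ∀ᵐ t ∂volume.restrict (Set.Icc 0 T), V t =ᵐ[torusMeasure d] v t)
    (h : ∀ᵐ t ∂volume.restrict (Set.Ioc 0 T), U t =ᵐ[torusMeasure d] V t) :
    u =ᵐ[volume.restrict (Set.Icc 0 T)] v := by
  rw [Measure.restrict_congr_set Ioc_ae_eq_Icc] at h
  filter_upwards [hUu, hVv, h] with t h1 h2 h3
  exact Lp.ext (h1.symm.trans (h3.trans h2))

theorem sq_integrable_logDiff {d : ℕ} {lam C M : ℝ} {U V : ℝ → UnitAddTorus (Fin d) → ℂ}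
    (hU : IsBoundedCurve M U) (hV : IsBoundedCurve M V) {t : ℝ}
    (h1 : Integrable (fun x => ‖logNonlinearity lam (U t x)‖ ^ 2) (torusMeasure d) ∧
      ∫ x, ‖logNonlinearity lam (U t x)‖ ^ 2 ∂(torusMeasure d) ≤ C)
    (h2 : Integrable (fun x => ‖logNonlinearity lam (V t x)‖ ^ 2) (torusMeasure d) ∧
      ∫ x, ‖logNonlinearity lam (V t x)‖ ^ 2 ∂(torusMeasure d) ≤ C) :
    Integrable (fun x => ‖logDiff lam (U t x) (V t x)‖ ^ (2 : ℝ)) (torusMeasure d) ∧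
      ∫ x, ‖logDiff lam (U t x) (V t x)‖ ^ (2 : ℝ) ∂(torusMeasure d) ≤ 2 * (C + C) := by
  have hi := (h1.1.add h2.1).const_mul 2
  have hle : ∀ x, ‖logDiff lam (U t x) (V t x)‖ ^ (2 : ℝ) ≤
      2 * (‖logNonlinearity lam (U t x)‖ ^ 2 + ‖logNonlinearity lam (V t x)‖ ^ 2) := fun x => by
    rw [Real.rpow_ofNat, logDiff]
    have := norm_sub_le (logNonlinearity lam (U t x)) (logNonlinearity lam (V t x))
    nlinarith [norm_nonneg (logNonlinearity lam (U t x) - logNonlinearity lam (V t x)),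
      sq_nonneg (‖logNonlinearity lam (U t x)‖ - ‖logNonlinearity lam (V t x)‖)]
  have h3 : Integrable (fun x => ‖logDiff lam (U t x) (V t x)‖ ^ (2 : ℝ)) (torusMeasure d) :=
    hi.mono' (((measurable_logDiff hU hV lam).comp
      measurable_prodMk_left).norm.pow_const _).aestronglyMeasurable (.of_forall fun x => by
        rw [Real.norm_of_nonneg (by positivity)]
        exact hle x)
  refine ⟨h3, (integral_mono h3 hi hle).trans ?_⟩
  simp only [Pi.add_apply]
  rw [integral_const_mul, integral_add h1.1 h2.1]
  linarith [h1.2, h2.2]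

theorem weakHsSolution_unique {d : ℕ} (hd : 1 ≤ d) {lam T s : ℝ} (hT : 0 < T) (hs : 0 < s)
    {u₀ : SobolevTorus d s} {u v : Lp (SobolevTorus d s) ∞ (volume.restrict (Set.Icc (0 : ℝ) T))}
    (hu : IsWeakHsSolution lam T u₀ u) (hv : IsWeakHsSolution lam T u₀ v) : u = v := by
  obtain ⟨K, hK, huK, hvK⟩ := exists_forall_ae_norm_le u v
  have hc := SobolevTorus.continuous_toL2 (d := d) hs.le
  obtain ⟨U, hU, hUu⟩ := exists_isBoundedCurve
    (hc.comp_aestronglyMeasurable (Lp.aestronglyMeasurable u))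
    (huK.mono fun t ht => ((u t).norm_toL2_le hs.le).trans ht) (by linarith)
  obtain ⟨V, hV, hVv⟩ := exists_isBoundedCurve
    (hc.comp_aestronglyMeasurable (Lp.aestronglyMeasurable v))
    (hvK.mono fun t ht => ((v t).norm_toL2_le hs.le).trans ht) (by linarith)
  obtain ⟨C, hC⟩ := exists_integral_logNonlinearity_sq_le (d := d) hs hK lam hd
  have hEq := fourierDifferenceEquation hU hV hT hUu hVv hu.1 hu.2 hv.1 hv.2
  have hsum : ∀ {W : ℝ → UnitAddTorus (Fin d) → ℂ} {t : ℝ} {f : SobolevTorus d s},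
      W t =ᵐ[torusMeasure d] f.toL2 → ‖f‖ ≤ K → ∀ S : Finset (Fin d → ℤ),
      ∑ n ∈ S, (1 + laplaceEigenvalue n) ^ s * ‖torusCoeff (W t) n‖ ^ 2 ≤ K ^ 2 := by
    intro W t f hW hf S
    simp only [torusCoeff_congr_ae hW]
    exact (f.sum_torusCoeff_le S).trans (pow_le_pow_left₀ (norm_nonneg _) hf 2)
  have hsq : ∀ᵐ t ∂volume.restrict (Set.Icc 0 T),
      Integrable (fun x => ‖logDiff lam (U t x) (V t x)‖ ^ (2 : ℝ)) (torusMeasure d) ∧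
        ∫ x, ‖logDiff lam (U t x) (V t x)‖ ^ (2 : ℝ) ∂(torusMeasure d) ≤ 2 * (C + C) := by
    filter_upwards [hUu, hVv, huK, hvK] with t h1 h2 h3 h4
    exact sq_integrable_logDiff hU hV
      (hC _ (hU.memLp t) (hU.measurable_apply t) (hsum h1 h3))
      (hC _ (hV.memLp t) (hV.measurable_apply t) (hsum h2 h4))
  have h := ae_eq_of_high_part_small hU hV hT hEq fun t ht ε hε =>
    high_part_small_of_sq_integrable hU hV ht.1.le (ae_mono (Measure.restrict_mono
      (Set.Ioc_subset_Icc_self.trans (Set.Icc_subset_Icc_right ht.2.le)) le_rfl) hsq) hε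
  exact Lp.ext ((ae_Icc_eq_of_ae_Ioc hUu hVv h).mono fun t ht => SobolevTorus.toL2_injective ht)

theorem weakL2Solution_unique {lam T : ℝ} (hT : 0 < T) {u₀ : L2Torus 1}
    {u v : Lp (L2Torus 1) ∞ (volume.restrict (Set.Icc (0 : ℝ) T))}
    (hu : IsWeakL2Solution lam T u₀ u) (hv : IsWeakL2Solution lam T u₀ v) : u = v := by
  obtain ⟨K, hK, huK, hvK⟩ := exists_forall_ae_norm_le u v
  obtain ⟨U, hU, hUu⟩ := exists_isBoundedCurve (Lp.aestronglyMeasurable u) huK (by linarith)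
  obtain ⟨V, hV, hVv⟩ := exists_isBoundedCurve (Lp.aestronglyMeasurable v) hvK (by linarith)
  have hEq := fourierDifferenceEquation hU hV hT hUu hVv hu.1 hu.2 hv.1 hv.2
  exact Lp.ext (ae_Icc_eq_of_ae_Ioc hUu hVv (ae_eq_of_high_part_small hU hV hT hEq
    fun _ ht _ hε => high_part_small_of_dim_one hU hV hT hEq ht hε))

theorem theorem1p5 :
    (∀ (d : ℕ), 1 ≤ d → ∀ (lam : ℝ), lam ≠ 0 → ∀ (T : ℝ), 0 < T → ∀ (s : ℝ), 0 < s → s < 1 →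
      ∀ (u₀ : SobolevTorus d s)
        (u v : Lp (SobolevTorus d s) ∞ (volume.restrict (Set.Icc (0 : ℝ) T))),
        IsWeakHsSolution lam T u₀ u → IsWeakHsSolution lam T u₀ v → u = v) ∧
    (∀ (lam : ℝ), lam ≠ 0 → ∀ (T : ℝ), 0 < T →
      ∀ (u₀ : L2Torus 1)
        (u v : Lp (L2Torus 1) ∞ (volume.restrict (Set.Icc (0 : ℝ) T))),
        IsWeakL2Solution lam T u₀ u → IsWeakL2Solution lam T u₀ v → u = v) :=
  ⟨fun _ hd _ _ _ hT _ hs _ _ _ _ hu hv => weakHsSolution_unique hd hT hs hu hv,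
    fun _ _ _ hT _ _ _ hu hv => weakL2Solution_unique hT hu hv⟩
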